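/- **Discretization of transforms for graphs embedded in $\mathbb R^2$.** *Setting.* A complex is a finite geometric simplicial complex $K$ in $\mathbb R^2$; an embedded graph is a complex all of whose simplices have dimension at most one (edges are straight segments meeting only in common endpoints). For $s\in\mathbb S^1$ let $h_s(\sigma)=\max_{v\in\sigma} s\cdot v$ be the lower-star filter function. A compatible index filtration of $(K,h_s)$ lists the simplices $\sigma_1,\dots,\sigma_n$ with faces before cofaces and $h_s(\sigma_1)\le\dots\le h_s(\sigma_n)$. With homology over a field $F$, the $k$-dimensional augmented persistence diagram (APD) in direction $s$ is the multiset of the points $(h_s(\sigma_i),h_s(\sigma_j))$, where $(i,j)$ (possibly $j=\infty$, $h_s(\sigma_\infty)=\infty$) runs over the points of the $k$-dimensional persistence diagram of the index filtration; the $k$-th augmented Betti curve in direction $s$ records the triple $(h_s(\sigma_i),h_s(\sigma_j),b)$ for each maximal interval $[i,j)$ on which the $k$-th Betti number of the index filtration is constantly $b$. The PHT (the BCT) assigns to $K$ and $s$ all these diagrams (all these curves). Any compatible index filtrations may be chosen for each $K$ and $s$. A transform, assigning to each complex $K$ and direction $s$ a descriptor $D(K,s)$, is dimension-returning if $D(K,s)$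 determines, for all $k$ and $c$, the number of $k$-simplices $\sigma$ of $K$ with $h_s(\sigma)=c$. A finite set $S$ of directions is a faithful discretization of $D$ for $K$ if the only complex $K'$ with $D(K',s)=D(K,s)$ for all $s\in S$ is $K'=K$. A set $V\subset\mathbb R^2$ is in general position if any three of its points are affinely independent (equivalently, not collinear) and no two have the same first coordinate. *Algorithm.* The algorithm knows $G$ only through an oracle that returns APDs for a direction. It queries $e_1$, $e_2$ and a tilt $s$ of $e_1$ towards $e_2$ (the normalization of $(1-\varepsilon)e_1+\varepsilon e_2$, where, for the smallest gap $g$ between distinct heights of vertices in direction $e_1$ and the spread $m$ of the heights in direction $e_2$, $\varepsilon=\frac{g}{2(g+m)}$, or $\varepsilon=\frac12$ if there are no two distinct heights), and computes the vertices from the sorted births in directions $e_1$ and $s$. It then queries $-e_1$ and sweeps the vertices $x$ in ascending order in direction $e_1$, finding the edges from $x$ to vertices above $x$ by binary search: starting from the list of all the vertices above $x$ in clockwise order around $x$, a list of $k\ge2$ vertices containing at least one neighbour of $x$ is split into its first $\lfloor k/2\rfloor$ and its remaining vertices, and the numbers of neighbours in the two parts are found by querying the directions $s$ and $-s$, with $s=\big(\cos(\alpha-\frac\pi2-\frac\theta2),\sin(\alpha-\frac\pi2-\frac\theta2)\big)$,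 where $\alpha$ is the oriented angle from $e_1$ to the vector from $x$ to the $\lfloor k/2\rfloor$-th vertex of the list and $\theta$ is the smallest angle between two lines through $x$ and other vertices; the first part is processed before the second, and a list with no neighbour, or with exactly one vertex, is not split. *Claim.* Let $G$ be an embedded graph in $\mathbb R^2$ with vertices in general position, and let $S(G)$ be the set of directions queried by the algorithm on $G$. Then $S(G)$ is a faithful discretization, for $G$, of the PHT, of the BCT, and of every dimension-returning transform. Moreover its size is $\Theta(n_0\log n_0)$ in the worst case: there are absolute constants $a,b>0$ such that for every $n_0\ge2$ the algorithm makes at most $b\,n_0\log n_0$ queries (so $|S(G)|\le b\,n_0\log n_0$) on every such $G$ with $n_0$ vertices, and there is such a $G$ with $n_0$ vertices and $|S(G)|\ge a\,n_0\log n_0$. -/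

import Mathlib

universe u v

set_option maxSynthPendingDepth 3

noncomputable section

namespace DirTransform

/-! ### Geometric simplicial complexes in the plane -/

/-- The Euclidean plane. -/
abbrev Plane := EuclideanSpace ℝ (Fin 2)

/-- The circle of directions. -/
abbrev Direction := Metric.sphere (0 : Plane) 1

/-- A (finite, geometric) simplicial complex in the plane. A simplex is given by its vertex set. -/
@[ext]
structure PlaneComplex extends Geometry.SimplicialComplex ℝ Plane where
  finite_faces : faces.Finite

/-- The vertex set `K₀`. -/
def PlaneComplex.verts (K : PlaneComplex) : Set Plane := {x | {x} ∈ K.faces}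

/-- Embedded (straight-line) graph: every simplex has dimension at most one. -/
def PlaneComplex.IsGraph (K : PlaneComplex) : Prop := ∀ σ ∈ K.faces, σ.card ≤ 2

/-- General position of a set of points of the plane. The second property speaks about the
orthogonal projection to the `(e₁, e₂)`-plane, which is the identity here. -/
structure GeneralPosition (V : Set Plane) : Prop where
  affineIndependent : ∀ t : Finset Plane, (t : Set Plane) ⊆ V → t.card = 3 →
    AffineIndependent ℝ ((↑) : t → Plane)
  not_collinear : ∀ x ∈ V, ∀ y ∈ V, ∀ z ∈ V, x ≠ y → x ≠ z → y ≠ z →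
    ¬ Collinear ℝ ({x, y, z} : Set Plane)
  injOn_fst : Set.InjOn (fun x : Plane => x 0) V

/-- Height of a point in direction `s`. -/
def height (s : Direction) (x : Plane) : ℝ := inner ℝ (s : Plane) x

/-- The lower-star filter function `h_s`: height of the highest vertex of a simplex. -/
def lowerStar (s : Direction) (σ : Finset Plane) : ℝ :=
  if h : σ.Nonempty then σ.sup' h (height s) else 0

/-- Number of `k`-simplices of `K` at height `c` in direction `s`. -/
def simplexCount (K : PlaneComplex) (s : Direction) (k : ℕ) (c : ℝ) : ℕ :=
  {σ : Finset Plane | σ ∈ K.faces ∧ σ.card = k + 1 ∧ lowerStar s σ = c}.ncard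

/-! ### Simplicial homology with coefficients in a field -/

section Homology

variable (F : Type u) [Field F]

open Classical in
/-- Incidence sign of the facet `σ \ {x}` in `σ`, for the lexicographic order of the vertices. -/
def incidenceSign (σ : Finset Plane) (x : Plane) : F :=
  (-1) ^ (σ.filter (fun y => toLex y.ofLp < toLex x.ofLp)).card

open Classical in
/-- The simplicial boundary operator (zero on vertices). -/
def boundary : (Finset Plane →₀ F) →ₗ[F] (Finset Plane →₀ F) :=
  Finsupp.linearCombination F (fun σ =>
    if 2 ≤ σ.card then ∑ x ∈ σ, Finsupp.single (σ.erase x) (incidenceSign F σ x) else 0)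

/-- The `k`-chains of a set `A` of simplices. -/
def chains (A : Set (Finset Plane)) (k : ℕ) : Submodule F (Finset Plane →₀ F) :=
  Finsupp.supported F F {σ | σ ∈ A ∧ σ.card = k + 1}

def cycles (A : Set (Finset Plane)) (k : ℕ) : Submodule F (Finset Plane →₀ F) :=
  chains F A k ⊓ LinearMap.ker (boundary F)

def boundaries (A : Set (Finset Plane)) (k : ℕ) : Submodule F (Finset Plane →₀ F) :=
  (chains F A (k + 1)).map (boundary F)

/-- `H_k(A)`, cycles modulo boundaries. -/
abbrev Homology (A : Set (Finset Plane)) (k : ℕ) : Type u :=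
  ↥(cycles F A k) ⧸ (boundaries F A k).submoduleOf (cycles F A k)

theorem chains_mono {A B : Set (Finset Plane)} (h : A ⊆ B) (k : ℕ) :
    chains F A k ≤ chains F B k :=
  Finsupp.supported_mono (fun _ hσ => ⟨h hσ.1, hσ.2⟩)

theorem cycles_mono {A B : Set (Finset Plane)} (h : A ⊆ B) (k : ℕ) :
    cycles F A k ≤ cycles F B k :=
  inf_le_inf_right _ (chains_mono F h k)

/-- The map `H_k(A) → H_k(B)` induced by an inclusion `A ⊆ B`. -/
def homologyMap {A B : Set (Finset Plane)} (h : A ⊆ B) (k : ℕ) :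
    Homology F A k →ₗ[F] Homology F B k :=
  Submodule.mapQ _ _ (Submodule.inclusion (cycles_mono F h k))
    (fun _ hx => Submodule.map_mono (chains_mono F h (k + 1)) hx)

end Homology

/-! ### Index filtrations -/

/-- An index filtration of `K` compatible with `f`: the simplices are listed one by one, no simplex
before one of its faces, and in the order of their `f`-values. -/
structure IndexFiltration (K : PlaneComplex) (f : Finset Plane → ℝ) where
  list : List (Finset Plane)
  nodup : list.Nodup
  mem_iff : ∀ σ, σ ∈ list ↔ σ ∈ K.faces
  ordered : list.Pairwise (fun σ τ => f σ ≤ f τ ∧ ¬ τ ⊂ σ)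

theorem nonempty_indexFiltration (K : PlaneComplex) (s : Direction) :
    Nonempty (IndexFiltration K (lowerStar s)) := by
  classical
  let key : Finset Plane → ℝ ×ₗ ℕ := fun σ => toLex (lowerStar s σ, σ.card)
  let r : Finset Plane → Finset Plane → Prop := fun σ τ => key σ ≤ key τ
  have : Std.Total r := ⟨fun a b => le_total (key a) (key b)⟩
  have : IsTrans (Finset Plane) r := ⟨fun a b c h1 h2 => le_trans h1 h2⟩
  let l := K.finite_faces.toFinset.toList.insertionSort r
  refine ⟨⟨l, ?_, ?_, ?_⟩⟩
  · exact (List.perm_insertionSort r _).nodup_iff.2 (Finset.nodup_toList _)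
  · intro σ
    rw [(List.perm_insertionSort r _).mem_iff]
    simp
  · refine (List.pairwise_insertionSort r K.finite_faces.toFinset.toList).imp_of_mem ?_
    intro σ τ _ hτl h
    have hτ : τ.Nonempty := by
      rw [(List.perm_insertionSort r _).mem_iff] at hτl
      exact K.nonempty_of_mem_faces (by simpa using hτl)
    have h' : key σ ≤ key τ := h
    rw [Prod.Lex.toLex_le_toLex] at h'
    rcases h' with h' | ⟨h1, h2⟩
    · refine ⟨le_of_lt h', fun hs => ?_⟩
      have hle : lowerStar s τ ≤ lowerStar s σ := by
        have hσ : σ.Nonempty := hτ.mono hs.1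
        simp only [lowerStar, hτ, hσ, dif_pos]
        exact Finset.sup'_mono _ hs.1 hτ
      exact absurd h' (not_lt.2 hle)
    · exact ⟨le_of_eq h1, fun hs => absurd (Finset.card_lt_card hs) (not_lt.2 h2)⟩

/-- The first `i` simplices of an index filtration. -/
def stage (l : List (Finset Plane)) (i : ℕ) : Set (Finset Plane) := {σ | σ ∈ l.take i}

theorem stage_mono (l : List (Finset Plane)) {i j : ℕ} (h : i ≤ j) : stage l i ⊆ stage l j :=
  fun _ hσ => (List.take_sublist_take_left h).subset hσ

/-- The `f`-value of the `i`-th simplex (counted from `1`); the index `0` stands for `-∞` and every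
index larger than the length of the list for `+∞`. -/
def eventTime (f : Finset Plane → ℝ) (l : List (Finset Plane)) : ℕ → EReal
  | 0 => ⊥
  | i + 1 => (l[i]?).elim ⊤ (fun σ => ((f σ : ℝ) : EReal))

/-! ### Augmented persistence diagrams -/

section Descriptors

variable (F : Type u) [Field F]

/-- `β_k^{i,j}`, the rank of `H_k(F_i) → H_k(F_j)`, for the index filtration `l` and
`i ≤ j ≤ l.length`. It is zero for `j > l.length`, that is, at `j = ∞`. -/
def persistentBetti (l : List (Finset Plane)) (k i j : ℕ) : ℕ :=
  if h : i ≤ j ∧ j ≤ l.length then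
    Module.finrank F (LinearMap.range (homologyMap F (stage_mono l h.1) k))
  else 0

/-- The multiplicity `μ_k^{(i,j)}` of the point `(i, j)` in the diagram of the index filtration. -/
def multiplicity (l : List (Finset Plane)) (k i j : ℕ) : ℕ :=
  ((persistentBetti F l k i (j - 1) : ℤ) - persistentBetti F l k i j
    - persistentBetti F l k (i - 1) (j - 1) + persistentBetti F l k (i - 1) j).toNat

/-- The `k`-dimensional augmented persistence diagram of `f`, computed from a compatible index
filtration `l`. A point `(i, j)` with `j = l.length + 1` is a class that never dies. -/
def apd (f : Finset Plane → ℝ) (l : List (Finset Plane)) (k : ℕ) : Multiset (ℝ × EReal) :=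
  ∑ i ∈ Finset.Icc 1 l.length, ∑ j ∈ Finset.Icc (i + 1) (l.length + 1),
    multiplicity F l k i j • {(f (l.getD (i - 1) ∅), eventTime f l j)}

/-! ### Augmented Betti curves -/

/-- The Betti number `β_k(A)`. -/
def betti (A : Set (Finset Plane)) (k : ℕ) : ℕ := Module.finrank F (Homology F A k)

/-- `[i, j)` is a maximal interval on which the `k`-th Betti curve of the index filtration is
constant. -/
def IsConstancyInterval (l : List (Finset Plane)) (k i j : ℕ) : Prop :=
  i < j ∧ j ≤ l.length + 1 ∧
  (∀ m, i ≤ m → m < j → betti F (stage l m) k = betti F (stage l i) k) ∧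
  (i = 0 ∨ betti F (stage l (i - 1)) k ≠ betti F (stage l i) k) ∧
  (j = l.length + 1 ∨ betti F (stage l j) k ≠ betti F (stage l i) k)

open Classical in
/-- The `k`-th augmented Betti curve of `f`, computed from a compatible index filtration `l`: the
decorated step function that takes the value `b` on `[f(σ_i), f(σ_j))` for each maximal interval
`[i, j)` on which the `k`-th Betti curve of the index filtration is constantly `b`. It is recorded as
the multiset of all `(f(σ_i), f(σ_j), b)`; the empty intervals are the decorations. -/
def abc (f : Finset Plane → ℝ) (l : List (Finset Plane)) (k : ℕ) :
    Multiset (EReal × EReal × ℕ) :=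
  ((Finset.range (l.length + 1) ×ˢ Finset.range (l.length + 2)).filter
    (fun p => IsConstancyInterval F l k p.1 p.2)).val.map
    (fun p => (eventTime f l p.1, eventTime f l p.2, betti F (stage l p.1) k))

/-! ### Transforms and their discretizations -/

/-- A choice of a compatible index filtration for every lower-star filtration. -/
abbrev IndexChoice := ∀ (K : PlaneComplex) (s : Direction), IndexFiltration K (lowerStar s)

/-- The persistent homology transform: all directional augmented persistence diagrams. -/
def pht (ι : IndexChoice) (K : PlaneComplex) (s : Direction) : ℕ → Multiset (ℝ × EReal) :=
  apd F (lowerStar s) (ι K s).list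

/-- The Betti curve transform: all directional augmented Betti curves. -/
def bct (ι : IndexChoice) (K : PlaneComplex) (s : Direction) :
    ℕ → Multiset (EReal × EReal × ℕ) :=
  abc F (lowerStar s) (ι K s).list

end Descriptors

/-- A transform (a descriptor for each complex and each direction) is dimension-returning if the
descriptor in direction `s` contains the heights in direction `s` and the dimensions of all the
simplices (with multiplicity). -/
def DimensionReturning {α : Type v} (D : PlaneComplex → Direction → α) : Prop :=
  ∀ (s : Direction) (K K' : PlaneComplex), D K s = D K' s →
    ∀ k c, simplexCount K s k c = simplexCount K' s k c

/-- The finite set `S` of directions gives a faithful discretization of the transform `D` of `K`: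
no other complex has the same descriptors in all the directions of `S`. -/
def IsFaithfulDiscretization {α : Type v} (D : PlaneComplex → Direction → α) (K : PlaneComplex)
    (S : Finset Direction) : Prop :=
  ∀ K' : PlaneComplex, (∀ s ∈ S, D K' s = D K s) → K' = K

/-! ### The reconstruction algorithm

For a complex of dimension at most one in the plane the algorithm consists of the reconstruction of
the vertices and the reconstruction of the edges. It knows the complex only through an oracle that
returns, for a direction, the augmented persistence diagrams in this direction. -/

/-- Oracle: direction and dimension to augmented persistence diagram. -/
abbrev Oracle := Direction → ℕ → Multiset (ℝ × EReal)

def e₁ : Direction := ⟨EuclideanSpace.single 0 1, by simp⟩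

def e₂ : Direction := ⟨EuclideanSpace.single 1 1, by simp⟩

/-- The direction of a nonzero vector. -/
def directionOf (x : Plane) : Direction :=
  if h : x = 0 then e₁ else ⟨‖x‖⁻¹ • x, by simp [norm_smul, h]⟩

/-- The direction `(cos t, sin t)`. -/
def dirOfAngle (t : ℝ) : Direction :=
  ⟨!₂[Real.cos t, Real.sin t], by simp [EuclideanSpace.norm_eq]⟩

/-- The sorted list of birth times of a diagram. -/
def births (D : Multiset (ℝ × EReal)) : List ℝ := (D.map Prod.fst).sort (· ≤ ·)

open Classical in
/-- Half of the first parameter `t > 0` at which two of the lines `(1 - t) h + t h'`, with `h ∈ H`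
and `h' ∈ H'`, that start at different points cross: this happens for the closest heights of `H` and
the extreme heights of `H'`. If no two heights of `H` differ, any parameter will do. -/
def tiltParameter (H H' : List ℝ) : ℝ :=
  let gap := sInf {t : ℝ | ∃ a ∈ H, ∃ b ∈ H, a < b ∧ t = b - a}
  let spread := sSup {t : ℝ | ∃ a ∈ H', ∃ b ∈ H', t = b - a}
  if ∃ a ∈ H, ∃ b ∈ H, a < b then gap / (gap + spread) / 2 else 1 / 2

/-- The tilt from `s` towards `s'`, for the lists `H`, `H'` of heights in these directions. -/
def tilt (s s' : Direction) (H H' : List ℝ) : Direction :=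
  directionOf ((1 - tiltParameter H H') • (s : Plane) + tiltParameter H H' • (s' : Plane))

/-- The tilt of `e₁` towards `e₂` used for the vertices. -/
def vertexTilt (O : Oracle) : Direction := tilt e₁ e₂ (births (O e₁ 0)) (births (O e₂ 0))

/-- Reconstruction of the vertices, in ascending order in direction `e₁`: first coordinates from the
births in direction `e₁`, second coordinates from the births in the tilted direction, which come in
the same order. -/
def findVerts (O : Oracle) : List Plane :=
  let s : Plane := vertexTilt O
  List.zipWith (fun h t => !₂[h, (t - s 0 * h) / s 1])
    (births (O e₁ 0)) (births (O (vertexTilt O) 0))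

open Classical in
/-- The number of edges at height `c` in direction `s`, read off from the diagrams: deaths in
dimension `0` and births in dimension `1`. It is the indegree of a vertex at height `c` if there is
only one. -/
def indegree (O : Oracle) (s : Direction) (c : ℝ) : ℕ :=
  (O s 0).countP (fun p => p.2 = (c : EReal)) + (O s 1).countP (fun p => p.1 = c)

/-- The oriented angle from `e₁` to the vector from `x` to `y`. -/
def angleFrom (x y : Plane) : ℝ := Complex.arg ⟨y 0 - x 0, y 1 - x 1⟩

/-- The minimal angle between two of the lines through `x` and the other points of `V`. -/
def minAngle (V : List Plane) (x : Plane) : ℝ :=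
  sInf {t : ℝ | ∃ a ∈ V, ∃ b ∈ V, a ≠ x ∧ b ≠ x ∧ a ≠ b ∧
    t = min (EuclideanGeometry.angle a x b) (Real.pi - EuclideanGeometry.angle a x b)}

/-- The splitting direction for the middle vertex `y` around `x`. -/
def splitDir (x y : Plane) (θ : ℝ) : Direction :=
  dirOfAngle (angleFrom x y - Real.pi / 2 - θ / 2)

open Classical in
/-- Simultaneous binary search for the edges from `x` to vertices of the edge interval `I`, a list of
vertices in clockwise order around `x`. Here `c` is the number of these edges, `E` the list of the
neighbours of `x` known so far, and `w` the number of edges in the edge intervals further on the stack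
(which come after `I` in the clockwise order). An interval with an edge and with at least two vertices
is split into halves that are below and above `x` in the direction `s`; the numbers of edges in the
two halves come from the indegrees of `x` in the directions `s` and `-s`, and the left half is
processed before the right half. Result: the known neighbours and the list of queried directions. -/
def searchInterval (O : Oracle) (x : Plane) (θ : ℝ) (I : List Plane) (c w : ℕ) (E : List Plane) :
    List Plane × List Direction :=
  if c = 0 then (E, [])
  else if I.length = 0 then (E, [])
  else if I.length = 1 then (E ++ I, [])
  else
    let i := I.length / 2
    let s := splitDir x (I.getD (i - 1) x) θ
    let cl := indegree O s (height s x) - E.countP (fun y => height s y < height s x)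
    let cr := indegree O (-s) (height (-s) x) - E.countP (fun y => height s x < height s y) - w
    let left := searchInterval O x θ (I.take i) cl (w + cr) E
    let right := searchInterval O x θ (I.drop i) cr w left.1
    (right.1, s :: -s :: (left.2 ++ right.2))
termination_by I.length
decreasing_by
  all_goals simp only [List.length_take, List.length_drop]; omega

/-- The vertices of `V` above `x` in direction `e₁`, in clockwise order around `x`. -/
def upVerts (V : List Plane) (x : Plane) : List Plane :=
  (V.filter (fun y => height e₁ x < height e₁ y)).insertionSort
    (fun y z => angleFrom x z ≤ angleFrom x y)

open Classical in
/-- The step of the sweep at the vertex `x`. The state consists of the edges `(lower, upper)` found so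
far and of the directions queried so far. -/
def sweepStep (O : Oracle) (V : List Plane) (st : List (Plane × Plane) × List Direction)
    (x : Plane) : List (Plane × Plane) × List Direction :=
  let known := V.filter (fun y => (y, x) ∈ st.1)
  let r := searchInterval O x (minAngle V x) (upVerts V x)
    (indegree O (-e₁) (height (-e₁) x)) 0 known
  (st.1 ++ (r.1.filter (fun y => height e₁ x < height e₁ y)).map (fun y => (x, y)), st.2 ++ r.2)

/-- Reconstruction of the edges by a sweep in direction `e₁`. -/
def findEdges (O : Oracle) (V : List Plane) : List (Plane × Plane) × List Direction :=
  V.foldl (sweepStep O V) ([], [-e₁])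

/-- The list of all the directions in which the algorithm queries the oracle. -/
def queries (O : Oracle) : List Direction :=
  e₁ :: e₂ :: vertexTilt O :: (findEdges O (findVerts O)).2

open Classical in
/-- The set of all the directions in which the algorithm queries the oracle. -/
def queriedDirections (O : Oracle) : Finset Direction := (queries O).toFinset

end DirTransform

end

open DirTransform

open DirTransform

namespace DirTransform

/-! ### Linear algebra of simplicial chains -/

section ChainAlgebra

variable (F : Type u) [Field F]

/-! Everything the algorithm reads from the oracle is a number of vertices or edges at a given
height. Passing from one stage of an index filtration to the next, a simplex of dimension k + 1
either enlarges the space of (k + 1)-cycles or that of k-boundaries, and the births and deaths of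
the diagrams are exactly these two kinds of growth (`sum_multiplicity_birth`,
`sum_multiplicity_death`). So diagrams return dimensions. Augmented Betti curves do too: a birth
raises a Betti number by one, a death lowers it by one, and the decorations keep every such jump
(`jumpSum_abc`).

Faithfulness is the correctness of the algorithm, applied twice to the same oracle. `Consistent`
isolates what correctness needs: in the queried directions the answers agree with the counts of a
complex. `algorithm_spec` shows that the run then outputs the vertices and edges of that complex. A
competitor with the counts of G is consistent with the oracle of G, so both are described by one
output (`eq_of_simplexCount_eq`). Correctness itself rests on two geometric facts: the tilt is small
enough to keep the order of the first coordinates (`tiltParameter_spec`), and a splitting line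
through x meets no other vertex and separates the two halves of the list (`AngleBound`,
`searchInterval_split`).

For the upper bound, a search makes at most a logarithmic number of splits per neighbour found, each
edge is searched from its left endpoint only, and there are at most 3 n₀ edges. The linear edge
bound is proved without Euler's formula, by charging each edge that is not the topmost one at its
left endpoint to a vertex, at most two edges to each (`ncard_orientedEdges_le`).

For the lower bound, a path runs through points of a parabola with abscissae -2 ^ k. Each vertex
after the first has a neighbour among the k vertices to its right, which costs at least log₂ k
splits. The slopes seen from the k-th vertex lie between -2 ^ (k + 1) and -2 ^ k, so different
vertices use different directions (`sum_length_parabolaSplits_le`). -/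

theorem boundary_single (σ : Finset Plane) (a : F) :
    boundary F (Finsupp.single σ a) = if 2 ≤ σ.card then
      ∑ x ∈ σ, Finsupp.single (σ.erase x) (a * incidenceSign F σ x) else 0 := by
  classical
  unfold boundary
  rw [Finsupp.linearCombination_single]
  split_ifs with h
  · rw [Finset.smul_sum]
    refine Finset.sum_congr rfl fun x _ => ?_
    rw [Finsupp.smul_single, smul_eq_mul]
  · simp

theorem incidenceSign_erase_of_lt {σ : Finset Plane} {x y : Plane} (hx : x ∈ σ)
    (h : toLex x.ofLp < toLex y.ofLp) :
    incidenceSign F (σ.erase x) y = - incidenceSign F σ y := by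
  classical
  unfold incidenceSign
  have hmem : x ∈ σ.filter (fun z => toLex z.ofLp < toLex y.ofLp) := by simp [hx, h]
  have : ((σ.erase x).filter (fun z => toLex z.ofLp < toLex y.ofLp)) =
      (σ.filter (fun z => toLex z.ofLp < toLex y.ofLp)).erase x := by
    rw [Finset.filter_erase]
  rw [this, ← Finset.card_erase_add_one hmem, pow_succ]
  ring

theorem incidenceSign_erase_of_not_lt {σ : Finset Plane} {x y : Plane}
    (h : ¬ toLex x.ofLp < toLex y.ofLp) :
    incidenceSign F (σ.erase x) y = incidenceSign F σ y := by
  classical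
  unfold incidenceSign
  have : ((σ.erase x).filter (fun z => toLex z.ofLp < toLex y.ofLp)) =
      (σ.filter (fun z => toLex z.ofLp < toLex y.ofLp)) := by
    rw [Finset.filter_erase, Finset.erase_eq_of_notMem]
    simp [h]
  rw [this]

/-- Deleting the smaller of the two vertices lowers the position of the larger by one, while
deleting the larger leaves the position of the smaller alone. Exactly one of the two products
changes sign. -/
theorem incidenceSign_anticomm {σ : Finset Plane} {x y : Plane} (hx : x ∈ σ) (hy : y ∈ σ)
    (hxy : x ≠ y) :
    incidenceSign F σ x * incidenceSign F (σ.erase x) y +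
      incidenceSign F σ y * incidenceSign F (σ.erase y) x = 0 := by
  have hne : toLex x.ofLp ≠ toLex y.ofLp := fun h => hxy (WithLp.ofLp_injective 2 (toLex.injective h))
  rcases lt_or_gt_of_ne hne with h | h
  · rw [incidenceSign_erase_of_lt F hx h, incidenceSign_erase_of_not_lt F h.not_gt]; ring
  · rw [incidenceSign_erase_of_lt F hy h, incidenceSign_erase_of_not_lt F h.not_gt]; ring

theorem boundary_boundary (c : Finset Plane →₀ F) : boundary F (boundary F c) = 0 := by
  classical
  suffices h : (boundary F).comp (boundary F) = 0 by
    simpa using congrArg (fun g : (Finset Plane →₀ F) →ₗ[F] (Finset Plane →₀ F) => g c) h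
  refine Finsupp.lhom_ext fun σ a => ?_
  rw [LinearMap.comp_apply, boundary_single, LinearMap.zero_apply]
  split_ifs with h2
  swap
  · simp
  rw [map_sum]
  -- Edges are treated apart: `boundary` is set to zero on vertices, so the expansion of the double
  -- boundary is valid only from triangles on.
  by_cases h3 : 3 ≤ σ.card
  swap
  · refine Finset.sum_eq_zero fun x hx => ?_
    rw [boundary_single, if_neg]
    rw [Finset.card_erase_of_mem hx]; omega
  have : ∀ x ∈ σ, boundary F (Finsupp.single (σ.erase x) (a * incidenceSign F σ x)) =
      ∑ y ∈ σ.erase x, Finsupp.single ((σ.erase x).erase y)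
        (a * incidenceSign F σ x * incidenceSign F (σ.erase x) y) := by
    intro x hx
    rw [boundary_single, if_pos]
    rw [Finset.card_erase_of_mem hx]; omega
  rw [Finset.sum_congr rfl this, Finset.sum_sigma']
  -- Swapping the order in which two vertices are deleted pairs each term with its negative.
  refine Finset.sum_involution (fun p _ => ⟨p.2, p.1⟩) ?_ ?_ ?_ ?_
  · rintro ⟨x, y⟩ hp
    simp only [Finset.mem_sigma, Finset.mem_erase] at hp
    rw [Finset.erase_right_comm, ← Finsupp.single_add]
    have := incidenceSign_anticomm F hp.1 hp.2.2 (Ne.symm hp.2.1)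
    rw [mul_assoc, mul_assoc, ← mul_add, this, mul_zero, Finsupp.single_zero]
  · rintro ⟨x, y⟩ hp _ heq
    simp only [Finset.mem_sigma, Finset.mem_erase] at hp
    simp only [Sigma.mk.injEq] at heq
    exact hp.2.1 heq.1
  · rintro ⟨x, y⟩ hp
    simp only [Finset.mem_sigma, Finset.mem_erase] at hp ⊢
    exact ⟨hp.2.2, Ne.symm hp.2.1, hp.1⟩
  · rintro ⟨x, y⟩ hp
    rfl

/-- A set of simplices closed under nonempty faces. -/
def FaceClosed (A : Set (Finset Plane)) : Prop :=
  ∀ σ ∈ A, ∀ τ ⊆ σ, τ.Nonempty → τ ∈ A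

theorem finiteDimensional_chains {A : Set (Finset Plane)} (hA : A.Finite) (k : ℕ) :
    FiniteDimensional F (chains F A k) := by
  have : Finite {σ | σ ∈ A ∧ σ.card = k + 1} := (hA.subset fun _ h => h.1).to_subtype
  exact Module.Finite.equiv (Finsupp.supportedEquivFinsupp (R := F) (M := F)
    {σ | σ ∈ A ∧ σ.card = k + 1}).symm

theorem finrank_chains {A : Set (Finset Plane)} (hA : A.Finite) (k : ℕ) :
    Module.finrank F (chains F A k) = {σ | σ ∈ A ∧ σ.card = k + 1}.ncard := by
  have hfin : {σ | σ ∈ A ∧ σ.card = k + 1}.Finite := hA.subset fun _ h => h.1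
  have := hfin.fintype
  rw [chains, LinearEquiv.finrank_eq (Finsupp.supportedEquivFinsupp (R := F) (M := F)
    {σ | σ ∈ A ∧ σ.card = k + 1}), Module.finrank_finsupp_self, Set.ncard_eq_toFinset_card',
    Set.toFinset_card]

theorem finiteDimensional_cycles {A : Set (Finset Plane)} (hA : A.Finite) (k : ℕ) :
    FiniteDimensional F (cycles F A k) := by
  have := finiteDimensional_chains F hA k
  exact Submodule.finiteDimensional_of_le (inf_le_left : cycles F A k ≤ chains F A k)

theorem finiteDimensional_boundaries {A : Set (Finset Plane)} (hA : A.Finite) (k : ℕ) :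
    FiniteDimensional F (boundaries F A k) := by
  have := finiteDimensional_chains F hA (k + 1)
  exact inferInstanceAs (FiniteDimensional F ((chains F A (k + 1)).map (boundary F)))

/-- Rank-nullity for the boundary operator on (k + 1)-chains. Each summand depends on the topology
of `A`, but the sum only counts simplices; this is why births and deaths together return dimensions.
-/
theorem finrank_cycles_add_finrank_boundaries {A : Set (Finset Plane)} (hA : A.Finite) (k : ℕ) :
    Module.finrank F (cycles F A (k + 1)) + Module.finrank F (boundaries F A k) =
      {σ | σ ∈ A ∧ σ.card = k + 2}.ncard := by
  have := finiteDimensional_chains F hA (k + 1)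
  rw [← finrank_chains F hA (k + 1),
    ← LinearMap.finrank_range_add_finrank_ker ((boundary F).domRestrict (chains F A (k + 1))),
    LinearMap.range_domRestrict, LinearMap.ker_domRestrict, add_comm]
  congr 1
  have h : cycles F A (k + 1) = ((LinearMap.ker (boundary F)).submoduleOf
      (chains F A (k + 1))).map (chains F A (k + 1)).subtype := by
    rw [Submodule.submoduleOf, Submodule.map_comap_subtype]; rfl
  rw [h, Submodule.submoduleOf]
  exact LinearEquiv.finrank_eq (Submodule.equivSubtypeMap _ _).symm

theorem boundary_mem_chains {A : Set (Finset Plane)} (hA : FaceClosed A) {k : ℕ}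
    {c : Finset Plane →₀ F} (hc : c ∈ chains F A (k + 1)) : boundary F c ∈ chains F A k := by
  classical
  have : chains F A (k + 1) ≤ (chains F A k).comap (boundary F) := by
    rw [chains, Finsupp.supported_eq_span_single, Submodule.span_le]
    rintro _ ⟨σ, ⟨hσ, hcard⟩, rfl⟩
    rw [SetLike.mem_coe, Submodule.mem_comap, boundary_single, if_pos (by omega)]
    refine Submodule.sum_mem _ fun x hx => Finsupp.single_mem_supported F _ ?_
    have hc : (σ.erase x).card = k + 1 := by rw [Finset.card_erase_of_mem hx]; omega
    exact ⟨hA σ hσ _ (Finset.erase_subset _ _) (Finset.card_pos.1 (by omega)), hc⟩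
  exact this hc

theorem boundaries_le_cycles {A : Set (Finset Plane)} (hA : FaceClosed A) (k : ℕ) :
    boundaries F A k ≤ cycles F A k := by
  rintro _ ⟨c, hc, rfl⟩
  exact ⟨boundary_mem_chains F hA hc, boundary_boundary F c⟩

theorem cycles_zero (A : Set (Finset Plane)) : cycles F A 0 = chains F A 0 := by
  refine inf_eq_left.2 ?_
  rw [chains, Finsupp.supported_eq_span_single, Submodule.span_le]
  rintro _ ⟨σ, ⟨hσ, hcard⟩, rfl⟩
  rw [SetLike.mem_coe, LinearMap.mem_ker, boundary_single, if_neg (by omega)]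

theorem chains_insert_of_card_ne {A : Set (Finset Plane)} {σ : Finset Plane} {k : ℕ}
    (h : σ.card ≠ k + 1) : chains F (insert σ A) k = chains F A k := by
  unfold chains
  congr 1
  ext τ
  simp only [Set.mem_insert_iff, Set.mem_ofPred_eq]
  constructor
  · rintro ⟨rfl | h1, h2⟩
    · exact absurd h2 h
    · exact ⟨h1, h2⟩
  · exact fun h => ⟨Or.inr h.1, h.2⟩

theorem cycles_insert_of_card_ne {A : Set (Finset Plane)} {σ : Finset Plane} {k : ℕ}
    (h : σ.card ≠ k + 1) : cycles F (insert σ A) k = cycles F A k := by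
  rw [cycles, chains_insert_of_card_ne F h]; rfl

theorem boundaries_insert_of_card_ne {A : Set (Finset Plane)} {σ : Finset Plane} {k : ℕ}
    (h : σ.card ≠ k + 2) : boundaries F (insert σ A) k = boundaries F A k := by
  rw [boundaries, chains_insert_of_card_ne F h]; rfl

theorem boundaries_mono {A B : Set (Finset Plane)} (h : A ⊆ B) (k : ℕ) :
    boundaries F A k ≤ boundaries F B k :=
  Submodule.map_mono (chains_mono F h (k + 1))

theorem ncard_insert_simplices {A : Set (Finset Plane)} (hA : A.Finite) {σ : Finset Plane}
    (hσ : σ ∉ A) {k : ℕ} (h : σ.card = k) :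
    {τ | τ ∈ insert σ A ∧ τ.card = k}.ncard = {τ | τ ∈ A ∧ τ.card = k}.ncard + 1 := by
  have : {τ | τ ∈ insert σ A ∧ τ.card = k} = insert σ {τ | τ ∈ A ∧ τ.card = k} := by
    ext τ
    simp only [Set.mem_insert_iff, Set.mem_ofPred_eq]
    constructor
    · rintro ⟨rfl | h1, h2⟩
      · exact Or.inl rfl
      · exact Or.inr ⟨h1, h2⟩
    · rintro (rfl | h1)
      · exact ⟨Or.inl rfl, h⟩
      · exact ⟨Or.inr h1.1, h1.2⟩
  rw [this, Set.ncard_insert_of_notMem (fun h => hσ h.1) (hA.subset fun _ h => h.1)]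

/-- The map from cycles of `A` to the homology of `B` has the same range and kills the cycles that
bound in `B`. Ranks between quotients become dimensions of intersections in one ambient space. -/
theorem finrank_range_homologyMap {A B : Set (Finset Plane)} (h : A ⊆ B) (hA : A.Finite) (k : ℕ) :
    Module.finrank F (LinearMap.range (homologyMap F h k)) +
      Module.finrank F ↥(cycles F A k ⊓ boundaries F B k) = Module.finrank F (cycles F A k) := by
  have := finiteDimensional_cycles F hA k
  set g : cycles F A k →ₗ[F] Homology F B k :=
    ((boundaries F B k).submoduleOf (cycles F B k)).mkQ ∘ₗ
      Submodule.inclusion (cycles_mono F h k) with hg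
  have h1 : LinearMap.range (homologyMap F h k) = LinearMap.range g := by
    have h0 : g = homologyMap F h k ∘ₗ ((boundaries F A k).submoduleOf (cycles F A k)).mkQ := rfl
    rw [h0, LinearMap.range_comp_of_range_eq_top _ (Submodule.range_mkQ _)]
  have h2 : LinearMap.ker g = (boundaries F B k).submoduleOf (cycles F A k) := by
    rw [hg, LinearMap.ker_comp, Submodule.ker_mkQ]
    ext c
    simp [Submodule.submoduleOf]
  have h3 : cycles F A k ⊓ boundaries F B k = ((boundaries F B k).submoduleOf
      (cycles F A k)).map (cycles F A k).subtype := by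
    rw [Submodule.submoduleOf, Submodule.map_comap_subtype]
  rw [h1, h3, ← LinearMap.finrank_range_add_finrank_ker g, h2]
  congr 1
  exact LinearEquiv.finrank_eq (Submodule.equivSubtypeMap _ _).symm

theorem betti_add_finrank_boundaries {A : Set (Finset Plane)} (hA : A.Finite) (hc : FaceClosed A)
    (k : ℕ) :
    betti F A k + Module.finrank F (boundaries F A k) = Module.finrank F (cycles F A k) := by
  have := finiteDimensional_cycles F hA k
  have h1 := Submodule.finrank_quotient_add_finrank
    ((boundaries F A k).submoduleOf (cycles F A k))
  rw [← h1, betti]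
  congr 1
  exact (LinearEquiv.finrank_eq (Submodule.submoduleOfEquivOfLe
    (boundaries_le_cycles F hc k))).symm

end ChainAlgebra

/-! ### Index filtrations -/

theorem stage_zero (l : List (Finset Plane)) : stage l 0 = ∅ := by
  ext σ; simp [stage]

theorem finite_stage (l : List (Finset Plane)) (i : ℕ) : (stage l i).Finite :=
  (l.take i).finite_toSet

theorem stage_succ (l : List (Finset Plane)) {i : ℕ} (hi : i < l.length) :
    stage l (i + 1) = insert l[i] (stage l i) := by
  ext σ
  simp only [stage, List.take_add_one, List.mem_append, Set.mem_insert_iff, Set.mem_ofPred_eq,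
    List.getElem?_eq_getElem hi, Option.toList_some, List.mem_singleton]
  exact or_comm

theorem getElem_notMem_stage {l : List (Finset Plane)} (hl : l.Nodup) {i : ℕ} (hi : i < l.length) :
    l[i] ∉ stage l i := by
  intro h
  obtain ⟨j, hj, he⟩ := List.mem_take_iff_getElem.1 h
  have := (hl.getElem_inj_iff (hi := by omega) (hj := hi)).1 he
  omega

theorem IndexFiltration.faceClosed_stage {K : PlaneComplex} {f : Finset Plane → ℝ}
    (L : IndexFiltration K f) (i : ℕ) : FaceClosed (stage L.list i) := by
  intro σ hσ τ hτσ hτ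
  have hσK : σ ∈ K.faces := (L.mem_iff σ).1 (List.mem_of_mem_take hσ)
  have hτl : τ ∈ L.list := (L.mem_iff τ).2 (K.down_closed hσK hτσ hτ)
  obtain ⟨m, hm, rfl⟩ := List.mem_take_iff_getElem.1 hσ
  obtain ⟨j, hj, rfl⟩ := List.mem_iff_getElem.1 hτl
  refine List.mem_take_iff_getElem.2 ⟨j, ?_, rfl⟩
  rw [lt_min_iff] at hm ⊢
  refine ⟨?_, hj⟩
  by_contra hji
  have hmj : m < j := by omega
  refine (List.pairwise_iff_getElem.1 L.ordered m j hm.2 hj hmj).2 ⟨hτσ, fun h => ?_⟩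
  have := (L.nodup.getElem_inj_iff (hi := hm.2) (hj := hj)).1 (h.antisymm hτσ)
  omega

/-! ### Ranks of cycles and boundaries along an index filtration -/

section Dimensions

variable (F : Type u) [Field F]

/-- Dimension of the space of `k`-cycles of the `i`-th stage. -/
noncomputable def cycleRank (l : List (Finset Plane)) (k i : ℕ) : ℕ :=
  Module.finrank F (cycles F (stage l i) k)

/-- Dimension of the space of `k`-boundaries of the `i`-th stage. -/
noncomputable def boundaryRank (l : List (Finset Plane)) (k i : ℕ) : ℕ :=
  Module.finrank F (boundaries F (stage l i) k)

theorem cycleRank_mono (l : List (Finset Plane)) (k i : ℕ) :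
    cycleRank F l k i ≤ cycleRank F l k (i + 1) := by
  have := finiteDimensional_cycles F (finite_stage l (i + 1)) k
  exact Submodule.finrank_mono (cycles_mono F (stage_mono l (Nat.le_succ i)) k)

theorem boundaryRank_mono (l : List (Finset Plane)) (k i : ℕ) :
    boundaryRank F l k i ≤ boundaryRank F l k (i + 1) := by
  have := finiteDimensional_boundaries F (finite_stage l (i + 1)) k
  exact Submodule.finrank_mono (boundaries_mono F (stage_mono l (Nat.le_succ i)) k)

theorem cycleRank_succ_add_boundaryRank {l : List (Finset Plane)} (hl : l.Nodup) (k : ℕ) {i : ℕ}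
    (hi : i < l.length) :
    cycleRank F l (k + 1) (i + 1) + boundaryRank F l k (i + 1) =
      cycleRank F l (k + 1) i + boundaryRank F l k i + if l[i].card = k + 2 then 1 else 0 := by
  unfold cycleRank boundaryRank
  split_ifs with h
  · rw [finrank_cycles_add_finrank_boundaries F (finite_stage l _),
      finrank_cycles_add_finrank_boundaries F (finite_stage l _), stage_succ l hi,
      ncard_insert_simplices (finite_stage l i) (getElem_notMem_stage hl hi) h]
  · rw [stage_succ l hi, cycles_insert_of_card_ne F h, boundaries_insert_of_card_ne F h, add_zero]

theorem cycleRank_zero_succ {l : List (Finset Plane)} (hl : l.Nodup) {i : ℕ}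
    (hi : i < l.length) :
    cycleRank F l 0 (i + 1) = cycleRank F l 0 i + if l[i].card = 1 then 1 else 0 := by
  unfold cycleRank
  rw [cycles_zero, cycles_zero, finrank_chains F (finite_stage l _),
    finrank_chains F (finite_stage l _), stage_succ l hi]
  split_ifs with h
  · rw [ncard_insert_simplices (finite_stage l i) (getElem_notMem_stage hl hi) h]
  · rw [add_zero]
    congr 1
    ext τ
    simp only [Set.mem_insert_iff, Set.mem_ofPred_eq]
    constructor
    · rintro ⟨rfl | h1, h2⟩
      · exact absurd h2 h
      · exact ⟨h1, h2⟩
    · exact fun h => ⟨Or.inr h.1, h.2⟩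

/-- New k-boundaries require the added simplex to have dimension k + 1, and then there are no new
k-chains. Hence boundaries of a stage are cycles one stage earlier, which makes the end terms of the
telescoping sums computable. -/
theorem boundaries_stage_succ_le_cycles {l : List (Finset Plane)}
    (hc : ∀ i, FaceClosed (stage l i)) (k : ℕ) {i : ℕ} (hi : i < l.length) :
    boundaries F (stage l (i + 1)) k ≤ cycles F (stage l i) k := by
  by_cases h : l[i].card = k + 2
  · refine (boundaries_le_cycles F (hc (i + 1)) k).trans_eq ?_
    rw [stage_succ l hi, cycles_insert_of_card_ne F (by omega)]
  · rw [stage_succ l hi, boundaries_insert_of_card_ne F h]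
    exact boundaries_le_cycles F (hc i) k

open Classical in
/-- The `k`-boundaries of the `j`-th stage; at the index `∞` everything bounds. -/
noncomputable def extBoundaries (l : List (Finset Plane)) (k j : ℕ) :
    Submodule F (Finset Plane →₀ F) :=
  if j ≤ l.length then boundaries F (stage l j) k else ⊤

theorem extBoundaries_mono (l : List (Finset Plane)) (k j : ℕ) :
    extBoundaries F l k j ≤ extBoundaries F l k (j + 1) := by
  unfold extBoundaries
  split_ifs with h1 h2 h2
  · exact boundaries_mono F (stage_mono l (Nat.le_succ j)) k
  · exact le_top
  · omega
  · exact le_rfl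

/-- Dimension of the space of the `k`-cycles of stage `i` that bound at stage `j`. -/
noncomputable def bounding (l : List (Finset Plane)) (k i j : ℕ) : ℕ :=
  Module.finrank F ↥(cycles F (stage l i) k ⊓ extBoundaries F l k j)

theorem persistentBetti_add_bounding (l : List (Finset Plane)) (k : ℕ) {i j : ℕ} (h : i ≤ j) :
    persistentBetti F l k i j + bounding F l k i j = cycleRank F l k i := by
  unfold persistentBetti bounding extBoundaries
  by_cases hj : j ≤ l.length
  · rw [dif_pos ⟨h, hj⟩, if_pos hj]
    exact finrank_range_homologyMap F (stage_mono l h) (finite_stage l i) k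
  · rw [dif_neg (fun h' => hj h'.2), if_neg hj, inf_top_eq, zero_add]; rfl

/-- The dimension formula for two subspaces whose sum lies in the largest of the four intersections
and whose intersection is the smallest. It says that the alternating sum in `multiplicity` is
nonnegative, so that `toNat` loses nothing. -/
theorem bounding_supermodular (l : List (Finset Plane)) (k i j : ℕ) :
    bounding F l k (i + 1) j + bounding F l k i (j + 1) ≤
      bounding F l k (i + 1) (j + 1) + bounding F l k i j := by
  unfold bounding
  have hZ := cycles_mono F (stage_mono l (Nat.le_succ i)) k
  have hB := extBoundaries_mono F l k j
  have := finiteDimensional_cycles F (finite_stage l i) k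
  have := finiteDimensional_cycles F (finite_stage l (i + 1)) k
  set Z := cycles F (stage l i) k
  set Z' := cycles F (stage l (i + 1)) k
  set B := extBoundaries F l k j
  set B' := extBoundaries F l k (j + 1)
  rw [← Submodule.finrank_sup_add_finrank_inf_eq (Z' ⊓ B) (Z ⊓ B')]
  refine add_le_add (Submodule.finrank_mono (sup_le (inf_le_inf_left _ hB)
    (inf_le_inf_right _ hZ))) (le_of_eq ?_)
  have : Z' ⊓ B ⊓ (Z ⊓ B') = Z ⊓ B := by
    rw [inf_inf_inf_comm, inf_eq_right.2 hZ, inf_eq_left.2 hB]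
  rw [this]

theorem multiplicity_eq (l : List (Finset Plane)) (k : ℕ) {i j : ℕ} (h : i + 1 ≤ j) :
    (multiplicity F l k (i + 1) (j + 1) : ℤ) =
      (bounding F l k (i + 1) (j + 1) - bounding F l k i (j + 1)) -
        (bounding F l k (i + 1) j - bounding F l k i j) := by
  have h1 := persistentBetti_add_bounding F l k h
  have h2 := persistentBetti_add_bounding F l k (Nat.le_succ_of_le h)
  have h3 := persistentBetti_add_bounding F l k (Nat.le_of_succ_le h)
  have h4 := persistentBetti_add_bounding F l k (Nat.le_succ_of_le (Nat.le_of_succ_le h))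
  have h5 := bounding_supermodular F l k i j
  unfold multiplicity
  simp only [Nat.add_sub_cancel, Nat.succ_eq_add_one] at *
  omega

theorem bounding_zero (l : List (Finset Plane)) (k j : ℕ) : bounding F l k 0 j = 0 := by
  unfold bounding
  have : cycles F (stage l 0) k = ⊥ := by
    rw [stage_zero, eq_bot_iff]
    refine inf_le_left.trans ?_
    simp [chains]
  rw [this, bot_inf_eq, finrank_bot]

theorem bounding_last (l : List (Finset Plane)) (k i : ℕ) :
    bounding F l k i (l.length + 1) = cycleRank F l k i := by
  unfold bounding extBoundaries cycleRank
  rw [if_neg (by omega), inf_top_eq]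

theorem bounding_eq_boundaryRank (l : List (Finset Plane)) (k : ℕ) {i j : ℕ} (hj : j ≤ l.length)
    (h : boundaries F (stage l j) k ≤ cycles F (stage l i) k) :
    bounding F l k i j = boundaryRank F l k j := by
  unfold bounding extBoundaries boundaryRank
  rw [if_pos hj, inf_eq_right.2 h]

/-- The sum telescopes in `j`. At infinity every cycle bounds, which leaves the difference of cycle
ranks; at the lower end both terms equal the boundary rank of stage `i + 1` and cancel. -/
theorem sum_multiplicity_birth {l : List (Finset Plane)} (hc : ∀ i, FaceClosed (stage l i)) (k : ℕ)
    {i : ℕ} (hi : i < l.length) :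
    (∑ j ∈ Finset.Icc (i + 1 + 1) (l.length + 1), (multiplicity F l k (i + 1) j : ℤ)) =
      cycleRank F l k (i + 1) - cycleRank F l k i := by
  have h : Finset.Icc (i + 1 + 1) (l.length + 1) =
      (Finset.Ico (i + 1) (l.length + 1)).map (addRightEmbedding 1) := by
    rw [Finset.map_add_right_Ico]; rfl
  rw [h, Finset.sum_map]
  obtain ⟨g, hg⟩ : ∃ g : ℕ → ℤ, ∀ j, g j = bounding F l k (i + 1) j - bounding F l k i j :=
    ⟨_, fun _ => rfl⟩
  have h2 : ∀ j ∈ Finset.Ico (i + 1) (l.length + 1),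
      (multiplicity F l k (i + 1) (addRightEmbedding 1 j) : ℤ) = g (j + 1) - g j := by
    intro j hj
    rw [hg, hg]
    exact multiplicity_eq F l k (Finset.mem_Ico.1 hj).1
  rw [Finset.sum_congr rfl h2, Finset.sum_Ico_sub _ (by omega), hg, hg]
  simp only [bounding_last]
  rw [bounding_eq_boundaryRank F l k hi (boundaries_le_cycles F (hc _) k),
    bounding_eq_boundaryRank F l k hi (boundaries_stage_succ_le_cycles F hc k hi)]
  ring

/-- The sum telescopes in `i`: the empty stage has no cycles, and stage `j` already contains all
cycles that bound at stage `j + 1`. -/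
theorem sum_multiplicity_death {l : List (Finset Plane)} (hc : ∀ i, FaceClosed (stage l i)) (k : ℕ)
    {j : ℕ} (hj : j < l.length) :
    (∑ i ∈ Finset.range j, (multiplicity F l k (i + 1) (j + 1) : ℤ)) =
      boundaryRank F l k (j + 1) - boundaryRank F l k j := by
  obtain ⟨g, hg⟩ : ∃ g : ℕ → ℤ, ∀ i, g i = bounding F l k i (j + 1) - bounding F l k i j :=
    ⟨_, fun _ => rfl⟩
  have h2 : ∀ i ∈ Finset.range j,
      (multiplicity F l k (i + 1) (j + 1) : ℤ) = g (i + 1) - g i := by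
    intro i hi
    rw [multiplicity_eq F l k (Finset.mem_range.1 hi), hg, hg]
    ring
  rw [Finset.sum_congr rfl h2, Finset.sum_range_sub, hg, hg]
  simp only [bounding_zero]
  rw [bounding_eq_boundaryRank F l k hj (boundaries_stage_succ_le_cycles F hc k hj),
    bounding_eq_boundaryRank F l k hj.le (boundaries_le_cycles F (hc _) k)]
  ring

end Dimensions

/-! ### Births and deaths -/

section Counting

variable (F : Type u) [Field F]

theorem countP_apd (f : Finset Plane → ℝ) (l : List (Finset Plane)) (k : ℕ)
    (p : ℝ × EReal → Prop) [DecidablePred p] :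
    (apd F f l k).countP p =
      ∑ i ∈ Finset.range l.length, ∑ j ∈ Finset.Icc (i + 1 + 1) (l.length + 1),
        if p (f (l.getD i ∅), eventTime f l j) then multiplicity F l k (i + 1) j else 0 := by
  have h : Finset.Icc 1 l.length = (Finset.range l.length).map (addRightEmbedding 1) := by
    rw [Finset.range_eq_Ico, Finset.map_add_right_Ico]; rfl
  unfold apd
  rw [← Multiset.coe_countPAddMonoidHom, map_sum, h, Finset.sum_map]
  refine Finset.sum_congr rfl fun i _ => ?_
  rw [map_sum]
  refine Finset.sum_congr rfl fun j _ => ?_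
  rw [map_nsmul, Multiset.coe_countPAddMonoidHom, Multiset.countP_eq_card_filter,
    Multiset.filter_singleton]
  simp only [addRightEmbedding_apply, Nat.add_sub_cancel]
  split_ifs <;> simp

open Classical in
theorem births_apd {f : Finset Plane → ℝ} {l : List (Finset Plane)}
    (hc : ∀ i, FaceClosed (stage l i)) (k : ℕ) (c : ℝ) :
    ((apd F f l k).countP (fun p => p.1 = c) : ℤ) =
      ∑ i ∈ Finset.range l.length,
        if f (l.getD i ∅) = c then (cycleRank F l k (i + 1) - cycleRank F l k i : ℤ) else 0 := by
  rw [countP_apd]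
  push_cast
  refine Finset.sum_congr rfl fun i hi => ?_
  split_ifs with h
  · simp only [← sum_multiplicity_birth F hc k (Finset.mem_range.1 hi)]
  · simp

theorem eventTime_succ (f : Finset Plane → ℝ) {l : List (Finset Plane)} {j : ℕ}
    (hj : j < l.length) : eventTime f l (j + 1) = (f (l.getD j ∅) : EReal) := by
  simp [eventTime, List.getElem?_eq_getElem hj]

theorem eventTime_last (f : Finset Plane → ℝ) (l : List (Finset Plane)) :
    eventTime f l (l.length + 1) = ⊤ := by
  simp [eventTime]

open Classical in
theorem deaths_apd {f : Finset Plane → ℝ} {l : List (Finset Plane)}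
    (hc : ∀ i, FaceClosed (stage l i)) (k : ℕ) (c : ℝ) :
    ((apd F f l k).countP (fun p => p.2 = (c : EReal)) : ℤ) =
      ∑ j ∈ Finset.range l.length,
        if f (l.getD j ∅) = c then (boundaryRank F l k (j + 1) - boundaryRank F l k j : ℤ)
          else 0 := by
  rw [countP_apd]
  push_cast
  rw [Finset.sum_comm' (t' := Finset.Icc 2 (l.length + 1)) (s' := fun j => Finset.range (j - 1))
    (h := by intro i j; simp only [Finset.mem_range, Finset.mem_Icc]; omega)]
  have h : Finset.Icc 2 (l.length + 1) =
      (Finset.Ico 1 (l.length + 1)).map (addRightEmbedding 1) := by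
    rw [Finset.map_add_right_Ico]; rfl
  rw [h, Finset.sum_map]
  have hlast : (c : EReal) ≠ ⊤ := EReal.coe_ne_top c
  have key : ∀ j, j < l.length → (∑ i ∈ Finset.range j,
      if eventTime f l (j + 1) = (c : EReal) then (multiplicity F l k (i + 1) (j + 1) : ℤ) else 0) =
      if f (l.getD j ∅) = c then (boundaryRank F l k (j + 1) - boundaryRank F l k j : ℤ)
          else 0 := by
    intro j hj
    simp only [eventTime_succ f hj, EReal.coe_eq_coe_iff]
    split_ifs with h
    · exact sum_multiplicity_death F hc k hj
    · simp
  -- The index `j = l.length` stands for death at infinity, which never equals the real height `c`.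
  have key2 : ∀ j ∈ Finset.Ico 0 (l.length + 1), (∑ i ∈ Finset.range j,
      if eventTime f l (j + 1) = (c : EReal) then (multiplicity F l k (i + 1) (j + 1) : ℤ) else 0) =
      if j < l.length ∧ f (l.getD j ∅) = c then
        (boundaryRank F l k (j + 1) - boundaryRank F l k j : ℤ) else 0 := by
    intro j hj
    rcases (Nat.lt_succ_iff.1 (Finset.mem_Ico.1 hj).2).lt_or_eq with h | rfl
    · rw [key j h]; simp [h]
    · rw [eventTime_last, if_neg (by simp)]
      simp [hlast.symm]
  have h1 : (∑ j ∈ Finset.Ico 0 (l.length + 1), ∑ i ∈ Finset.range j,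
      if eventTime f l (j + 1) = (c : EReal) then (multiplicity F l k (i + 1) (j + 1) : ℤ) else 0) =
      ∑ j ∈ Finset.Ico 1 (l.length + 1), ∑ i ∈ Finset.range j,
      if eventTime f l (j + 1) = (c : EReal) then
        (multiplicity F l k (i + 1) (j + 1) : ℤ) else 0 := by
    rw [Finset.sum_eq_sum_Ico_succ_bot (by omega)]; simp
  refine Eq.trans ?_ (h1.symm.trans ?_)
  · refine Finset.sum_congr rfl fun j _ => ?_
    simp
  · rw [Finset.sum_congr rfl key2, ← Finset.range_eq_Ico, Finset.sum_range_succ]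
    simp only [lt_irrefl, false_and, if_false, add_zero]
    refine Finset.sum_congr rfl fun j hj => ?_
    simp [Finset.mem_range.1 hj]

open Classical in
theorem simplexCount_eq_sum {K : PlaneComplex} {s : Direction}
    (L : IndexFiltration K (lowerStar s)) (k : ℕ) (c : ℝ) :
    simplexCount K s k c = ∑ i ∈ Finset.range L.list.length,
      if lowerStar s (L.list.getD i ∅) = c then
        (if (L.list.getD i ∅).card = k + 1 then 1 else 0) else 0 := by
  have h1 : {σ : Finset Plane | σ ∈ K.faces ∧ σ.card = k + 1 ∧ lowerStar s σ = c} =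
      ↑((Finset.range L.list.length).filter (fun i => lowerStar s (L.list.getD i ∅) = c ∧
        (L.list.getD i ∅).card = k + 1) |>.image (fun i => L.list.getD i ∅)) := by
    ext σ
    simp only [Set.mem_ofPred_eq, Finset.coe_image, Set.mem_image, Finset.mem_coe,
      Finset.mem_filter, Finset.mem_range]
    constructor
    · rintro ⟨h1, h2, h3⟩
      obtain ⟨i, hi, rfl⟩ := List.mem_iff_getElem.1 ((L.mem_iff σ).2 h1)
      exact ⟨i, by rw [List.getD_eq_getElem _ _ hi]; exact ⟨hi, h3, h2⟩,
        List.getD_eq_getElem _ _ hi⟩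
    · rintro ⟨i, ⟨hi, h2, h3⟩, rfl⟩
      refine ⟨(L.mem_iff _).1 ?_, h3, h2⟩
      rw [List.getD_eq_getElem _ _ hi]
      exact List.getElem_mem hi
  rw [simplexCount, h1, Set.ncard_coe_finset, Finset.card_image_of_injOn, Finset.card_filter]
  · refine Finset.sum_congr rfl fun i _ => ?_
    split_ifs <;> simp_all
  · intro i hi j hj h
    simp only [Finset.coe_filter, Finset.mem_range, Set.mem_ofPred_eq] at hi hj
    simp only [List.getD_eq_getElem _ _ hi.1, List.getD_eq_getElem _ _ hj.1] at h
    exact (L.nodup.getElem_inj_iff).1 h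

open Classical in
theorem births_zero_apd {K : PlaneComplex} {s : Direction} (L : IndexFiltration K (lowerStar s))
    (c : ℝ) :
    (apd F (lowerStar s) L.list 0).countP (fun p => p.1 = c) = simplexCount K s 0 c := by
  zify
  rw [births_apd F L.faceClosed_stage, simplexCount_eq_sum L]
  push_cast
  refine Finset.sum_congr rfl fun i hi => ?_
  split_ifs with h h2
  · have := cycleRank_zero_succ F L.nodup (Finset.mem_range.1 hi)
    rw [List.getD_eq_getElem _ _ (Finset.mem_range.1 hi)] at h2
    rw [if_pos h2] at this
    rw [this]; push_cast; ring
  · have := cycleRank_zero_succ F L.nodup (Finset.mem_range.1 hi)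
    rw [List.getD_eq_getElem _ _ (Finset.mem_range.1 hi)] at h2
    rw [if_neg h2] at this
    rw [this]; push_cast; ring
  · rfl

open Classical in
theorem births_succ_add_deaths_apd {K : PlaneComplex} {s : Direction}
    (L : IndexFiltration K (lowerStar s)) (k : ℕ) (c : ℝ) :
    (apd F (lowerStar s) L.list k).countP (fun p => p.2 = (c : EReal)) +
      (apd F (lowerStar s) L.list (k + 1)).countP (fun p => p.1 = c) =
        simplexCount K s (k + 1) c := by
  zify
  rw [births_apd F L.faceClosed_stage, deaths_apd F L.faceClosed_stage, simplexCount_eq_sum L,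
    ← Finset.sum_add_distrib]
  push_cast
  refine Finset.sum_congr rfl fun i hi => ?_
  by_cases h : lowerStar s (L.list.getD i ∅) = c
  · have h1 := cycleRank_succ_add_boundaryRank F L.nodup k (Finset.mem_range.1 hi)
    rw [← List.getD_eq_getElem _ ∅ (Finset.mem_range.1 hi)] at h1
    simp only [if_pos h]
    by_cases hk : (L.list.getD i ∅).card = k + 2
    · rw [if_pos hk] at h1 ⊢
      omega
    · rw [if_neg hk] at h1 ⊢
      omega
  · simp only [if_neg h, add_zero]

theorem dimensionReturning_pht (ι : IndexChoice) : DimensionReturning (pht F ι) := by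
  classical
  intro s K K' h k c
  cases k with
  | zero =>
    rw [← births_zero_apd F (ι K s), ← births_zero_apd F (ι K' s)]
    exact congrArg (fun D : ℕ → Multiset (ℝ × EReal) => (D 0).countP (fun p => p.1 = c)) h
  | succ k =>
    rw [← births_succ_add_deaths_apd F (ι K s), ← births_succ_add_deaths_apd F (ι K' s)]
    exact congrArg (fun D : ℕ → Multiset (ℝ × EReal) =>
      (D k).countP (fun p => p.2 = (c : EReal)) + (D (k + 1)).countP (fun p => p.1 = c)) h

theorem indegree_pht (ι : IndexChoice) (K : PlaneComplex) (s : Direction) (c : ℝ) :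
    indegree (pht F ι K) s c = simplexCount K s 1 c :=
  births_succ_add_deaths_apd F (ι K s) 0 c

theorem count_births_pht (ι : IndexChoice) (K : PlaneComplex) (s : Direction) (c : ℝ) :
    (births (pht F ι K s 0)).count c = simplexCount K s 0 c := by
  classical
  rw [← births_zero_apd F (ι K s), births, ← Multiset.coe_count, Multiset.sort_eq,
    Multiset.count_map, Multiset.countP_eq_card_filter]
  congr! 3
  exact eq_comm

end Counting

/-! ### Augmented Betti curves return dimensions -/

section BettiCurves

variable (F : Type u) [Field F]

theorem IsConstancyInterval.right_unique {l : List (Finset Plane)} {k i j j' : ℕ}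
    (h : IsConstancyInterval F l k i j) (h' : IsConstancyInterval F l k i j') : j = j' := by
  obtain ⟨h1, h2, h3, h4, h5⟩ := h
  obtain ⟨h1', h2', h3', h4', h5'⟩ := h'
  rcases lt_trichotomy j j' with hj | hj | hj
  · rcases h5 with h5 | h5
    · omega
    · exact absurd (h3' j h1.le hj) h5
  · exact hj
  · rcases h5' with h5' | h5'
    · omega
    · exact absurd (h3 j' h1'.le hj) h5'

theorem IsConstancyInterval.betti_pred {l : List (Finset Plane)} {k i j : ℕ}
    (h : IsConstancyInterval F l k i j) :
    betti F (stage l (j - 1)) k = betti F (stage l i) k := by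
  have := h.1
  exact h.2.2.1 (j - 1) (by omega) (by omega)

theorem IsConstancyInterval.left_unique {l : List (Finset Plane)} {k i i' j : ℕ}
    (h : IsConstancyInterval F l k i j) (h' : IsConstancyInterval F l k i' j) : i = i' := by
  have e := h.betti_pred
  have e' := h'.betti_pred
  obtain ⟨h1, h2, h3, h4, h5⟩ := h
  obtain ⟨h1', h2', h3', h4', h5'⟩ := h'
  rcases lt_trichotomy i i' with hi | hi | hi
  · rcases h4' with h4' | h4'
    · omega
    · exact absurd ((h3 (i' - 1) (by omega) (by omega)).trans (e.symm.trans e')) h4'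
  · exact hi
  · rcases h4 with h4 | h4
    · omega
    · exact absurd ((h3' (i - 1) (by omega) (by omega)).trans (e'.symm.trans e)) h4

theorem exists_isConstancyInterval_left {l : List (Finset Plane)} {k i : ℕ} (hi : i ≤ l.length)
    (h : i = 0 ∨ betti F (stage l (i - 1)) k ≠ betti F (stage l i) k) :
    ∃ j, IsConstancyInterval F l k i j := by
  classical
  have hex : ∃ j, i < j ∧ (j = l.length + 1 ∨ betti F (stage l j) k ≠ betti F (stage l i) k) :=
    ⟨l.length + 1, by omega, Or.inl rfl⟩
  have hle : Nat.find hex ≤ l.length + 1 := Nat.find_min' hex ⟨by omega, Or.inl rfl⟩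
  refine ⟨Nat.find hex, (Nat.find_spec hex).1, hle, fun m h1 h2 => ?_, h, (Nat.find_spec hex).2⟩
  rcases h1.eq_or_lt with rfl | h1
  · rfl
  · by_contra hne
    exact Nat.find_min hex h2 ⟨h1, Or.inr hne⟩

theorem exists_isConstancyInterval_right {l : List (Finset Plane)} {k j : ℕ} (hj0 : 0 < j)
    (hj : j ≤ l.length + 1)
    (h : j = l.length + 1 ∨ betti F (stage l (j - 1)) k ≠ betti F (stage l j) k) :
    ∃ i, IsConstancyInterval F l k i j := by
  classical
  have hex : ∃ i, i < j ∧ ∀ m, i ≤ m → m < j →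
      betti F (stage l m) k = betti F (stage l (j - 1)) k :=
    ⟨j - 1, by omega, fun m h1 h2 => by rw [show m = j - 1 by omega]⟩
  have hs := Nat.find_spec hex
  have he := hs.2 _ le_rfl hs.1
  refine ⟨Nat.find hex, hs.1, hj, fun m h1 h2 => (hs.2 m h1 h2).trans he.symm, ?_, ?_⟩
  · rcases Nat.eq_zero_or_pos (Nat.find hex) with h0 | h0
    · exact Or.inl h0
    · refine Or.inr fun heq => Nat.find_min hex (m := Nat.find hex - 1) (by omega)
        ⟨by omega, fun m h1 h2 => ?_⟩
      by_cases hm : Nat.find hex ≤ m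
      · exact hs.2 m hm h2
      · rw [show m = Nat.find hex - 1 by omega, heq, he]
  · rw [he]
    exact h.imp_right Ne.symm

/-- Signed count of the start and end values of an augmented Betti curve at height `c`. -/
noncomputable def jumpSum (e : ℤ) (c : ℝ) (C : Multiset (EReal × EReal × ℕ)) : ℤ :=
  (C.map fun t => (if t.1 = (c : EReal) then 1 + e * t.2.2 else 0) -
    (if t.2.1 = (c : EReal) then e * t.2.2 else 0)).sum

theorem eventTime_zero (f : Finset Plane → ℝ) (l : List (Finset Plane)) :
    eventTime f l 0 = ⊥ := rfl

open Classical in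
-- At every change of the Betti number one constancy interval ends and the next begins. With old
-- value b and new value b', the two contribute 1 + e * b' and -e * b, so the multiset of triples
-- determines 1 + e * (b' - b) summed over the changes at height `c`, without knowing which
-- intervals are adjacent.
theorem jumpSum_abc (f : Finset Plane → ℝ) (l : List (Finset Plane)) (k : ℕ) (e : ℤ) (c : ℝ) :
    jumpSum e c (abc F f l k) = ∑ m ∈ Finset.range l.length,
      if f (l.getD m ∅) = c then
        (if betti F (stage l m) k = betti F (stage l (m + 1)) k then 0 else
          1 + e * ((betti F (stage l (m + 1)) k : ℤ) - betti F (stage l m) k)) else 0 := by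
  have hsplit : jumpSum e c (abc F f l k) =
      (∑ i ∈ Finset.range (l.length + 1), ∑ j ∈ Finset.range (l.length + 2),
        if IsConstancyInterval F l k i j then
          (if eventTime f l i = (c : EReal) then 1 + e * (betti F (stage l i) k : ℤ) else 0)
          else 0) -
      ∑ j ∈ Finset.range (l.length + 2), ∑ i ∈ Finset.range (l.length + 1),
        if IsConstancyInterval F l k i j then
          (if eventTime f l j = (c : EReal) then e * (betti F (stage l i) k : ℤ) else 0)
          else 0 := by
    rw [Finset.sum_comm (s := Finset.range (l.length + 2)), ← Finset.sum_sub_distrib]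
    simp only [← Finset.sum_sub_distrib]
    rw [jumpSum, abc, Multiset.map_map, ← Finset.sum_product', ← Finset.sum_filter_add_sum_filter_not
      (Finset.range (l.length + 1) ×ˢ Finset.range (l.length + 2))
      (fun p : ℕ × ℕ => IsConstancyInterval F l k p.1 p.2)]
    rw [Finset.sum_eq_zero (s := Finset.filter (fun p : ℕ × ℕ =>
      ¬ IsConstancyInterval F l k p.1 p.2) _),
      add_zero]
    · refine Finset.sum_congr rfl fun p hp => ?_
      simp only [Function.comp, if_pos (Finset.mem_filter.1 hp).2]
    · intro p hp
      simp only [if_neg (Finset.mem_filter.1 hp).2, sub_zero]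
  have hstart : ∀ i ∈ Finset.range (l.length + 1), (∑ j ∈ Finset.range (l.length + 2),
        if IsConstancyInterval F l k i j then
          (if eventTime f l i = (c : EReal) then 1 + e * (betti F (stage l i) k : ℤ) else 0)
          else 0) = if i = 0 ∨ betti F (stage l (i - 1)) k ≠ betti F (stage l i) k then
          (if eventTime f l i = (c : EReal) then 1 + e * (betti F (stage l i) k : ℤ) else 0)
          else 0 := by
    intro i hi
    by_cases h : i = 0 ∨ betti F (stage l (i - 1)) k ≠ betti F (stage l i) k
    · rw [if_pos h]
      obtain ⟨j, hj⟩ := exists_isConstancyInterval_left F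
        (Nat.lt_succ_iff.1 (Finset.mem_range.1 hi)) h
      rw [Finset.sum_eq_single j]
      · rw [if_pos hj]
      · intro j' _ hne
        rw [if_neg fun h' => hne (h'.right_unique F hj)]
      · intro hn
        exact absurd (Finset.mem_range.2 (Nat.lt_succ_of_le hj.2.1)) hn
    · rw [if_neg h]
      refine Finset.sum_eq_zero fun j _ => ?_
      rw [if_neg fun h' => h h'.2.2.2.1]
  have hend : ∀ j ∈ Finset.range (l.length + 1), (∑ i ∈ Finset.range (l.length + 1),
        if IsConstancyInterval F l k i (j + 1) then
          (if eventTime f l (j + 1) = (c : EReal) then e * (betti F (stage l i) k : ℤ) else 0)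
          else 0) = if j = l.length ∨ betti F (stage l j) k ≠ betti F (stage l (j + 1)) k then
          (if eventTime f l (j + 1) = (c : EReal) then e * (betti F (stage l j) k : ℤ) else 0)
          else 0 := by
    intro j hj
    have hjl := Finset.mem_range.1 hj
    by_cases h : j = l.length ∨ betti F (stage l j) k ≠ betti F (stage l (j + 1)) k
    · rw [if_pos h]
      obtain ⟨i, hi⟩ := exists_isConstancyInterval_right F (l := l) (k := k) (j := j + 1)
        (Nat.succ_pos j) (by omega) (by simpa using h)
      rw [Finset.sum_eq_single i]
      · rw [if_pos hi, ← hi.betti_pred F, Nat.add_sub_cancel]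
      · intro i' _ hne
        rw [if_neg fun h' => hne (h'.left_unique F hi)]
      · intro hn
        exact absurd (Finset.mem_range.2 (lt_of_lt_of_le hi.1 hjl)) hn
    · rw [if_neg h]
      refine Finset.sum_eq_zero fun i _ => if_neg fun h' => h ?_
      have h1 := h'.betti_pred F
      rw [Nat.add_sub_cancel] at h1
      rw [h1]
      simpa [ne_comm] using h'.2.2.2.2
  have hend0 : (∑ i ∈ Finset.range (l.length + 1),
        if IsConstancyInterval F l k i 0 then
          (if eventTime f l 0 = (c : EReal) then e * (betti F (stage l i) k : ℤ) else 0)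
          else 0) = 0 := by
    refine Finset.sum_eq_zero fun i _ => ?_
    rw [eventTime_zero, if_neg (EReal.coe_ne_bot c).symm, ite_self]
  -- The start at index 0 and the end at index `l.length + 1` have infinite event times and drop
  -- out; the remaining starts and ends are matched at the common index `m + 1`.
  rw [hsplit, Finset.sum_congr rfl hstart, Finset.sum_range_succ' _ (l.length + 1), hend0, add_zero,
    Finset.sum_congr rfl hend, Finset.sum_range_succ', Finset.sum_range_succ, eventTime_last,
    eventTime_zero, if_neg (EReal.coe_ne_bot c).symm, if_neg (EReal.coe_ne_top c).symm, ite_self,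
    ite_self, add_zero, add_zero, ← Finset.sum_sub_distrib]
  refine Finset.sum_congr rfl fun m hm => ?_
  have hml := Finset.mem_range.1 hm
  simp only [eventTime_succ f hml, EReal.coe_eq_coe_iff, hml.ne, Nat.add_sub_cancel, false_or,
    Nat.succ_ne_zero, ne_eq]
  split_ifs <;> first | rfl | ring

theorem betti_stage {l : List (Finset Plane)} (hc : ∀ i, FaceClosed (stage l i)) (k i : ℕ) :
    betti F (stage l i) k + boundaryRank F l k i = cycleRank F l k i :=
  betti_add_finrank_boundaries F (finite_stage l i) (hc i) k

theorem cycleRank_succ_le {l : List (Finset Plane)} (hl : l.Nodup) (k : ℕ) {i : ℕ}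
    (hi : i < l.length) :
    cycleRank F l k (i + 1) ≤ cycleRank F l k i + if l[i].card = k + 1 then 1 else 0 := by
  cases k with
  | zero => exact (cycleRank_zero_succ F hl hi).le
  | succ k =>
    have h1 := cycleRank_succ_add_boundaryRank F hl k hi
    have h2 := boundaryRank_mono F l k i
    rw [show k + 1 + 1 = k + 2 from rfl]
    omega

/-- A single simplex raises at most one of the cycle rank and the boundary rank in degree `k`, by at
most one. For e = 1 a rise of the Betti number therefore counts 2 and a fall counts 0, which singles
out births; e = -1 singles out deaths. -/
theorem jump_pos {l : List (Finset Plane)} (hl : l.Nodup) (hc : ∀ i, FaceClosed (stage l i))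
    (k : ℕ) {i : ℕ} (hi : i < l.length) :
    (if betti F (stage l i) k = betti F (stage l (i + 1)) k then 0 else
      1 + 1 * ((betti F (stage l (i + 1)) k : ℤ) - betti F (stage l i) k)) =
      2 * ((cycleRank F l k (i + 1) : ℤ) - cycleRank F l k i) := by
  have h1 := betti_stage F hc k i
  have h2 := betti_stage F hc k (i + 1)
  have h3 := cycleRank_succ_le F hl k hi
  have h4 := cycleRank_succ_add_boundaryRank F hl k hi
  have h5 := cycleRank_mono F l k i
  have h6 := cycleRank_mono F l (k + 1) i
  have h7 := boundaryRank_mono F l k i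
  split_ifs at * <;> omega

theorem jump_neg {l : List (Finset Plane)} (hl : l.Nodup) (hc : ∀ i, FaceClosed (stage l i))
    (k : ℕ) {i : ℕ} (hi : i < l.length) :
    (if betti F (stage l i) k = betti F (stage l (i + 1)) k then 0 else
      1 + (-1) * ((betti F (stage l (i + 1)) k : ℤ) - betti F (stage l i) k)) =
      2 * ((boundaryRank F l k (i + 1) : ℤ) - boundaryRank F l k i) := by
  have h1 := betti_stage F hc k i
  have h2 := betti_stage F hc k (i + 1)
  have h3 := cycleRank_succ_le F hl k hi
  have h4 := cycleRank_succ_add_boundaryRank F hl k hi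
  have h5 := cycleRank_mono F l k i
  have h6 := cycleRank_mono F l (k + 1) i
  have h7 := boundaryRank_mono F l k i
  split_ifs at * <;> omega

open Classical in
theorem jumpSum_pos_abc {K : PlaneComplex} {s : Direction} (L : IndexFiltration K (lowerStar s))
    (k : ℕ) (c : ℝ) : jumpSum 1 c (abc F (lowerStar s) L.list k) =
      2 * ((apd F (lowerStar s) L.list k).countP (fun p => p.1 = c) : ℤ) := by
  rw [jumpSum_abc, births_apd F L.faceClosed_stage, Finset.mul_sum]
  refine Finset.sum_congr rfl fun i hi => ?_
  rw [jump_pos F L.nodup L.faceClosed_stage k (Finset.mem_range.1 hi), mul_ite, mul_zero]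

open Classical in
theorem jumpSum_neg_abc {K : PlaneComplex} {s : Direction} (L : IndexFiltration K (lowerStar s))
    (k : ℕ) (c : ℝ) : jumpSum (-1) c (abc F (lowerStar s) L.list k) =
      2 * ((apd F (lowerStar s) L.list k).countP (fun p => p.2 = (c : EReal)) : ℤ) := by
  rw [jumpSum_abc, deaths_apd F L.faceClosed_stage, Finset.mul_sum]
  refine Finset.sum_congr rfl fun i hi => ?_
  rw [jump_neg F L.nodup L.faceClosed_stage k (Finset.mem_range.1 hi), mul_ite, mul_zero]

theorem dimensionReturning_bct (ι : IndexChoice) : DimensionReturning (bct F ι) := by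
  classical
  intro s K K' h k c
  have hk : ∀ (k : ℕ) (e : ℤ), jumpSum e c (abc F (lowerStar s) (ι K s).list k) =
      jumpSum e c (abc F (lowerStar s) (ι K' s).list k) := fun k e =>
    congrArg (fun D : ℕ → Multiset (EReal × EReal × ℕ) => jumpSum e c (D k)) h
  cases k with
  | zero =>
    have h1 := hk 0 1
    rw [jumpSum_pos_abc, jumpSum_pos_abc, births_zero_apd, births_zero_apd] at h1
    omega
  | succ k =>
    have h1 := hk (k + 1) 1
    have h2 := hk k (-1)
    rw [jumpSum_pos_abc, jumpSum_pos_abc] at h1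
    rw [jumpSum_neg_abc, jumpSum_neg_abc] at h2
    rw [← births_succ_add_deaths_apd F (ι K s), ← births_succ_add_deaths_apd F (ι K' s)]
    omega

end BettiCurves

/-! ### The number of edges of an embedded graph -/

theorem plane_ext {x y : Plane} (h0 : x 0 = y 0) (h1 : x 1 = y 1) : x = y := by
  ext i; fin_cases i <;> assumption

/-- The edges of `K`, as pairs (left endpoint, right endpoint). -/
def PlaneComplex.orientedEdges (K : PlaneComplex) : Set (Plane × Plane) :=
  {p | ({p.1, p.2} : Finset Plane) ∈ K.faces ∧ p.1 0 < p.2 0}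

theorem PlaneComplex.finite_verts (K : PlaneComplex) : K.verts.Finite :=
  K.finite_faces.preimage (Finset.singleton_injective.injOn)

theorem PlaneComplex.mem_verts_of_mem {K : PlaneComplex} {σ : Finset Plane} (hσ : σ ∈ K.faces)
    {x : Plane} (hx : x ∈ σ) : x ∈ K.verts :=
  K.down_closed hσ (Finset.singleton_subset_iff.2 hx) (Finset.singleton_nonempty x)

theorem PlaneComplex.orientedEdges_subset (K : PlaneComplex) :
    K.orientedEdges ⊆ K.verts ×ˢ K.verts := fun p hp =>
  ⟨K.mem_verts_of_mem hp.1 (by simp), K.mem_verts_of_mem hp.1 (by simp)⟩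

theorem PlaneComplex.finite_orientedEdges (K : PlaneComplex) : K.orientedEdges.Finite :=
  (K.finite_verts.prod K.finite_verts).subset K.orientedEdges_subset

/-! ### Edges as graphs of affine functions of the first coordinate -/

/-- Slope of the line through `u` and `v`. -/
noncomputable def slopeOf (u v : Plane) : ℝ := (v 1 - u 1) / (v 0 - u 0)

/-- Second coordinate at `t` of the line through `u` and `v`. -/
noncomputable def lineAt (u v : Plane) (t : ℝ) : ℝ := u 1 + slopeOf u v * (t - u 0)

theorem lineAt_left (u v : Plane) : lineAt u v (u 0) = u 1 := by simp [lineAt]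

theorem lineAt_right {u v : Plane} (h : u 0 < v 0) : lineAt u v (v 0) = v 1 := by
  have : v 0 - u 0 ≠ 0 := by linarith
  rw [lineAt, slopeOf, div_mul_cancel₀ _ this]; ring

theorem mem_convexHull_pair_lineAt {u v p : Plane} (h : u 0 < v 0) (h1 : u 0 ≤ p 0)
    (h2 : p 0 ≤ v 0) (hp : p 1 = lineAt u v (p 0)) :
    p ∈ convexHull ℝ (({u, v} : Finset Plane) : Set Plane) := by
  have hd : 0 < v 0 - u 0 := by linarith
  rw [Finset.coe_pair, convexHull_pair]
  refine ⟨(v 0 - p 0) / (v 0 - u 0), (p 0 - u 0) / (v 0 - u 0), div_nonneg (by linarith) hd.le,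
    div_nonneg (by linarith) hd.le, by field_simp; ring, ?_⟩
  apply plane_ext
  · simp only [PiLp.add_apply, PiLp.smul_apply, smul_eq_mul]
    field_simp; ring
  · rw [hp, lineAt, slopeOf]
    simp only [PiLp.add_apply, PiLp.smul_apply, smul_eq_mul]
    field_simp; ring

theorem fst_mem_of_mem_convexHull_pair {u v p : Plane}
    (hp : p ∈ convexHull ℝ (({u, v} : Finset Plane) : Set Plane)) (h : u 0 ≤ v 0) :
    u 0 ≤ p 0 ∧ p 0 ≤ v 0 := by
  rw [Finset.coe_pair, convexHull_pair] at hp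
  obtain ⟨a, b, ha, hb, hab, rfl⟩ := hp
  have hb' : b = 1 - a := by linarith
  subst hb'
  simp only [PiLp.add_apply, PiLp.smul_apply, smul_eq_mul]
  constructor <;> nlinarith

/-- The meeting point lies in the hull of the common vertices. If an endpoint were not shared, this
hull would contain at most the other endpoint, which has a different first coordinate. -/
theorem orientedEdges_eq_of_meet {K : PlaneComplex} {a b c d : Plane}
    (hab : (a, b) ∈ K.orientedEdges) (hcd : (c, d) ∈ K.orientedEdges) {t : ℝ} (h1 : a 0 < t)
    (h2 : t < b 0) (h3 : c 0 < t) (h4 : t < d 0) (h : lineAt a b t = lineAt c d t) :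
    a = c ∧ b = d := by
  set p : Plane := !₂[t, lineAt a b t] with hp
  have hp0 : p 0 = t := by simp [hp]
  have hp1 : p 1 = lineAt a b t := by simp [hp]
  have hpab := mem_convexHull_pair_lineAt (p := p) hab.2 (by rw [hp0]; exact h1.le)
    (by rw [hp0]; exact h2.le) (by rw [hp0, hp1])
  have hpcd := mem_convexHull_pair_lineAt (p := p) hcd.2 (by rw [hp0]; exact h3.le)
    (by rw [hp0]; exact h4.le) (by rw [hp0, hp1, h])
  have hpi := K.inter_subset_convexHull hab.1 hcd.1 ⟨hpab, hpcd⟩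
  have key : ∀ q : Plane, p 0 ≠ q 0 →
      ¬ (({a, b} : Finset Plane) : Set Plane) ∩ (({c, d} : Finset Plane) : Set Plane) ⊆ {q} := by
    intro q hq hsub
    have := convexHull_mono (𝕜 := ℝ) hsub hpi
    rw [convexHull_singleton] at this
    exact hq (by rw [Set.mem_singleton_iff.1 this])
  have hac := hab.2
  have hcd' := hcd.2
  simp only at hac hcd'
  have ha : a = c ∨ a = d := by
    by_contra hn
    refine key b (by rw [hp0]; exact h2.ne) ?_
    rintro x ⟨hx1, hx2⟩
    simp only [Finset.coe_insert, Finset.coe_singleton, Set.mem_insert_iff,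
      Set.mem_singleton_iff] at hx1 hx2 ⊢
    rcases hx1 with rfl | rfl
    · exact absurd hx2 hn
    · rfl
  have hb : b = c ∨ b = d := by
    by_contra hn
    refine key a (by rw [hp0]; exact h1.ne') ?_
    rintro x ⟨hx1, hx2⟩
    simp only [Finset.coe_insert, Finset.coe_singleton, Set.mem_insert_iff,
      Set.mem_singleton_iff] at hx1 hx2 ⊢
    rcases hx1 with rfl | rfl
    · rfl
    · exact absurd hx2 hn
  rcases ha with rfl | rfl <;> rcases hb with rfl | rfl
  · exact absurd hac (lt_irrefl _)
  · exact ⟨rfl, rfl⟩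
  · linarith
  · exact absurd hac (lt_irrefl _)

/-- The intermediate value theorem turns a change of vertical order into an interior meeting point,
where the edges must coincide. -/
theorem not_crossing {K : PlaneComplex} {a b c d : Plane}
    (hab : (a, b) ∈ K.orientedEdges) (hcd : (c, d) ∈ K.orientedEdges) {t t' : ℝ} (htt : t < t')
    (ha : a 0 ≤ t) (hc : c 0 ≤ t) (hb : t' ≤ b 0) (hd : t' ≤ d 0)
    (h1 : lineAt a b t < lineAt c d t) (h2 : lineAt c d t' < lineAt a b t') : False := by
  have hcont : ContinuousOn (fun x => lineAt a b x - lineAt c d x) (Set.Icc t t') := by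
    unfold lineAt; fun_prop
  obtain ⟨x, hx, hx0⟩ := intermediate_value_Ioo htt.le hcont
    (show (0 : ℝ) ∈ Set.Ioo _ _ from ⟨by linarith, by linarith⟩)
  obtain ⟨rfl, rfl⟩ := orientedEdges_eq_of_meet hab hcd (t := x) (by linarith [hx.1])
    (by linarith [hx.2]) (by linarith [hx.1]) (by linarith [hx.2]) (by simp only at hx0; linarith)
  exact lt_irrefl _ h1

theorem eq_of_slopeOf_eq {K : PlaneComplex} {u v v' : Plane} (h : (u, v) ∈ K.orientedEdges)
    (h' : (u, v') ∈ K.orientedEdges) (hs : slopeOf u v = slopeOf u v') : v = v' := by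
  obtain ⟨t, ht1, ht2⟩ := exists_between (lt_min h.2 h'.2)
  exact (orientedEdges_eq_of_meet h h' ht1 (lt_of_lt_of_le ht2 (min_le_left _ _)) ht1
    (lt_of_lt_of_le ht2 (min_le_right _ _)) (by simp only [lineAt, hs])).2

theorem eq_right_of_mem_edge {K : PlaneComplex} {u v w : Plane} (h : (u, v) ∈ K.orientedEdges)
    (hw : w ∈ K.verts) (h1 : u 0 < w 0) (h2 : w 0 ≤ v 0) (hl : w 1 = lineAt u v (w 0)) :
    w = v := by
  have h3 := mem_convexHull_pair_lineAt h.2 h1.le h2 hl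
  have h4 := K.inter_subset_convexHull hw h.1 ⟨by simp, h3⟩
  have h5 := convexHull_nonempty_iff.1 ⟨_, h4⟩
  obtain ⟨x, hx1, hx2⟩ := h5
  simp only [Finset.coe_insert, Finset.coe_singleton, Set.mem_insert_iff,
      Set.mem_singleton_iff] at hx1 hx2
  rcases hx2 with rfl | rfl
  · rw [hx1] at h1; exact absurd h1 (lt_irrefl _)
  · exact hx1.symm

theorem lineAt_le_of_slopeOf_le {u v v' : Plane} (h : slopeOf u v ≤ slopeOf u v') {t : ℝ}
    (ht : u 0 ≤ t) : lineAt u v t ≤ lineAt u v' t := by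
  unfold lineAt
  have := mul_le_mul_of_nonneg_right h (sub_nonneg.2 ht)
  linarith

/-! ### Charging edges to vertices -/

/-- `v'` is the next right neighbour of `u` above `v`, and `w` is the leftmost vertex between the
edges from `u` to `v` and `v'`. -/
structure IsCharged (K : PlaneComplex) (u v v' w : Plane) : Prop where
  lower : (u, v) ∈ K.orientedEdges
  upper : (u, v') ∈ K.orientedEdges
  lt : slopeOf u v < slopeOf u v'
  next : ∀ z, (u, z) ∈ K.orientedEdges → slopeOf u v < slopeOf u z → slopeOf u v' ≤ slopeOf u z
  mem : w ∈ K.verts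
  left_lt : u 0 < w 0
  le_lower : w 0 ≤ v 0
  le_upper : w 0 ≤ v' 0
  above : lineAt u v (w 0) ≤ w 1
  below : w 1 ≤ lineAt u v' (w 0)
  leftmost : ∀ z ∈ K.verts, u 0 < z 0 → lineAt u v (z 0) ≤ z 1 → z 1 ≤ lineAt u v' (z 0) →
    w 0 ≤ z 0

theorem exists_isCharged {K : PlaneComplex} {u v : Plane} (h : (u, v) ∈ K.orientedEdges)
    (hn : ∃ z, (u, z) ∈ K.orientedEdges ∧ slopeOf u v < slopeOf u z) :
    ∃ v' w, IsCharged K u v v' w := by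
  have hfin : {z | (u, z) ∈ K.orientedEdges ∧ slopeOf u v < slopeOf u z}.Finite :=
    K.finite_verts.subset fun z hz => (K.orientedEdges_subset hz.1).2
  obtain ⟨v', ⟨hv', hlt⟩, hmin⟩ := hfin.exists_minimalFor (slopeOf u) _ hn
  have hnext : ∀ z, (u, z) ∈ K.orientedEdges → slopeOf u v < slopeOf u z →
      slopeOf u v' ≤ slopeOf u z := fun z h1 h2 => by
    rcases le_total (slopeOf u v') (slopeOf u z) with h | h
    · exact h
    · exact hmin ⟨h1, h2⟩ h
  have hfin2 : {w | w ∈ K.verts ∧ u 0 < w 0 ∧ lineAt u v (w 0) ≤ w 1 ∧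
      w 1 ≤ lineAt u v' (w 0)}.Finite := K.finite_verts.subset fun z hz => hz.1
  have hvV := (K.orientedEdges_subset h).2
  have hvV' := (K.orientedEdges_subset hv').2
  -- The nearer of the two right neighbours lies in the wedge. It shows that candidates exist and
  -- that the leftmost one is not beyond either edge.
  have hex : ∃ w0, (w0 ∈ K.verts ∧ u 0 < w0 0 ∧ lineAt u v (w0 0) ≤ w0 1 ∧
      w0 1 ≤ lineAt u v' (w0 0)) ∧ w0 0 ≤ v 0 ∧ w0 0 ≤ v' 0 := by
    rcases le_total (v 0) (v' 0) with hle | hle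
    · refine ⟨v, ⟨hvV, h.2, (lineAt_right h.2).le, ?_⟩, le_rfl, hle⟩
      calc v 1 = lineAt u v (v 0) := (lineAt_right h.2).symm
        _ ≤ _ := lineAt_le_of_slopeOf_le hlt.le h.2.le
    · refine ⟨v', ⟨hvV', hv'.2, ?_, (lineAt_right hv'.2).ge⟩, hle, le_rfl⟩
      calc lineAt u v (v' 0) ≤ lineAt u v' (v' 0) := lineAt_le_of_slopeOf_le hlt.le hv'.2.le
        _ = _ := lineAt_right hv'.2
  obtain ⟨w0, hw0, hw1, hw2⟩ := hex
  obtain ⟨w, ⟨hw, hwl, hwa, hwb⟩, hwmin⟩ := hfin2.exists_minimalFor (fun w => w 0) _ ⟨w0, hw0⟩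
  have hleft : ∀ z ∈ K.verts, u 0 < z 0 → lineAt u v (z 0) ≤ z 1 → z 1 ≤ lineAt u v' (z 0) →
      w 0 ≤ z 0 := fun z h1 h2 h3 h4 => by
    rcases le_total (w 0) (z 0) with h | h
    · exact h
    · exact hwmin ⟨h1, h2, h3, h4⟩ h
  have := hleft w0 hw0.1 hw0.2.1 hw0.2.2.1 hw0.2.2.2
  exact ⟨v', w, h, hv', hlt, hnext, hw, hwl, this.trans hw1, this.trans hw2, hwa, hwb, hleft⟩

theorem IsCharged.eq_upper {K : PlaneComplex} {u v v' w : Plane} (h : IsCharged K u v v' w)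
    (he : w 1 = lineAt u v' (w 0)) : w = v' :=
  eq_right_of_mem_edge h.upper h.mem h.left_lt h.le_upper he

theorem IsCharged.eq_lower {K : PlaneComplex} {u v v' w : Plane} (h : IsCharged K u v v' w)
    (he : w 1 = lineAt u v (w 0)) : w = v :=
  eq_right_of_mem_edge h.lower h.mem h.left_lt h.le_lower he

theorem IsCharged.lower_ne_upper {K : PlaneComplex} {u v v' w : Plane}
    (h : IsCharged K u v v' w) : v ≠ v' := fun he => by
  have := h.lt
  rw [he] at this
  exact lt_irrefl _ this

/-- Different wedges at `u` can share `w` only on a common edge, where `w` ends the upper edge of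
one and the lower edge of the other. The tag `ht`, recording whether `w` is the upper endpoint,
excludes this. -/
theorem IsCharged.not_slope_lt {K : PlaneComplex} {u v₁ v₁' v₂ v₂' w : Plane}
    (h₁ : IsCharged K u v₁ v₁' w) (h₂ : IsCharged K u v₂ v₂' w) (ht : w = v₁' ↔ w = v₂') :
    ¬ slopeOf u v₁ < slopeOf u v₂ := by
  intro hlt
  have h1 := h₁.next _ h₂.lower hlt
  have h2 := lineAt_le_of_slopeOf_le h1 h₁.left_lt.le
  have h3 : w = v₁' := h₁.eq_upper (le_antisymm h₁.below (h2.trans h₂.above))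
  have h4 : w = v₂ := h₂.eq_lower (le_antisymm (h₁.below.trans h2) h₂.above)
  exact h₂.lower_ne_upper (h4.symm.trans (ht.1 h3))

/-- A vertex `u₂` between `u₁` and `w` is not in the first wedge, as `w` is leftmost there. So it
lies above or below, and to enclose `w` an edge from `u₂` would have to cross an edge from `u₁`. The
edges could also just touch at `w`; the tags rule that out. -/
theorem IsCharged.not_left_lt {K : PlaneComplex} {u₁ v₁ v₁' u₂ v₂ v₂' w : Plane}
    (h₁ : IsCharged K u₁ v₁ v₁' w) (h₂ : IsCharged K u₂ v₂ v₂' w) (ht : w = v₁' ↔ w = v₂') :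
    ¬ u₁ 0 < u₂ 0 := by
  intro hlt
  by_cases ha : lineAt u₁ v₁ (u₂ 0) ≤ u₂ 1
  · by_cases hb : u₂ 1 ≤ lineAt u₁ v₁' (u₂ 0)
    · exact absurd (h₁.leftmost u₂ (K.orientedEdges_subset h₂.lower).1 hlt ha hb)
        (not_le.2 h₂.left_lt)
    · refine not_crossing h₁.upper h₂.lower h₂.left_lt hlt.le le_rfl h₁.le_upper h₂.le_lower
        (by rw [lineAt_left]; exact not_le.1 hb) (lt_of_le_of_ne (h₂.above.trans h₁.below) ?_)
      intro he
      have h3 := h₁.eq_upper (le_antisymm h₁.below (he ▸ h₂.above))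
      have h4 := h₂.eq_lower (le_antisymm (he ▸ h₁.below) h₂.above)
      exact h₂.lower_ne_upper (h4.symm.trans (ht.1 h3))
  · refine not_crossing h₂.upper h₁.lower h₂.left_lt le_rfl hlt.le h₂.le_upper h₁.le_lower
      (by rw [lineAt_left]; exact not_le.1 ha) (lt_of_le_of_ne (h₁.above.trans h₂.below) ?_)
    intro he
    have h3 := h₂.eq_upper (le_antisymm h₂.below (he ▸ h₁.above))
    have h4 := h₁.eq_lower (le_antisymm (he ▸ h₂.below) h₁.above)
    exact h₁.lower_ne_upper (h4.symm.trans (ht.2 h3))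

theorem IsCharged.unique {K : PlaneComplex} (hK : Set.InjOn (fun x : Plane => x 0) K.verts)
    {u₁ v₁ v₁' u₂ v₂ v₂' w : Plane}
    (h₁ : IsCharged K u₁ v₁ v₁' w) (h₂ : IsCharged K u₂ v₂ v₂' w) (ht : w = v₁' ↔ w = v₂') :
    (u₁, v₁) = (u₂, v₂) := by
  have hu : u₁ = u₂ := hK (K.orientedEdges_subset h₁.lower).1 (K.orientedEdges_subset h₂.lower).1
    (le_antisymm (not_lt.1 (h₂.not_left_lt h₁ ht.symm)) (not_lt.1 (h₁.not_left_lt h₂ ht)))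
  subst hu
  rw [eq_of_slopeOf_eq h₁.lower h₂.lower
    (le_antisymm (not_lt.1 (h₂.not_slope_lt h₁ ht.symm)) (not_lt.1 (h₁.not_slope_lt h₂ ht)))]

/-- Each vertex is the left endpoint of at most one edge of maximal slope. Every other edge is
charged to a vertex with a Boolean tag, injectively by `IsCharged.unique`. This gives n + 2n. -/
theorem ncard_orientedEdges_le (K : PlaneComplex)
    (hK : Set.InjOn (fun x : Plane => x 0) K.verts) :
    K.orientedEdges.ncard ≤ 3 * K.verts.ncard := by
  classical
  set T : Set (Plane × Plane) := {p | p ∈ K.orientedEdges ∧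
    ∃ z, (p.1, z) ∈ K.orientedEdges ∧ slopeOf p.1 p.2 < slopeOf p.1 z} with hT
  have h1 : (K.orientedEdges \ T).ncard ≤ K.verts.ncard := by
    refine Set.ncard_le_ncard_of_injOn Prod.fst
      (fun p hp => (K.orientedEdges_subset hp.1).1) ?_ K.finite_verts
    rintro ⟨u, v⟩ ⟨hp, hpT⟩ ⟨u', v'⟩ ⟨hq, hqT⟩ (rfl : u = u')
    rcases lt_trichotomy (slopeOf u v) (slopeOf u v') with h | h | h
    · exact absurd ⟨hp, v', hq, h⟩ hpT
    · rw [eq_of_slopeOf_eq hp hq h]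
    · exact absurd ⟨hq, v, hp, h⟩ hqT
  have hch : ∀ p : Plane × Plane, ∃ q : Plane × Plane, p ∈ T → IsCharged K p.1 p.2 q.1 q.2 := by
    intro p
    by_cases hp : p ∈ T
    · obtain ⟨v', w, h⟩ := exists_isCharged hp.1 hp.2
      exact ⟨(v', w), fun _ => h⟩
    · exact ⟨p, fun h => absurd h hp⟩
  choose g hg using hch
  have h2 : T.ncard ≤ (K.verts ×ˢ (Set.univ : Set Bool)).ncard := by
    refine Set.ncard_le_ncard_of_injOn (fun p => ((g p).2, decide ((g p).2 = (g p).1)))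
      (fun p hp => ⟨(hg p hp).mem, Set.mem_univ _⟩) ?_ (K.finite_verts.prod Set.finite_univ)
    intro p hp q hq h
    simp only [Prod.mk.injEq, decide_eq_decide] at h
    have h1 := hg p hp
    rw [h.1] at h1
    exact h1.unique hK (hg q hq) (h.1 ▸ h.2)
  rw [Set.ncard_prod, Set.ncard_univ, Nat.card_eq_fintype_card, Fintype.card_bool] at h2
  have h3 : T ⊆ K.orientedEdges := fun p hp => hp.1
  have h4 := Set.ncard_sdiff_add_ncard_of_subset h3 K.finite_orientedEdges
  omega

/-! ### Reconstruction of the vertices -/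

/-- The answers of the oracle `O` in direction `s` are compatible with the complex `K`. -/
structure Consistent (O : Oracle) (K : PlaneComplex) (s : Direction) : Prop where
  count_births : ∀ c, (births (O s 0)).count c = simplexCount K s 0 c
  indegree_eq : ∀ c, indegree O s c = simplexCount K s 1 c

theorem consistent_pht (F : Type u) [Field F] (ι : IndexChoice) (K : PlaneComplex)
    (s : Direction) : Consistent (pht F ι K) K s :=
  ⟨count_births_pht F ι K s, indegree_pht F ι K s⟩

theorem Consistent.congr {O : Oracle} {K K' : PlaneComplex} {s : Direction}
    (h : Consistent O K s) (hc : ∀ k c, simplexCount K' s k c = simplexCount K s k c) :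
    Consistent O K' s :=
  ⟨fun c => (h.1 c).trans (hc 0 c).symm, fun c => (h.2 c).trans (hc 1 c).symm⟩

theorem height_eq (s : Direction) (x : Plane) :
    height s x = (s : Plane) 0 * x 0 + (s : Plane) 1 * x 1 := by
  simp [height, PiLp.inner_apply, Fin.sum_univ_two, mul_comm]

@[simp] theorem height_e₁ (x : Plane) : height e₁ x = x 0 := by
  simp [height_eq, e₁]

@[simp] theorem height_e₂ (x : Plane) : height e₂ x = x 1 := by
  simp [height_eq, e₂]

theorem height_neg (s : Direction) (x : Plane) : height (-s) x = - height s x := by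
  simp [height]

theorem lowerStar_singleton (s : Direction) (x : Plane) : lowerStar s {x} = height s x := by
  simp [lowerStar]

open Classical in
theorem lowerStar_pair (s : Direction) (x y : Plane) :
    lowerStar s {x, y} = max (height s x) (height s y) := by
  rw [lowerStar, dif_pos (by simp)]
  exact Finset.sup'_insert (H := by simp) (f := height s) |>.trans (by simp)

theorem simplexCount_zero (K : PlaneComplex) (s : Direction) (c : ℝ) :
    simplexCount K s 0 c = {x | x ∈ K.verts ∧ height s x = c}.ncard := by
  rw [simplexCount, ← Set.ncard_image_of_injective _ (Finset.singleton_injective (α := Plane))]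
  congr 1
  ext σ
  simp only [Set.mem_ofPred_eq, Set.mem_image, zero_add, Finset.card_eq_one]
  constructor
  · rintro ⟨h1, ⟨x, rfl⟩, h3⟩
    exact ⟨x, ⟨h1, by rwa [lowerStar_singleton] at h3⟩, rfl⟩
  · rintro ⟨x, ⟨h1, h2⟩, rfl⟩
    exact ⟨h1, ⟨x, rfl⟩, by rwa [lowerStar_singleton]⟩

/-- The vertices in ascending order of their first coordinates. -/
noncomputable def PlaneComplex.sortedVerts (K : PlaneComplex) : List Plane :=
  K.finite_verts.toFinset.toList.insertionSort (fun x y => x 0 ≤ y 0)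

theorem PlaneComplex.mem_sortedVerts {K : PlaneComplex} {x : Plane} :
    x ∈ K.sortedVerts ↔ x ∈ K.verts := by
  simp [PlaneComplex.sortedVerts]

theorem PlaneComplex.nodup_sortedVerts (K : PlaneComplex) : K.sortedVerts.Nodup :=
  (List.perm_insertionSort _ _).nodup_iff.2 (Finset.nodup_toList _)

theorem PlaneComplex.length_sortedVerts (K : PlaneComplex) :
    K.sortedVerts.length = K.verts.ncard := by
  rw [PlaneComplex.sortedVerts, List.length_insertionSort, Finset.length_toList,
    Set.ncard_eq_toFinset_card _ K.finite_verts]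

theorem PlaneComplex.pairwise_sortedVerts_le (K : PlaneComplex) :
    K.sortedVerts.Pairwise (fun x y => x 0 ≤ y 0) := by
  have : Std.Total (fun x y : Plane => x 0 ≤ y 0) := ⟨fun a b => le_total _ _⟩
  have : IsTrans Plane (fun x y : Plane => x 0 ≤ y 0) := ⟨fun a b c => le_trans⟩
  exact List.pairwise_insertionSort _ _

theorem PlaneComplex.pairwise_sortedVerts {K : PlaneComplex}
    (hK : Set.InjOn (fun x : Plane => x 0) K.verts) :
    K.sortedVerts.Pairwise (fun x y => x 0 < y 0) := by
  refine (K.pairwise_sortedVerts_le.and K.nodup_sortedVerts).imp_of_mem ?_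
  intro a b ha hb h
  exact lt_of_le_of_ne h.1 fun he =>
    h.2 (hK (mem_sortedVerts.1 ha) (mem_sortedVerts.1 hb) he)

theorem count_map_sortedVerts (K : PlaneComplex) (s : Direction) (c : ℝ) :
    (K.sortedVerts.map (height s)).count c = simplexCount K s 0 c := by
  classical
  have h : {x | x ∈ K.verts ∧ height s x = c} =
      ↑(K.sortedVerts.filter (fun x => height s x = c)).toFinset := by
    ext x; simp [PlaneComplex.mem_sortedVerts]
  rw [simplexCount_zero, h, Set.ncard_coe_finset,
    List.toFinset_card_of_nodup (K.nodup_sortedVerts.filter _), List.count, List.countP_map,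
    List.countP_eq_length_filter]
  congr! 3

theorem Consistent.births_perm {O : Oracle} {K : PlaneComplex} {s : Direction}
    (h : Consistent O K s) : (births (O s 0)).Perm (K.sortedVerts.map (height s)) := by
  rw [List.perm_iff_count]
  intro c
  rw [count_map_sortedVerts]
  convert h.count_births c

theorem Consistent.births_eq {O : Oracle} {K : PlaneComplex} {s : Direction}
    (h : Consistent O K s) (hs : K.sortedVerts.Pairwise (fun x y => height s x ≤ height s y)) :
    births (O s 0) = K.sortedVerts.map (height s) := by
  refine h.births_perm.eq_of_pairwise' ?_ (List.pairwise_map.2 hs)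
  exact Multiset.pairwise_sort _ _

theorem injOn_fst_of_count_le_one {K : PlaneComplex}
    (h : ∀ c, simplexCount K e₁ 0 c ≤ 1) : Set.InjOn (fun x : Plane => x 0) K.verts := by
  intro x hx y hy hxy
  have h1 := h (x 0)
  rw [simplexCount_zero, Set.ncard_le_one (K.finite_verts.subset fun _ h => h.1)] at h1
  exact h1 _ ⟨hx, by simp⟩ _ ⟨hy, by simpa using hxy.symm⟩

theorem count_le_one_of_injOn_fst {K : PlaneComplex}
    (h : Set.InjOn (fun x : Plane => x 0) K.verts) (c : ℝ) : simplexCount K e₁ 0 c ≤ 1 := by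
  rw [simplexCount_zero, Set.ncard_le_one (K.finite_verts.subset fun _ h => h.1)]
  rintro x ⟨hx, h1⟩ y ⟨hy, h2⟩
  rw [height_e₁] at h1 h2
  exact h hx hy (h1.trans h2.symm)

/-- With gap g, spread m and parameter t, one has t * (g + m) = g / 2. A height difference after
tilting is thus at least (1 - t) * g - t * m = g / 2. -/
theorem tiltParameter_spec (H H' : List ℝ) :
    0 < tiltParameter H H' ∧ ∀ a ∈ H, ∀ b ∈ H, a < b → ∀ a' ∈ H', ∀ b' ∈ H',
      0 < (1 - tiltParameter H H') * (b - a) + tiltParameter H H' * (b' - a') := by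
  classical
  set G : Set ℝ := {t : ℝ | ∃ a ∈ H, ∃ b ∈ H, a < b ∧ t = b - a} with hG
  set M : Set ℝ := {t : ℝ | ∃ a ∈ H', ∃ b ∈ H', t = b - a} with hM
  have ht : tiltParameter H H' = if ∃ a ∈ H, ∃ b ∈ H, a < b then
    sInf G / (sInf G + sSup M) / 2 else 1 / 2 := rfl
  by_cases hex : ∃ a ∈ H, ∃ b ∈ H, a < b
  swap
  · rw [ht, if_neg hex]
    exact ⟨by norm_num, fun a ha b hb hab => absurd ⟨a, ha, b, hb, hab⟩ hex⟩
  rw [if_pos hex] at ht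
  have hGf : G.Finite := by
    refine ((H.toFinset ×ˢ H.toFinset).image (fun p : ℝ × ℝ => p.2 - p.1)).finite_toSet.subset ?_
    rintro t ⟨a, ha, b, hb, -, rfl⟩
    simp only [Finset.coe_image, Set.mem_image, Finset.mem_coe, Finset.mem_product,
      List.mem_toFinset]
    exact ⟨(a, b), ⟨ha, hb⟩, rfl⟩
  have hMf : M.Finite := by
    refine ((H'.toFinset ×ˢ H'.toFinset).image (fun p : ℝ × ℝ => p.2 - p.1)).finite_toSet.subset ?_
    rintro t ⟨a, ha, b, hb, rfl⟩
    simp only [Finset.coe_image, Set.mem_image, Finset.mem_coe, Finset.mem_product,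
      List.mem_toFinset]
    exact ⟨(a, b), ⟨ha, hb⟩, rfl⟩
  have hGn : G.Nonempty := by
    obtain ⟨a, ha, b, hb, hab⟩ := hex
    exact ⟨_, a, ha, b, hb, hab, rfl⟩
  have hg : 0 < sInf G := by
    obtain ⟨a, ha, b, hb, hab, he⟩ := hGn.csInf_mem hGf
    rw [he]; linarith
  have hm : 0 ≤ sSup M := by
    rcases M.eq_empty_or_nonempty with h0 | ⟨_, a, ha, b, hb, -⟩
    · rw [h0, Real.sSup_empty]
    · exact le_csSup hMf.bddAbove ⟨a, ha, a, ha, by ring⟩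
  have hle : ∀ a ∈ H, ∀ b ∈ H, a < b → sInf G ≤ b - a := fun a ha b hb hab =>
    csInf_le hGf.bddBelow ⟨a, ha, b, hb, hab, rfl⟩
  have hle' : ∀ a ∈ H', ∀ b ∈ H', b - a ≤ sSup M := fun a ha b hb =>
    le_csSup hMf.bddAbove ⟨a, ha, b, hb, rfl⟩
  generalize sInf G = g at *
  generalize sSup M = m at *
  have hpos : 0 < g + m := by linarith
  have ht0 : 0 < tiltParameter H H' := by rw [ht]; positivity
  have ht2 : tiltParameter H H' * (g + m) = g / 2 := by rw [ht]; field_simp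
  refine ⟨ht0, fun a ha b hb hab a' ha' b' hb' => ?_⟩
  have h1 := hle a ha b hb hab
  have h2 := hle' b' hb' a' ha'
  generalize tiltParameter H H' = t at *
  -- If t ≥ 1, then t * (g + m) would be at least g, not g / 2.
  have ht1 : 0 < 1 - t := by
    by_contra hn
    nlinarith
  nlinarith [mul_le_mul_of_nonneg_left h1 ht1.le, mul_le_mul_of_nonneg_left h2 ht0.le]

theorem directionOf_apply {x : Plane} (hx : x ≠ 0) (i : Fin 2) :
    (directionOf x : Plane) i = ‖x‖⁻¹ * x i := by
  simp [directionOf, hx]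

/-- The tilted direction orders the vertices as their first coordinates do. The two sorted lists of
births therefore match vertex by vertex, and each second coordinate solves a linear equation with
nonzero coefficient. -/
theorem findVerts_eq {O : Oracle} {K : PlaneComplex}
    (hK : Set.InjOn (fun x : Plane => x 0) K.verts) (h1 : Consistent O K e₁)
    (h2 : Consistent O K e₂) (h3 : Consistent O K (vertexTilt O)) :
    findVerts O = K.sortedVerts := by
  have hb1 : births (O e₁ 0) = K.sortedVerts.map (height e₁) :=
    h1.births_eq (by simpa using K.pairwise_sortedVerts_le)
  obtain ⟨ht0, ht⟩ := tiltParameter_spec (births (O e₁ 0)) (births (O e₂ 0))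
  set t := tiltParameter (births (O e₁ 0)) (births (O e₂ 0)) with htdef
  set w : Plane := (1 - t) • (e₁ : Plane) + t • (e₂ : Plane) with hw
  have hw0 : w 0 = 1 - t := by simp [hw, e₁, e₂]
  have hw1 : w 1 = t := by simp [hw, e₁, e₂]
  have hwn : w ≠ 0 := fun h => by
    rw [h] at hw1
    exact ht0.ne hw1
  have hs : vertexTilt O = directionOf w := rfl
  have hn : 0 < ‖w‖⁻¹ := inv_pos.2 (norm_pos_iff.2 hwn)
  have hs0 : (vertexTilt O : Plane) 0 = ‖w‖⁻¹ * (1 - t) := by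
    rw [hs, directionOf_apply hwn, hw0]
  have hs1 : (vertexTilt O : Plane) 1 = ‖w‖⁻¹ * t := by
    rw [hs, directionOf_apply hwn, hw1]
  have hb3 : births (O (vertexTilt O) 0) = K.sortedVerts.map (height (vertexTilt O)) := by
    refine h3.births_eq ((K.pairwise_sortedVerts hK).imp_of_mem fun {x y} hx hy hxy => ?_)
    have hx2 : x 1 ∈ births (O e₂ 0) := by
      rw [h2.births_perm.mem_iff]
      exact List.mem_map.2 ⟨x, hx, by simp⟩
    have hy2 : y 1 ∈ births (O e₂ 0) := by
      rw [h2.births_perm.mem_iff]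
      exact List.mem_map.2 ⟨y, hy, by simp⟩
    have hx1 : x 0 ∈ births (O e₁ 0) := by
      rw [hb1]
      exact List.mem_map.2 ⟨x, hx, by simp⟩
    have hy1 : y 0 ∈ births (O e₁ 0) := by
      rw [hb1]
      exact List.mem_map.2 ⟨y, hy, by simp⟩
    have := ht _ hx1 _ hy1 hxy _ hx2 _ hy2
    rw [height_eq, height_eq, hs0, hs1]
    have := mul_pos hn this
    nlinarith
  have hs1' : (vertexTilt O : Plane) 1 ≠ 0 := by rw [hs1]; positivity
  unfold findVerts
  simp only
  rw [hb1, hb3, List.zipWith_map, List.zipWith_self]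
  conv_rhs => rw [← List.map_id K.sortedVerts]
  refine List.map_congr_left fun x _ => plane_ext (by simp) ?_
  simp only [height_e₁, height_eq (vertexTilt O), Matrix.cons_val_one,
    Matrix.cons_val_fin_one, id]
  field_simp
  ring

theorem verts_eq_of_findVerts_eq {K K' : PlaneComplex} (h : K.sortedVerts = K'.sortedVerts) :
    K.verts = K'.verts := by
  ext x
  rw [← PlaneComplex.mem_sortedVerts, h, PlaneComplex.mem_sortedVerts]

/-! ### Angles around a vertex -/

theorem fst_sub_eq (x y : Plane) : y 0 - x 0 = ‖y - x‖ * Real.cos (angleFrom x y) ∧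
    y 1 - x 1 = ‖y - x‖ * Real.sin (angleFrom x y) := by
  have h : ‖(⟨y 0 - x 0, y 1 - x 1⟩ : ℂ)‖ = ‖y - x‖ := by
    rw [EuclideanSpace.norm_eq, Complex.norm_eq_sqrt_sq_add_sq]
    simp [Fin.sum_univ_two]
  constructor
  · rw [← h, angleFrom, Complex.norm_mul_cos_arg]
  · rw [← h, angleFrom, Complex.norm_mul_sin_arg]

/-- Comparing cosines avoids the branch cut of `Complex.arg`: the difference of oriented angles is
the unoriented one only up to sign and full turns. -/
theorem cos_angle_eq {x y z : Plane} (hy : y ≠ x) (hz : z ≠ x) :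
    Real.cos (EuclideanGeometry.angle z x y) = Real.cos (angleFrom x z - angleFrom x y) := by
  have hy' : ‖y - x‖ ≠ 0 := norm_ne_zero_iff.2 (sub_ne_zero.2 hy)
  have hz' : ‖z - x‖ ≠ 0 := norm_ne_zero_iff.2 (sub_ne_zero.2 hz)
  have h1 := fst_sub_eq x y
  have h2 := fst_sub_eq x z
  rw [EuclideanGeometry.angle, InnerProductGeometry.cos_angle, Real.cos_sub]
  simp only [vsub_eq_sub]
  have : inner ℝ (z - x) (y - x) = (z 0 - x 0) * (y 0 - x 0) + (z 1 - x 1) * (y 1 - x 1) := by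
    simp [PiLp.inner_apply, Fin.sum_univ_two, mul_comm]
  rw [this, h1.1, h1.2, h2.1, h2.2]
  field_simp

theorem height_dirOfAngle_sub (t : ℝ) (x z : Plane) :
    height (dirOfAngle t) z - height (dirOfAngle t) x =
      ‖z - x‖ * Real.cos (angleFrom x z - t) := by
  have h := fst_sub_eq x z
  rw [height_eq, height_eq, Real.cos_sub]
  have h0 : (dirOfAngle t : Plane) 0 = Real.cos t := by simp [dirOfAngle]
  have h1 : (dirOfAngle t : Plane) 1 = Real.sin t := by simp [dirOfAngle]
  rw [h0, h1]
  linear_combination Real.cos t * h.1 + Real.sin t * h.2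

theorem height_splitDir_sub (x y z : Plane) (θ : ℝ) :
    height (splitDir x y θ) z - height (splitDir x y θ) x =
      - (‖z - x‖ * Real.sin (angleFrom x z - angleFrom x y + θ / 2)) := by
  rw [splitDir, height_dirOfAngle_sub, show angleFrom x z - (angleFrom x y - Real.pi / 2 - θ / 2) =
    (angleFrom x z - angleFrom x y + θ / 2) + Real.pi / 2 by ring, Real.cos_add_pi_div_two]
  ring

theorem abs_angleFrom_lt {x y : Plane} (h : x 0 < y 0) :
    |angleFrom x y| < Real.pi / 2 :=
  Complex.abs_arg_lt_pi_div_two_iff.2 (Or.inl (by simpa using h))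

theorem tan_angleFrom (x y : Plane) : Real.tan (angleFrom x y) = slopeOf x y :=
  Complex.tan_arg _

/-- Every line through `x` and a point of `V` makes an angle of at least `θ` with the line through
`x` and any other point of `V`. -/
def AngleBound (V : Set Plane) (x : Plane) (θ : ℝ) : Prop :=
  ∀ y ∈ V, ∀ z ∈ V, y ≠ x → z ≠ x → y ≠ z →
    0 < θ ∧ θ ≤ Real.pi / 2 ∧ |Real.cos (angleFrom x z - angleFrom x y)| ≤ Real.cos θ

/-- The infimum is attained on a finite set, and no angle is 0 or π because no three points are
collinear. For an angle φ, the inequality θ ≤ min φ (π - φ) gives both |cos φ| ≤ cos θ and θ ≤ π /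
2. -/
theorem angleBound_minAngle {V : Set Plane} (hV : GeneralPosition V) {l : List Plane}
    (hl : ∀ y, y ∈ l ↔ y ∈ V) {x : Plane} (hx : x ∈ V) : AngleBound V x (minAngle l x) := by
  intro y hy z hz hyx hzx hyz
  set S : Set ℝ := {t : ℝ | ∃ a ∈ l, ∃ b ∈ l, a ≠ x ∧ b ≠ x ∧ a ≠ b ∧
    t = min (EuclideanGeometry.angle a x b) (Real.pi - EuclideanGeometry.angle a x b)} with hS
  have hm : minAngle l x = sInf S := rfl
  have hfin : S.Finite := by
    classical
    refine ((l.toFinset ×ˢ l.toFinset).image (fun p : Plane × Plane =>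
      min (EuclideanGeometry.angle p.1 x p.2)
        (Real.pi - EuclideanGeometry.angle p.1 x p.2))).finite_toSet.subset ?_
    rintro t ⟨a, ha, b, hb, -, -, -, rfl⟩
    simp only [Finset.coe_image, Set.mem_image, Finset.mem_coe, Finset.mem_product,
      List.mem_toFinset]
    exact ⟨(a, b), ⟨ha, hb⟩, rfl⟩
  have hmem : min (EuclideanGeometry.angle z x y) (Real.pi - EuclideanGeometry.angle z x y) ∈ S :=
    ⟨z, (hl z).2 hz, y, (hl y).2 hy, hzx, hyx, hyz.symm, rfl⟩
  have hle := csInf_le hfin.bddBelow hmem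
  have hpos : 0 < sInf S := by
    obtain ⟨a, ha, b, hb, hax, hbx, hab, he⟩ := Set.Nonempty.csInf_mem ⟨_, hmem⟩ hfin
    rw [he]
    have hnc := hV.not_collinear a ((hl a).1 ha) x hx b ((hl b).1 hb) hax hab hbx.symm
    rw [EuclideanGeometry.collinear_iff_eq_or_eq_or_angle_eq_zero_or_angle_eq_pi] at hnc
    push Not at hnc
    exact lt_min (lt_of_le_of_ne (EuclideanGeometry.angle_nonneg _ _ _) hnc.2.2.1.symm)
      (sub_pos.2 (lt_of_le_of_ne (EuclideanGeometry.angle_le_pi _ _ _) hnc.2.2.2))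
  rw [hm]
  generalize sInf S = θ at *
  rw [le_min_iff] at hle
  refine ⟨hpos, by linarith [hle.1, hle.2], ?_⟩
  rw [← cos_angle_eq hyx hzx, abs_le]
  constructor
  · rw [neg_le, ← Real.cos_pi_sub]
    exact Real.cos_le_cos_of_nonneg_of_le_pi hpos.le
      (by linarith [EuclideanGeometry.angle_nonneg z x y]) hle.2
  · exact Real.cos_le_cos_of_nonneg_of_le_pi hpos.le (EuclideanGeometry.angle_le_pi _ _ _) hle.1

section Split

variable {V : Set Plane} {x y z : Plane} {θ : ℝ}

theorem AngleBound.angleFrom_ne (h : AngleBound V x θ) (hy : y ∈ V) (hz : z ∈ V) (hyx : y ≠ x)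
    (hzx : z ≠ x) (hyz : y ≠ z) : angleFrom x y ≠ angleFrom x z := by
  intro he
  obtain ⟨h1, h2, h3⟩ := h y hy z hz hyx hzx hyz
  rw [he, sub_self, Real.cos_zero, abs_one] at h3
  have := Real.cos_lt_cos_of_nonneg_of_le_pi_div_two le_rfl h2 h1
  rw [Real.cos_zero] at this
  linarith

/-- A zero would put `z` on the splitting line, which makes an angle of only θ / 2 with the line
through `x` and `y`. The points may lie on either side of `x`. -/
theorem AngleBound.sin_ne_zero (h : AngleBound V x θ) (hy : y ∈ V) (hz : z ∈ V) (hyx : y ≠ x)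
    (hzx : z ≠ x) (hyz : y ≠ z) :
    Real.sin (angleFrom x z - angleFrom x y + θ / 2) ≠ 0 := by
  obtain ⟨h1, h2, h3⟩ := h y hy z hz hyx hzx hyz
  intro h0
  obtain ⟨n, hn⟩ := Real.sin_eq_zero_iff.1 h0
  have h4 : angleFrom x z - angleFrom x y = n * Real.pi - θ / 2 := by linarith
  rw [h4, Real.cos_int_mul_pi_sub, abs_mul, abs_zpow, abs_neg, abs_one, one_zpow, one_mul] at h3
  have h5 := Real.cos_lt_cos_of_nonneg_of_le_pi_div_two (x := θ / 2) (by linarith) h2 (by linarith)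
  linarith [le_abs_self (Real.cos (θ / 2))]

theorem AngleBound.sin_pos (h : AngleBound V x θ) (hy : y ∈ V) (hz : z ∈ V) (hyx : x 0 < y 0)
    (hzx : x 0 < z 0) (hlt : angleFrom x y < angleFrom x z) :
    0 < Real.sin (angleFrom x z - angleFrom x y + θ / 2) := by
  obtain ⟨h1, h2, h3⟩ := h y hy z hz (by rintro rfl; exact lt_irrefl _ hyx)
    (by rintro rfl; exact lt_irrefl _ hzx) (by rintro rfl; exact lt_irrefl _ hlt)
  have hy' := abs_lt.1 (abs_angleFrom_lt hyx)
  have hz' := abs_lt.1 (abs_angleFrom_lt hzx)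
  -- Here the bound for lines rather than rays is needed: it keeps the difference away from π, so
  -- adding θ / 2 does not pass π.
  have h4 : θ ≤ Real.pi - (angleFrom x z - angleFrom x y) := by
    by_contra hn
    have := Real.cos_lt_cos_of_nonneg_of_le_pi
      (x := Real.pi - (angleFrom x z - angleFrom x y)) (by linarith) (by linarith) (not_le.1 hn)
    rw [Real.cos_pi_sub] at this
    linarith [(abs_le.1 h3).1]
  exact Real.sin_pos_of_pos_of_lt_pi (by linarith) (by linarith)

theorem AngleBound.lt_sub (h : AngleBound V x θ) (hy : y ∈ V) (hz : z ∈ V) (hyx : x 0 < y 0)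
    (hzx : x 0 < z 0) (hlt : angleFrom x z < angleFrom x y) :
    θ ≤ angleFrom x y - angleFrom x z := by
  obtain ⟨h1, h2, h3⟩ := h y hy z hz (by rintro rfl; exact lt_irrefl _ hyx)
    (by rintro rfl; exact lt_irrefl _ hzx) (by rintro rfl; exact lt_irrefl _ hlt)
  by_contra hn
  have := Real.cos_lt_cos_of_nonneg_of_le_pi
    (x := angleFrom x y - angleFrom x z) (by linarith) (by linarith) (not_le.1 hn)
  rw [← Real.cos_neg (angleFrom x y - angleFrom x z), neg_sub] at this
  linarith [(abs_le.1 h3).2]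

theorem AngleBound.sin_neg (h : AngleBound V x θ) (hθ : 0 < θ) (hy : y ∈ V) (hz : z ∈ V)
    (hyx : x 0 < y 0) (hzx : x 0 < z 0) (hlt : angleFrom x z < angleFrom x y) :
    Real.sin (angleFrom x z - angleFrom x y + θ / 2) < 0 := by
  have h4 := h.lt_sub hy hz hyx hzx hlt
  have hy' := abs_lt.1 (abs_angleFrom_lt hyx)
  have hz' := abs_lt.1 (abs_angleFrom_lt hzx)
  exact Real.sin_neg_of_neg_of_neg_pi_lt (by linarith) (by linarith)

theorem norm_sub_pos_of_ne (h : z ≠ x) : 0 < ‖z - x‖ := norm_pos_iff.2 (sub_ne_zero.2 h)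

/-- With no other vertex at the height of `x`, the number of edges at that height is an indegree of
`x`. -/
theorem AngleBound.height_splitDir_ne (h : AngleBound V x θ) (hθ : 0 < θ) (hθ' : θ ≤ Real.pi / 2)
    (hy : y ∈ V) (hyx : y ≠ x) (hz : z ∈ V) (hzx : z ≠ x) :
    height (splitDir x y θ) z ≠ height (splitDir x y θ) x := by
  rw [← sub_ne_zero, height_splitDir_sub, neg_ne_zero]
  refine mul_ne_zero (norm_sub_pos_of_ne hzx).ne' ?_
  by_cases hyz : y = z
  · subst hyz
    rw [sub_self, zero_add]
    exact (Real.sin_pos_of_pos_of_lt_pi (by linarith) (by linarith [Real.pi_pos])).ne'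
  · exact h.sin_ne_zero hy hz hyx hzx hyz

theorem AngleBound.height_splitDir_lt (h : AngleBound V x θ) (hθ : 0 < θ) (hθ' : θ ≤ Real.pi / 2)
    (hy : y ∈ V) (hz : z ∈ V) (hyx : x 0 < y 0) (hzx : x 0 < z 0)
    (hle : y = z ∨ angleFrom x y < angleFrom x z) :
    height (splitDir x y θ) z < height (splitDir x y θ) x := by
  rw [← sub_neg, height_splitDir_sub, neg_lt_zero]
  refine mul_pos (norm_sub_pos_of_ne (by rintro rfl; exact lt_irrefl _ hzx)) ?_
  rcases hle with rfl | hlt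
  · rw [sub_self, zero_add]
    exact Real.sin_pos_of_pos_of_lt_pi (by linarith) (by linarith [Real.pi_pos])
  · exact h.sin_pos hy hz hyx hzx hlt

theorem AngleBound.lt_height_splitDir (h : AngleBound V x θ) (hθ : 0 < θ)
    (hy : y ∈ V) (hz : z ∈ V) (hyx : x 0 < y 0) (hzx : x 0 < z 0)
    (hlt : angleFrom x z < angleFrom x y) :
    height (splitDir x y θ) x < height (splitDir x y θ) z := by
  rw [← sub_pos, height_splitDir_sub, neg_pos]
  exact mul_neg_of_pos_of_neg (norm_sub_pos_of_ne (by rintro rfl; exact lt_irrefl _ hzx))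
    (h.sin_neg hθ hy hz hyx hzx hlt)

end Split

/-! ### Indegrees -/

/-- Adjacency in the 1-skeleton of `K`. -/
def PlaneComplex.Adj (K : PlaneComplex) (x y : Plane) : Prop :=
  ({x, y} : Finset Plane) ∈ K.faces ∧ x ≠ y

theorem PlaneComplex.Adj.symm {K : PlaneComplex} {x y : Plane} (h : K.Adj x y) : K.Adj y x :=
  ⟨by rw [Finset.pair_comm]; exact h.1, h.2.symm⟩

theorem PlaneComplex.Adj.mem_right {K : PlaneComplex} {x y : Plane} (h : K.Adj x y) :
    y ∈ K.verts := K.mem_verts_of_mem h.1 (by simp)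

theorem PlaneComplex.Adj.mem_left {K : PlaneComplex} {x y : Plane} (h : K.Adj x y) :
    x ∈ K.verts := K.mem_verts_of_mem h.1 (by simp)

theorem simplexCount_one_vertex {K : PlaneComplex} {s : Direction} {x : Plane}
    (hs : ∀ y ∈ K.verts, y ≠ x → height s y ≠ height s x) :
    simplexCount K s 1 (height s x) = {y | K.Adj x y ∧ height s y < height s x}.ncard := by
  classical
  have hinj : Set.InjOn (fun y : Plane => ({x, y} : Finset Plane))
      {y | K.Adj x y ∧ height s y < height s x} := by
    intro y hy z hz h
    have h1 : y ∈ ({x, z} : Finset Plane) := by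
      have : y ∈ ({x, y} : Finset Plane) := by simp
      simp only at h
      rwa [h] at this
    simp only [Finset.mem_insert, Finset.mem_singleton] at h1
    exact h1.resolve_left hy.1.2.symm
  rw [simplexCount, ← hinj.ncard_image]
  congr 1
  ext σ
  simp only [Set.mem_ofPred_eq, Set.mem_image]
  constructor
  · rintro ⟨h1, h2, h3⟩
    obtain ⟨a, b, hab, rfl⟩ := Finset.card_eq_two.1 h2
    rw [lowerStar_pair] at h3
    have key : ∀ a b : Plane, a ≠ b → ({a, b} : Finset Plane) ∈ K.faces →
        max (height s a) (height s b) = height s x → height s b ≤ height s a →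
        ∃ y, (K.Adj x y ∧ height s y < height s x) ∧ ({x, y} : Finset Plane) = {a, b} := by
      intro a b hab hf hm hle
      rw [max_eq_left hle] at hm
      have hax : a = x := by
        by_contra hne
        exact hs a (K.mem_verts_of_mem hf (by simp)) hne hm
      subst hax
      exact ⟨b, ⟨⟨hf, hab⟩, lt_of_le_of_ne hle
        (hs b (K.mem_verts_of_mem hf (by simp)) hab.symm)⟩, rfl⟩
    rcases le_total (height s b) (height s a) with h | h
    · exact key a b hab h1 h3 h
    · rw [Finset.pair_comm] at h1 ⊢
      rw [max_comm] at h3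
      exact key b a hab.symm h1 h3 h
  · rintro ⟨y, ⟨hy, hlt⟩, rfl⟩
    exact ⟨hy.1, Finset.card_pair hy.2, by rw [lowerStar_pair, max_eq_left hlt.le]⟩

theorem Consistent.indegree_vertex {O : Oracle} {K : PlaneComplex} {s : Direction} {x : Plane}
    (h : Consistent O K s) (hs : ∀ y ∈ K.verts, y ≠ x → height s y ≠ height s x)
    {A : List Plane} (hA : A.Nodup) (hA' : ∀ y, y ∈ A ↔ K.Adj x y) :
    indegree O s (height s x) = A.countP (fun y => height s y < height s x) := by
  classical
  have h1 : {y | K.Adj x y ∧ height s y < height s x} =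
      ↑(A.filter (fun y => height s y < height s x)).toFinset := by
    ext y; simp [hA']
  rw [h.indegree_eq, simplexCount_one_vertex hs, h1, Set.ncard_coe_finset,
    List.toFinset_card_of_nodup (hA.filter _), List.countP_eq_length_filter]

/-! ### Correctness of the binary search -/

open Classical in
/-- The middle vertices at which the binary search splits the list `I`, for the set `p` of
neighbours. -/
noncomputable def splitPoints (p : Plane → Prop) (I : List Plane) : List Plane :=
  if I.countP (fun y => p y) = 0 then []
  else if I.length = 0 then []
  else if I.length = 1 then []
  else I.getD (I.length / 2 - 1) 0 ::
    (splitPoints p (I.take (I.length / 2)) ++ splitPoints p (I.drop (I.length / 2)))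
termination_by I.length
decreasing_by
  all_goals simp only [List.length_take, List.length_drop]; omega

/-- The directions queried in order to split at the vertices of a list. -/
noncomputable def splitQueries (x : Plane) (θ : ℝ) (l : List Plane) : List Direction :=
  l.flatMap fun y => [splitDir x y θ, -splitDir x y θ]

theorem countP_eq_length_of_forall {l : List Plane} {p : Plane → Bool} (h : ∀ y ∈ l, p y = true) :
    l.countP p = l.length := List.countP_eq_length.2 h

/-- The neighbours of `x` are the known ones `E`, those in the list being split, and those still on
the stack, `W`. The splitting line leaves the first part below `x` and the second part together with
`W` above. Subtracting the known neighbours on each side, and the size of `W` above, leaves the two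
wanted numbers; no truncation occurs. -/
theorem searchInterval_split {O : Oracle} {K : PlaneComplex} {x : Plane} {θ : ℝ}
    (hθ : AngleBound K.verts x θ) {A : List Plane} (hA : A.Nodup) (hA' : ∀ y, y ∈ A ↔ K.Adj x y)
    {I₁ I₂ E W : List Plane} {y : Plane} (hne : I₂ ≠ [])
    (hI : ∀ z ∈ (I₁ ++ [y]) ++ I₂, z ∈ K.verts ∧ x 0 < z 0)
    (hIs : ((I₁ ++ [y]) ++ I₂).Pairwise (fun z z' => angleFrom x z' < angleFrom x z))
    (hW : ∀ z ∈ W, z ∈ K.verts ∧ x 0 < z 0)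
    (hIW : ∀ z ∈ (I₁ ++ [y]) ++ I₂, ∀ z' ∈ W, angleFrom x z' < angleFrom x z)
    {p : Plane → Bool}
    (hp : A.Perm (E ++ (((I₁ ++ [y]) ++ I₂).filter p ++ W)))
    (h1 : Consistent O K (splitDir x y θ)) (h2 : Consistent O K (-splitDir x y θ)) :
    indegree O (splitDir x y θ) (height (splitDir x y θ) x) -
      E.countP (fun z => height (splitDir x y θ) z < height (splitDir x y θ) x) =
        (I₁ ++ [y]).countP p ∧
    indegree O (-splitDir x y θ) (height (-splitDir x y θ) x) -
      E.countP (fun z => height (splitDir x y θ) x < height (splitDir x y θ) z) - W.length =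
        I₂.countP p := by
  classical
  set s := splitDir x y θ with hs
  obtain ⟨z₀, hz₀⟩ := List.exists_mem_of_ne_nil _ hne
  have hy := hI y (by simp)
  have hne' : ∀ z : Plane, x 0 < z 0 → z ≠ x := by
    rintro z h rfl; exact lt_irrefl _ h
  have hlt2 : ∀ z ∈ I₂, angleFrom x z < angleFrom x y := fun z hz =>
    (List.pairwise_append.1 hIs).2.2 y (by simp) z hz
  have hz₀' := hI z₀ (by simp [hz₀])
  obtain ⟨hθ0, hθ1, -⟩ := hθ y hy.1 z₀ hz₀'.1 (hne' y hy.2) (hne' z₀ hz₀'.2)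
    (by rintro rfl; exact lt_irrefl _ (hlt2 _ hz₀))
  have hsx : ∀ z ∈ K.verts, z ≠ x → height s z ≠ height s x := fun z hz hzx =>
    hθ.height_splitDir_ne hθ0 hθ1 hy.1 (hne' y hy.2) hz hzx
  have hsx' : ∀ z ∈ K.verts, z ≠ x → height (-s) z ≠ height (-s) x := fun z hz hzx h => by
    rw [height_neg, height_neg, neg_inj] at h
    exact hsx z hz hzx h
  have hleft : ∀ z ∈ I₁ ++ [y], height s z < height s x := by
    intro z hz
    have hz' := hI z (List.mem_append_left _ hz)
    refine hθ.height_splitDir_lt hθ0 hθ1 hy.1 hz'.1 hy.2 hz'.2 ?_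
    rcases List.mem_append.1 hz with hz | hz
    · exact Or.inr ((List.pairwise_append.1 (List.pairwise_append.1 hIs).1).2.2 z hz y (by simp))
    · exact Or.inl (List.mem_singleton.1 hz).symm
  have hright : ∀ z ∈ I₂, height s x < height s z := by
    intro z hz
    have hz' := hI z (List.mem_append_right _ hz)
    exact hθ.lt_height_splitDir hθ0 hy.1 hz'.1 hy.2 hz'.2 (hlt2 z hz)
  have hlater : ∀ z ∈ W, height s x < height s z := by
    intro z hz
    exact hθ.lt_height_splitDir hθ0 hy.1 (hW z hz).1 hy.2 (hW z hz).2 (hIW y (by simp) z hz)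
  have c1 := h1.indegree_vertex hsx hA hA'
  have c2 := h2.indegree_vertex hsx' hA hA'
  have c2' : A.countP (fun z => height (-s) z < height (-s) x) =
      A.countP (fun z => height s x < height s z) := by
    simp only [height_neg, neg_lt_neg_iff]
  rw [c2', hp.countP_eq] at c2
  rw [hp.countP_eq] at c1
  simp only [List.filter_append, List.countP_append] at c1 c2
  constructor
  · have e1 : (List.filter p I₁).countP (fun z => height s z < height s x) +
        (List.filter p [y]).countP (fun z => height s z < height s x) =
        (I₁ ++ [y]).countP p := by
      rw [countP_eq_length_of_forall, countP_eq_length_of_forall, List.countP_append,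
        List.countP_eq_length_filter, List.countP_eq_length_filter]
      · intro z hz
        simpa using hleft z (List.mem_append_right _ (List.mem_of_mem_filter hz))
      · intro z hz
        simpa using hleft z (List.mem_append_left _ (List.mem_of_mem_filter hz))
    have e2 : (List.filter p I₂).countP (fun z => height s z < height s x) = 0 := by
      rw [List.countP_eq_zero]
      intro z hz
      simpa using (hright z (List.mem_of_mem_filter hz)).le
    have e3 : W.countP (fun z => height s z < height s x) = 0 := by
      rw [List.countP_eq_zero]
      intro z hz
      simpa using (hlater z hz).le
    omega
  · have e1 : (List.filter p I₁).countP (fun z => height s x < height s z) = 0 := by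
      rw [List.countP_eq_zero]
      intro z hz
      simpa using (hleft z (List.mem_append_left _ (List.mem_of_mem_filter hz))).le
    have e1' : (List.filter p [y]).countP (fun z => height s x < height s z) = 0 := by
      rw [List.countP_eq_zero]
      intro z hz
      simpa using (hleft z (List.mem_append_right _ (List.mem_of_mem_filter hz))).le
    have e2 : (List.filter p I₂).countP (fun z => height s x < height s z) = I₂.countP p := by
      rw [countP_eq_length_of_forall, List.countP_eq_length_filter]
      intro z hz
      simpa using hright z (List.mem_of_mem_filter hz)
    have e3 : W.countP (fun z => height s x < height s z) = W.length := by
      rw [countP_eq_length_of_forall]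
      intro z hz
      simpa using hlater z hz
    omega

open Classical in
-- The permutation hypothesis is the invariant of the search. Consistency is asked only in the
-- directions that this run queries, so that the lemma also applies to a competing complex.
theorem searchInterval_eq {O : Oracle} {K : PlaneComplex} {x : Plane} {θ : ℝ}
    (hθ : AngleBound K.verts x θ) {A : List Plane} (hA : A.Nodup)
    (hA' : ∀ y, y ∈ A ↔ K.Adj x y) (n : ℕ) :
    ∀ (I E W : List Plane) (c w : ℕ), I.length = n →
      (∀ z ∈ I, z ∈ K.verts ∧ x 0 < z 0) →
      I.Pairwise (fun z z' => angleFrom x z' < angleFrom x z) →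
      (∀ z ∈ W, z ∈ K.verts ∧ x 0 < z 0) →
      (∀ z ∈ I, ∀ z' ∈ W, angleFrom x z' < angleFrom x z) →
      A.Perm (E ++ (I.filter (fun y => K.Adj x y) ++ W)) →
      c = I.countP (fun y => K.Adj x y) → w = W.length →
      (∀ s ∈ (searchInterval O x θ I c w E).2, Consistent O K s) →
      searchInterval O x θ I c w E =
        (E ++ I.filter (fun y => K.Adj x y), splitQueries x θ (splitPoints (K.Adj x) I)) := by
  induction n using Nat.strong_induction_on with
  | _ n ih =>
  intro I E W c w hn hI hIs hW hIW hp hc hw hq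
  by_cases h0 : I.countP (fun y => K.Adj x y) = 0
  · rw [searchInterval, if_pos (hc.trans h0), splitPoints, if_pos h0]
    have : I.filter (fun y => K.Adj x y) = [] := by
      rw [← List.length_eq_zero_iff, ← List.countP_eq_length_filter, h0]
    rw [this, List.append_nil]; rfl
  by_cases h1 : I.length = 0
  · rw [List.length_eq_zero_iff.1 h1] at h0
    exact absurd rfl h0
  by_cases h2 : I.length = 1
  · rw [searchInterval, if_neg (hc ▸ h0), if_neg h1, if_pos h2, splitPoints, if_neg h0, if_neg h1,
      if_pos h2]
    have : I.filter (fun y => K.Adj x y) = I := by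
      obtain ⟨y, rfl⟩ := List.length_eq_one_iff.1 h2
      rw [List.filter_eq_self]
      simpa using List.countP_pos_iff.1 (Nat.pos_of_ne_zero h0)
    rw [this]; rfl
  set i := I.length / 2 with hi
  have hilt : i - 1 < I.length := by omega
  have hy : I.getD (i - 1) x = I[i - 1] := List.getD_eq_getElem _ _ hilt
  have hy0 : I.getD (i - 1) 0 = I[i - 1] := List.getD_eq_getElem _ _ hilt
  rw [searchInterval, if_neg (hc ▸ h0), if_neg h1, if_neg h2] at hq ⊢
  rw [splitPoints, if_neg h0, if_neg h1, if_neg h2]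
  simp only [← hi, hy, hy0] at hq ⊢
  set y := I[i - 1] with hydef
  have htake : I.take i = I.take (i - 1) ++ [y] := by
    have : i = i - 1 + 1 := by omega
    rw [this, List.take_add_one, List.getElem?_eq_getElem (by omega)]
    rfl
  have hsplit : I = (I.take (i - 1) ++ [y]) ++ I.drop i := by
    rw [← htake, List.take_append_drop]
  have hdne : I.drop i ≠ [] := by
    rw [← List.length_pos_iff, List.length_drop]; omega
  have hcount := searchInterval_split (O := O) (E := E) (W := W) hθ hA hA'
    (p := fun y => decide (K.Adj x y)) hdne
    (by rw [← hsplit]; exact hI) (by rw [← hsplit]; exact hIs) hW (by rw [← hsplit]; exact hIW)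
    (by rw [← hsplit]; exact hp)
    (hq _ (by simp)) (hq _ (by simp))
  rw [← htake] at hcount
  set s := splitDir x y θ with hs
  obtain ⟨cl, hcl⟩ : ∃ cl, cl = indegree O s (height s x) -
    E.countP (fun z => height s z < height s x) := ⟨_, rfl⟩
  obtain ⟨cr, hcr⟩ : ∃ cr, cr = indegree O (-s) (height (-s) x) -
    E.countP (fun z => height s x < height s z) - w := ⟨_, rfl⟩
  rw [← hcl, ← hcr] at hq ⊢
  rw [← hcl, ← hw, ← hcr] at hcount
  have hpw := (List.pairwise_append.1 ((List.take_append_drop i I).symm ▸ hIs))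
  have hfil : I.filter (fun y => decide (K.Adj x y)) =
      (I.take i).filter (fun y => decide (K.Adj x y)) ++
        (I.drop i).filter (fun y => decide (K.Adj x y)) := by
    rw [← List.filter_append, List.take_append_drop]
  -- During the search of the left half, the neighbours in the right half count as waiting on the
  -- stack.
  have hleft := ih (I.take i).length (by rw [List.length_take]; omega) (I.take i) E
    ((I.drop i).filter (fun y => decide (K.Adj x y)) ++ W) cl (w + cr) rfl
    (fun z hz => hI z (List.mem_of_mem_take hz)) hpw.1
    (fun z hz => by
      rcases List.mem_append.1 hz with hz | hz
      · exact hI z (List.mem_of_mem_drop (List.mem_of_mem_filter hz))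
      · exact hW z hz)
    (fun z hz z' hz' => by
      rcases List.mem_append.1 hz' with hz' | hz'
      · exact hpw.2.2 z hz z' (List.mem_of_mem_filter hz')
      · exact hIW z (List.mem_of_mem_take hz) z' hz')
    (by rw [← List.append_assoc (List.filter _ _), ← hfil]; exact hp)
    hcount.1
    (by rw [List.length_append, ← List.countP_eq_length_filter, hw, ← hcount.2, Nat.add_comm])
    (fun s' hs' => hq s' (by simp [hs']))
  -- By now the neighbours in the left half belong to the known ones, and the stack is `W` again.
  have hright := ih (I.drop i).length (by rw [List.length_drop]; omega) (I.drop i)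
    (searchInterval O x θ (I.take i) cl (w + cr) E).1
    W cr w rfl
    (fun z hz => hI z (List.mem_of_mem_drop hz)) hpw.2.1 hW
    (fun z hz z' hz' => hIW z (List.mem_of_mem_drop hz) z' hz')
    (by
      rw [hleft, List.append_assoc, ← List.append_assoc (List.filter _ _), ← hfil]
      exact hp)
    hcount.2 hw
    (fun s' hs' => hq s' (by simp [hs']))
  rw [hright, hleft]
  simp only [Prod.mk.injEq]
  constructor
  · rw [List.append_assoc, ← hfil]
  · simp only [splitQueries, List.flatMap_cons, List.flatMap_append, List.cons_append,
      List.nil_append, hs]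

/-! ### Correctness of the sweep -/

theorem GeneralPosition.sortedVerts_lt {K : PlaneComplex} (h : GeneralPosition K.verts) :
    K.sortedVerts.Pairwise (fun x y => x 0 < y 0) :=
  PlaneComplex.pairwise_sortedVerts h.injOn_fst

theorem upVerts_perm (V : List Plane) (x : Plane) :
    (upVerts V x).Perm (V.filter (fun y => x 0 < y 0)) := by
  refine (List.perm_insertionSort _ _).trans (List.Perm.of_eq ?_)
  simp

theorem mem_upVerts {V : List Plane} {x y : Plane} : y ∈ upVerts V x ↔ y ∈ V ∧ x 0 < y 0 := by
  rw [(upVerts_perm V x).mem_iff]; simp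

theorem pairwise_upVerts {K : PlaneComplex} {x : Plane} {θ : ℝ} (hθ : AngleBound K.verts x θ) :
    (upVerts K.sortedVerts x).Pairwise (fun z z' => angleFrom x z' < angleFrom x z) := by
  have h1 : (upVerts K.sortedVerts x).Pairwise (fun z z' => angleFrom x z' ≤ angleFrom x z) := by
    have : Std.Total (fun y z : Plane => angleFrom x z ≤ angleFrom x y) :=
      ⟨fun a b => le_total _ _⟩
    have : IsTrans Plane (fun y z : Plane => angleFrom x z ≤ angleFrom x y) :=
      ⟨fun a b c h h' => le_trans h' h⟩
    exact List.pairwise_insertionSort _ _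
  have h2 : (upVerts K.sortedVerts x).Nodup :=
    (upVerts_perm _ x).nodup_iff.2 (K.nodup_sortedVerts.filter _)
  refine (h1.and h2).imp_of_mem fun {a b} ha hb h => lt_of_le_of_ne h.1 fun he => ?_
  rw [mem_upVerts, PlaneComplex.mem_sortedVerts] at ha hb
  exact hθ.angleFrom_ne ha.1 hb.1 (by rintro rfl; exact lt_irrefl _ ha.2)
    (by rintro rfl; exact lt_irrefl _ hb.2) h.2 he.symm

/-- The directions queried at the vertex `x` in order to find its neighbours in `K`. -/
noncomputable def PlaneComplex.sweepQueries (K : PlaneComplex) (x : Plane) : List Direction :=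
  splitQueries x (minAngle K.sortedVerts x)
    (splitPoints (K.Adj x) (upVerts K.sortedVerts x))

open Classical in
-- Distinct first coordinates split the neighbours of `x` into left ones, found earlier in the
-- sweep, and right ones. The right ones are those below `x` in direction `-e₁`, so the indegree
-- there starts the search with the right number.
theorem searchInterval_sweep {O : Oracle} {K : PlaneComplex} (hK : GeneralPosition K.verts)
    {x : Plane} (hx : x ∈ K.verts) {S : List (Plane × Plane)}
    (hS : ∀ y ∈ K.verts, (y, x) ∈ S ↔ K.Adj x y ∧ y 0 < x 0) (h₁ : Consistent O K (-e₁))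
    (hq : ∀ s ∈ (searchInterval O x (minAngle K.sortedVerts x) (upVerts K.sortedVerts x)
      (indegree O (-e₁) (height (-e₁) x)) 0
      (K.sortedVerts.filter (fun y => (y, x) ∈ S))).2, Consistent O K s) :
    searchInterval O x (minAngle K.sortedVerts x) (upVerts K.sortedVerts x)
      (indegree O (-e₁) (height (-e₁) x)) 0 (K.sortedVerts.filter (fun y => (y, x) ∈ S)) =
      (K.sortedVerts.filter (fun y => (y, x) ∈ S) ++
        (upVerts K.sortedVerts x).filter (fun y => K.Adj x y), K.sweepQueries x) := by
  have hθ := angleBound_minAngle hK (fun y => K.mem_sortedVerts) hx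
  set V := K.sortedVerts with hV
  set A := V.filter (fun y => K.Adj x y) with hAdef
  have hA : A.Nodup := K.nodup_sortedVerts.filter _
  have hA' : ∀ y, y ∈ A ↔ K.Adj x y := fun y => by
    rw [hAdef, List.mem_filter, hV, PlaneComplex.mem_sortedVerts]
    simp only [decide_eq_true_eq, and_iff_right_iff_imp]
    exact fun h => h.mem_right
  have hne : ∀ y ∈ K.verts, y ≠ x → height (-e₁) y ≠ height (-e₁) x := fun y hy hyx h => by
    rw [height_neg, height_neg, height_e₁, height_e₁, neg_inj] at h
    exact hyx (hK.injOn_fst hy hx h)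
  have hknown : V.filter (fun y => (y, x) ∈ S) = A.filter (fun y => ¬ x 0 < y 0) := by
    rw [hAdef, List.filter_filter]
    refine List.filter_congr fun y hy => ?_
    have hy' := PlaneComplex.mem_sortedVerts.1 hy
    rw [← Bool.decide_and]
    refine decide_eq_decide.2 ((hS y hy').trans
      ⟨fun h => ⟨not_lt.2 h.2.le, h.1⟩, fun h => ⟨h.2, ?_⟩⟩)
    exact lt_of_le_of_ne (not_lt.1 h.1) fun he => h.2.2 (hK.injOn_fst hx hy' he.symm)
  have hup : ((upVerts V x).filter (fun y => K.Adj x y)).Perm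
      (A.filter (fun y => x 0 < y 0)) := by
    refine ((upVerts_perm V x).filter _).trans (List.Perm.of_eq ?_)
    rw [hAdef, List.filter_filter, List.filter_filter]
    exact List.filter_congr fun y _ => Bool.and_comm _ _
  refine searchInterval_eq hθ hA hA' _ _ _ [] _ _ rfl
    (fun z hz => by rwa [mem_upVerts, hV, PlaneComplex.mem_sortedVerts] at hz)
    (pairwise_upVerts hθ) (by simp) (by simp) ?_ ?_ rfl hq
  · rw [List.append_nil, hknown]
    refine List.Perm.trans ?_ (List.Perm.append_left _ hup.symm)
    refine List.Perm.trans ?_ List.perm_append_comm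
    simpa only [decide_not] using (List.filter_append_perm (fun y : Plane => decide (x 0 < y 0)) A).symm
  · rw [h₁.indegree_vertex hne hA hA', List.countP_eq_length_filter, List.countP_eq_length_filter,
      hup.length_eq]
    congr 1
    refine List.filter_congr fun y _ => ?_
    simp [height_neg]

theorem sweepStep_snd (O : Oracle) (V : List Plane) (st : List (Plane × Plane) × List Direction)
    (x : Plane) : st.2 <+: (sweepStep O V st x).2 := List.prefix_append _ _

theorem foldl_sweepStep_snd (O : Oracle) (V l : List Plane)
    (st : List (Plane × Plane) × List Direction) :
    st.2 <+: (l.foldl (sweepStep O V) st).2 := by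
  induction l generalizing st with
  | nil => exact List.prefix_rfl
  | cons x l ih => exact (sweepStep_snd O V st x).trans (ih _)

/-- Invariant: the edges found so far are those whose left endpoint has been swept. Queries are only
appended, so consistency in the final list of directions covers every intermediate search. -/
theorem foldl_sweepStep {O : Oracle} {K : PlaneComplex} (hK : GeneralPosition K.verts)
    (post : List Plane) :
    ∀ (pre : List Plane) (st : List (Plane × Plane) × List Direction),
      K.sortedVerts = pre ++ post →
      (∀ a b, (a, b) ∈ st.1 ↔ a ∈ pre ∧ K.Adj a b ∧ a 0 < b 0) → -e₁ ∈ st.2 →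
      (∀ s ∈ (post.foldl (sweepStep O K.sortedVerts) st).2, Consistent O K s) →
      (∀ a b, (a, b) ∈ (post.foldl (sweepStep O K.sortedVerts) st).1 ↔
        a ∈ K.sortedVerts ∧ K.Adj a b ∧ a 0 < b 0) ∧
      (post.foldl (sweepStep O K.sortedVerts) st).2 = st.2 ++ post.flatMap K.sweepQueries := by
  classical
  induction post with
  | nil =>
    intro pre st hV hst _ _
    rw [List.append_nil] at hV
    rw [hV]
    exact ⟨hst, by simp⟩
  | cons x post ih =>
    intro pre st hV hst he hq
    rw [List.foldl_cons] at hq ⊢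
    have hqs := fun s hs => hq s ((foldl_sweepStep_snd O K.sortedVerts post _).subset hs)
    have hx : x ∈ K.verts := PlaneComplex.mem_sortedVerts.1 (by rw [hV]; simp)
    have hpw := hK.sortedVerts_lt
    rw [hV] at hpw
    have hS : ∀ y ∈ K.verts, (y, x) ∈ st.1 ↔ K.Adj x y ∧ y 0 < x 0 := by
      intro y hy
      rw [hst]
      refine ⟨fun h => ⟨h.2.1.symm, h.2.2⟩, fun h => ⟨?_, h.1.symm, h.2⟩⟩
      have hy' : y ∈ pre ++ x :: post := by rwa [← hV, PlaneComplex.mem_sortedVerts]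
      rcases List.mem_append.1 hy' with hy' | hy'
      · exact hy'
      · rcases List.mem_cons.1 hy' with rfl | hy'
        · exact absurd h.2 (lt_irrefl _)
        · exact absurd h.2 ((List.pairwise_cons.1 (List.pairwise_append.1 hpw).2.1).1 y hy').not_gt
    have hs := searchInterval_sweep (O := O) hK hx hS
      (hqs _ ((sweepStep_snd O K.sortedVerts st x).subset he))
      (fun s hs => hqs s (List.mem_append_right _ hs))
    have hstep : sweepStep O K.sortedVerts st x = (st.1 ++
        ((K.sortedVerts.filter (fun y => (y, x) ∈ st.1) ++
          (upVerts K.sortedVerts x).filter (fun y => K.Adj x y)).filter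
            (fun y => height e₁ x < height e₁ y)).map (fun y => (x, y)),
        st.2 ++ K.sweepQueries x) := by
      unfold sweepStep
      simp only
      rw [hs]
    have := ih (pre ++ [x]) (sweepStep O K.sortedVerts st x) (by rw [hV]; simp) (fun a b => by
      rw [hstep]
      simp only [height_e₁, List.filter_append, List.map_append, List.mem_append, hst, List.mem_map,
        List.mem_filter, decide_eq_true_eq, Prod.mk.injEq, mem_upVerts,
        PlaneComplex.mem_sortedVerts, List.mem_singleton]
      constructor
      -- An edge is old, or comes from a known neighbour (impossible, as these lie to the left of
      -- `x`), or is newly found.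
      · rintro (h | ⟨y, ⟨⟨_, _, _, h1⟩, h2⟩, rfl, rfl⟩ | ⟨y, ⟨⟨⟨h1, h2⟩, h3⟩, -⟩, rfl, rfl⟩)
        · exact ⟨Or.inl h.1, h.2⟩
        · exact absurd h1 h2.not_gt
        · exact ⟨Or.inr rfl, h3, h2⟩
      · rintro ⟨h1 | rfl, h2, h3⟩
        · exact Or.inl ⟨h1, h2, h3⟩
        · exact Or.inr (Or.inr ⟨b, ⟨⟨⟨h2.mem_right, h3⟩, h2⟩, h3⟩, rfl, rfl⟩))
      ((sweepStep_snd O K.sortedVerts st x).subset he) hq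
    refine ⟨this.1, ?_⟩
    rw [this.2, hstep]
    simp

/-- The algorithm finds the vertices and the edges of every complex with which the answers of the
oracle are compatible. -/
theorem algorithm_spec {O : Oracle} {K : PlaneComplex} (hK : GeneralPosition K.verts)
    (h : ∀ s ∈ queries O, Consistent O K s) :
    findVerts O = K.sortedVerts ∧
    (∀ a b, (a, b) ∈ (findEdges O (findVerts O)).1 ↔ K.Adj a b ∧ a 0 < b 0) ∧
    queries O = e₁ :: e₂ :: vertexTilt O :: -e₁ :: K.sortedVerts.flatMap K.sweepQueries := by
  have hV : findVerts O = K.sortedVerts := findVerts_eq hK.injOn_fst (h _ (by simp [queries]))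
    (h _ (by simp [queries])) (h _ (by simp [queries]))
  have := foldl_sweepStep (O := O) hK K.sortedVerts [] ([], [-e₁]) (by simp) (by simp) (by simp)
    (fun s hs => h s (by
      rw [queries, hV]
      exact List.mem_cons_of_mem _ (List.mem_cons_of_mem _ (List.mem_cons_of_mem _ hs))))
  refine ⟨hV, fun a b => ?_, ?_⟩
  · rw [hV, findEdges, this.1]
    refine and_iff_right_of_imp fun h => PlaneComplex.mem_sortedVerts.2 h.1.mem_left
  · rw [queries, hV, findEdges, this.2]
    rfl

/-! ### Faithfulness -/

theorem PlaneComplex.mem_faces_iff {K : PlaneComplex} (hK : K.IsGraph) {σ : Finset Plane} :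
    σ ∈ K.faces ↔ (∃ x ∈ K.verts, σ = {x}) ∨ ∃ x y, K.Adj x y ∧ σ = {x, y} := by
  constructor
  · intro h
    have h1 := hK σ h
    have h2 := Finset.card_pos.2 (K.nonempty_of_mem_faces h)
    rcases (by omega : σ.card = 1 ∨ σ.card = 2) with h3 | h3
    · obtain ⟨x, rfl⟩ := Finset.card_eq_one.1 h3
      exact Or.inl ⟨x, h, rfl⟩
    · obtain ⟨x, y, hxy, rfl⟩ := Finset.card_eq_two.1 h3
      refine Or.inr ⟨x, y, ⟨?_, hxy⟩, ?_⟩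
      · convert h
      · congr!
  · rintro (⟨x, hx, rfl⟩ | ⟨x, y, hxy, rfl⟩)
    · exact hx
    · exact hxy.1

theorem isGraph_of_simplexCount {K : PlaneComplex} {s : Direction}
    (h : ∀ k, 2 ≤ k → ∀ c, simplexCount K s k c = 0) : K.IsGraph := by
  intro σ hσ
  by_contra hn
  have h1 := h (σ.card - 1) (by omega) (lowerStar s σ)
  rw [simplexCount, Set.ncard_eq_zero (K.finite_faces.subset fun _ h => h.1)] at h1
  exact (h1 ▸ (show σ ∈ {τ : Finset Plane | τ ∈ K.faces ∧ τ.card = σ.card - 1 + 1 ∧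
    lowerStar s τ = lowerStar s σ} from ⟨hσ, by omega, rfl⟩) : σ ∈ (∅ : Set _))

theorem simplexCount_eq_zero_of_isGraph {K : PlaneComplex} (hK : K.IsGraph) (s : Direction)
    {k : ℕ} (hk : 2 ≤ k) (c : ℝ) : simplexCount K s k c = 0 := by
  rw [simplexCount]
  rw [Set.ncard_eq_zero (K.finite_faces.subset fun _ h => h.1), Set.eq_empty_iff_forall_notMem]
  rintro σ ⟨h1, h2, -⟩
  have := hK σ h1
  omega

/-- Nothing is assumed about the competitor `K`. Counts in direction `e₁` bound its dimension and
separate its first coordinates; this suffices to recover its vertices, which then inherit general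
position from `G` and make the edge search applicable. -/
theorem eq_of_simplexCount_eq {O : Oracle} {G K : PlaneComplex} (hG : G.IsGraph)
    (hV : GeneralPosition G.verts) (hO : ∀ s ∈ queries O, Consistent O G s)
    (h : ∀ s ∈ queries O, ∀ k c, simplexCount K s k c = simplexCount G s k c) : K = G := by
  have h₁ : e₁ ∈ queries O := by simp [queries]
  have hO' : ∀ s ∈ queries O, Consistent O K s := fun s hs => (hO s hs).congr (h s hs)
  have hK : K.IsGraph := isGraph_of_simplexCount (s := e₁) fun k hk c => by
    rw [h _ h₁, simplexCount_eq_zero_of_isGraph hG _ hk]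
  have hinj : Set.InjOn (fun x : Plane => x 0) K.verts := injOn_fst_of_count_le_one fun c => by
    rw [h _ h₁]; exact count_le_one_of_injOn_fst hV.injOn_fst c
  have hverts : K.verts = G.verts := by
    refine verts_eq_of_findVerts_eq ?_
    rw [← findVerts_eq hinj (hO' _ h₁) (hO' _ (by simp [queries])) (hO' _ (by simp [queries])),
      (algorithm_spec hV hO).1]
  have hVK : GeneralPosition K.verts := by rw [hverts]; exact hV
  have hadj : ∀ a b, a 0 < b 0 → (K.Adj a b ↔ G.Adj a b) := fun a b hab => by
    have h1 := (algorithm_spec hVK hO').2.1 a b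
    rw [(algorithm_spec hV hO).2.1 a b] at h1
    simpa [hab] using h1.symm
  have hadj' : ∀ a b, K.Adj a b ↔ G.Adj a b := by
    intro a b
    have key : ∀ L : PlaneComplex, Set.InjOn (fun x : Plane => x 0) L.verts → L.Adj a b →
        a 0 < b 0 ∨ b 0 < a 0 := fun L hL h =>
      lt_or_gt_of_ne fun he => h.2 (hL h.mem_left h.mem_right he)
    have sw : ∀ L : PlaneComplex, L.Adj a b ↔ L.Adj b a := fun L => ⟨fun h => h.symm, fun h => h.symm⟩
    constructor
    · intro h
      rcases key K hinj h with h' | h'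
      · exact (hadj a b h').1 h
      · exact ((hadj b a h').1 h.symm).symm
    · intro h
      rcases key G hV.injOn_fst h with h' | h'
      · exact (hadj a b h').2 h
      · exact ((hadj b a h').2 h.symm).symm
  have hfaces : K.faces = G.faces := by
    ext σ
    rw [PlaneComplex.mem_faces_iff hK, PlaneComplex.mem_faces_iff hG, hverts]
    simp only [hadj']
  exact PlaneComplex.ext hfaces

theorem isFaithfulDiscretization_queriedDirections (F : Type u) [Field F] (ι : IndexChoice)
    {G : PlaneComplex} (hG : G.IsGraph) (hV : GeneralPosition G.verts) {α : Type v}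
    {D : PlaneComplex → Direction → α} (hD : DimensionReturning D) :
    IsFaithfulDiscretization D G (queriedDirections (pht F ι G)) := fun K h =>
  eq_of_simplexCount_eq hG hV (fun s _ => consistent_pht F ι G s)
    (fun s hs => hD s K G (h s (by simpa [queriedDirections] using hs)))

/-! ### The number of queries -/

theorem length_splitQueries (x : Plane) (θ : ℝ) (l : List Plane) :
    (splitQueries x θ l).length = 2 * l.length := by
  simp [splitQueries, List.length_flatMap, mul_comm]

open Classical in
theorem countP_take_add_countP_drop (p : Plane → Prop) (I : List Plane) (i : ℕ) :
    (I.take i).countP (fun y => p y) + (I.drop i).countP (fun y => p y) =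
      I.countP (fun y => p y) := by
  rw [← List.countP_append, List.take_append_drop]

open Classical in
-- Only lists with a neighbour are split, so each level of the recursion has at most one split per
-- neighbour. Halving with the larger part ⌈n / 2⌉ gives `Nat.clog` levels.
theorem length_splitPoints_le (p : Plane → Prop) (n : ℕ) :
    ∀ I : List Plane, I.length = n →
      (splitPoints p I).length ≤ I.countP (fun y => p y) * Nat.clog 2 n := by
  induction n using Nat.strong_induction_on with
  | _ n ih =>
  intro I hn
  rw [splitPoints]
  split_ifs with h0 h1 h2
  · simp
  · simp
  · simp
  have hl := ih (I.take (I.length / 2)).length (by rw [List.length_take]; omega) _ rfl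
  have hr := ih (I.drop (I.length / 2)).length (by rw [List.length_drop]; omega) _ rfl
  have hc := countP_take_add_countP_drop p I (I.length / 2)
  have hlog : Nat.clog 2 n = Nat.clog 2 ((n + 1) / 2) + 1 :=
    Nat.clog_of_two_le (by norm_num) (by omega)
  have hl' : Nat.clog 2 (I.take (I.length / 2)).length ≤ Nat.clog 2 ((n + 1) / 2) :=
    Nat.clog_mono_right 2 (by rw [List.length_take]; omega)
  have hr' : Nat.clog 2 (I.drop (I.length / 2)).length ≤ Nat.clog 2 ((n + 1) / 2) :=
    Nat.clog_mono_right 2 (by rw [List.length_drop]; omega)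
  have hl2 := hl.trans (Nat.mul_le_mul_left _ hl')
  have hr2 := hr.trans (Nat.mul_le_mul_left _ hr')
  rw [List.length_cons, List.length_append, hlog, ← hc]
  have : 1 ≤ I.countP (fun y => decide (p y)) := Nat.pos_of_ne_zero h0
  rw [← hc] at this
  nlinarith

open Classical in
-- Following a half that contains a neighbour keeps at least ⌊n / 2⌋ vertices at each split.
theorem log_le_length_splitPoints (p : Plane → Prop) (n : ℕ) :
    ∀ I : List Plane, I.length = n → I.countP (fun y => p y) ≠ 0 →
      Nat.log 2 n ≤ (splitPoints p I).length := by
  induction n using Nat.strong_induction_on with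
  | _ n ih =>
  intro I hn h0
  rcases lt_or_ge n 2 with h2 | h2
  · rw [Nat.log_of_lt h2]; exact Nat.zero_le _
  rw [splitPoints, if_neg h0, if_neg (by omega), if_neg (by omega), Nat.log_of_one_lt_of_le
    (by norm_num) h2, List.length_cons, List.length_append, Nat.add_le_add_iff_right]
  have hc := countP_take_add_countP_drop p I (I.length / 2)
  by_cases hl0 : (I.take (I.length / 2)).countP (fun y => decide (p y)) = 0
  · have hr := ih (I.drop (I.length / 2)).length (by rw [List.length_drop]; omega) _ rfl
      (by omega)
    have : Nat.log 2 (n / 2) ≤ Nat.log 2 (I.drop (I.length / 2)).length :=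
      Nat.log_mono_right (by rw [List.length_drop]; omega)
    omega
  · have hl := ih (I.take (I.length / 2)).length (by rw [List.length_take]; omega) _ rfl hl0
    have : Nat.log 2 (n / 2) ≤ Nat.log 2 (I.take (I.length / 2)).length :=
      Nat.log_mono_right (by rw [List.length_take]; omega)
    omega

/-- A splitting vertex ends the left one of two nonempty parts, so some vertex follows it in the
list. This prevents repeated splitting vertices, and later it keeps the shifted angles inside their
windows. -/
theorem splitPoints_subset (p : Plane → Prop) (n : ℕ) :
    ∀ I : List Plane, I.length = n → ∀ y ∈ splitPoints p I, y ∈ I.dropLast := by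
  induction n using Nat.strong_induction_on with
  | _ n ih =>
  intro I hn y hy
  rw [splitPoints] at hy
  split_ifs at hy with h0 h1 h2
  · simp at hy
  · simp at hy
  · simp at hy
  rw [List.dropLast_eq_take]
  rcases List.mem_cons.1 hy with rfl | hy
  · rw [List.getD_eq_getElem _ _ (by omega : I.length / 2 - 1 < I.length)]
    exact List.mem_take_iff_getElem.2 ⟨I.length / 2 - 1, by omega, rfl⟩
  · rcases List.mem_append.1 hy with hy | hy
    · have := ih (I.take (I.length / 2)).length (by rw [List.length_take]; omega) _ rfl y hy
      exact (List.take_subset_take_left I (by omega : I.length / 2 ≤ I.length - 1))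
        (List.dropLast_subset _ this)
    · have := ih (I.drop (I.length / 2)).length (by rw [List.length_drop]; omega) _ rfl y hy
      obtain ⟨j, hj, rfl⟩ := List.mem_iff_getElem.1 this
      rw [List.length_dropLast, List.length_drop] at hj
      rw [List.getElem_dropLast, List.getElem_drop]
      exact List.mem_take_iff_getElem.2 ⟨I.length / 2 + j, by omega, rfl⟩

theorem nodup_splitPoints (p : Plane → Prop) (n : ℕ) :
    ∀ I : List Plane, I.length = n → I.Nodup → (splitPoints p I).Nodup := by
  induction n using Nat.strong_induction_on with
  | _ n ih =>
  intro I hn hI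
  rw [splitPoints]
  split_ifs with h0 h1 h2
  · exact List.nodup_nil
  · exact List.nodup_nil
  · exact List.nodup_nil
  have hd : List.Disjoint (I.take (I.length / 2)) (I.drop (I.length / 2)) :=
    List.disjoint_take_drop hI le_rfl
  have hlen : (I.take (I.length / 2)).length = I.length / 2 := by rw [List.length_take]; omega
  have hl : ∀ y ∈ splitPoints p (I.take (I.length / 2)), y ∈ (I.take (I.length / 2)).dropLast :=
    splitPoints_subset p _ _ rfl
  have hr : ∀ y ∈ splitPoints p (I.drop (I.length / 2)), y ∈ I.drop (I.length / 2) :=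
    fun y hy => List.dropLast_subset _ (splitPoints_subset p _ _ rfl y hy)
  have hi : I.length / 2 - 1 < I.length := by omega
  rw [List.getD_eq_getElem _ _ hi, List.nodup_cons, List.nodup_append']
  refine ⟨fun h => ?_, ih _ (by omega) _ rfl hI.take, ih _ (by rw [List.length_drop]; omega) _ rfl
    hI.drop, fun y h1 h2 => hd (List.dropLast_subset _ (hl y h1)) (hr y h2)⟩
  have hmem : I[I.length / 2 - 1] ∈ I.take (I.length / 2) :=
    List.mem_take_iff_getElem.2 ⟨_, by omega, rfl⟩
  rcases List.mem_append.1 h with h | h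
  · obtain ⟨j, hj, he⟩ := List.mem_iff_getElem.1 (hl _ h)
    rw [List.length_dropLast, hlen] at hj
    rw [List.getElem_dropLast, List.getElem_take] at he
    have := (hI.getElem_inj_iff (hi := by omega) (hj := hi)).1 he
    omega
  · exact hd hmem (hr _ h)

open Classical in
theorem sum_countP_upVerts_le (K : PlaneComplex) :
    (K.sortedVerts.map fun x => (upVerts K.sortedVerts x).countP (fun y => K.Adj x y)).sum ≤
      K.orientedEdges.ncard := by
  set l : List (Plane × Plane) := K.sortedVerts.flatMap fun x =>
    ((upVerts K.sortedVerts x).filter (fun y => K.Adj x y)).map (Prod.mk x) with hl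
  have hlen : l.length =
      (K.sortedVerts.map fun x => (upVerts K.sortedVerts x).countP (fun y => K.Adj x y)).sum := by
    simp [hl, List.length_flatMap, List.countP_eq_length_filter]
  have hnd : l.Nodup := by
    rw [hl, List.nodup_flatMap]
    refine ⟨fun x _ => ?_, K.nodup_sortedVerts.imp fun {a b} hab => ?_⟩
    · refine List.Nodup.map (fun a b h => (Prod.mk.inj h).2) (List.Nodup.filter _ ?_)
      exact (upVerts_perm _ x).nodup_iff.2 (K.nodup_sortedVerts.filter _)
    · rw [Function.onFun, List.disjoint_left]
      intro q hq hq'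
      obtain ⟨_, _, rfl⟩ := List.mem_map.1 hq
      obtain ⟨_, _, h⟩ := List.mem_map.1 hq'
      exact hab (Prod.mk.inj h).1.symm
  rw [← hlen, ← List.toFinset_card_of_nodup hnd, ← Set.ncard_coe_finset]
  refine Set.ncard_le_ncard (fun q hq => ?_) K.finite_orientedEdges
  simp only [hl, List.coe_toFinset, Set.mem_ofPred_eq, List.mem_flatMap, List.mem_map,
    List.mem_filter, mem_upVerts, decide_eq_true_eq] at hq
  obtain ⟨x, -, y, ⟨⟨-, h1⟩, h2⟩, rfl⟩ := hq
  exact ⟨h2.1, h1⟩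

/-- Four queries precede the searches; the factor 6 comes from two directions per split and at most
three edges per vertex. -/
theorem length_queries_le (F : Type u) [Field F] (ι : IndexChoice) {G : PlaneComplex}
    (hV : GeneralPosition G.verts) :
    (queries (pht F ι G)).length ≤ 4 + 6 * (G.verts.ncard * Nat.clog 2 G.verts.ncard) := by
  classical
  rw [(algorithm_spec hV fun s _ => consistent_pht F ι G s).2.2]
  simp only [List.length_cons, List.length_flatMap]
  have h1 : (G.sortedVerts.map fun x => (G.sweepQueries x).length).sum ≤
      (G.sortedVerts.map fun x => (upVerts G.sortedVerts x).countP (fun y => G.Adj x y) *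
        (2 * Nat.clog 2 G.verts.ncard)).sum := by
    refine List.sum_le_sum fun x _ => ?_
    rw [PlaneComplex.sweepQueries, length_splitQueries]
    have h2 := length_splitPoints_le (G.Adj x) _ (upVerts G.sortedVerts x) rfl
    have h3 : Nat.clog 2 (upVerts G.sortedVerts x).length ≤ Nat.clog 2 G.verts.ncard := by
      refine Nat.clog_mono_right 2 ?_
      rw [(upVerts_perm _ x).length_eq, ← G.length_sortedVerts]
      exact List.length_filter_le _ _
    have := h2.trans (Nat.mul_le_mul_left _ h3)
    linarith
  rw [List.sum_map_mul_right] at h1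
  have h2 := sum_countP_upVerts_le G
  have h3 := ncard_orientedEdges_le G hV.injOn_fst
  have h4 := h1.trans (Nat.mul_le_mul_right _ (h2.trans h3))
  have h5 : 3 * G.verts.ncard * (2 * Nat.clog 2 G.verts.ncard) =
    6 * (G.verts.ncard * Nat.clog 2 G.verts.ncard) := by ring
  omega

/-! ### Binary and natural logarithms in the upper bound -/

theorem natLog_le_two_mul_log {n : ℕ} (hn : 2 ≤ n) : (Nat.log 2 n : ℝ) ≤ 2 * Real.log n := by
  have h1 : (2 : ℝ) ^ Nat.log 2 n ≤ n := by exact_mod_cast Nat.pow_log_le_self 2 (by omega)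
  have h2 := Real.log_le_log (by positivity) h1
  rw [Real.log_pow] at h2
  have h3 := Real.log_two_gt_d9
  have h4 : (0 : ℝ) ≤ Nat.log 2 n := Nat.cast_nonneg _
  nlinarith

theorem one_le_mul_log {n : ℕ} (hn : 2 ≤ n) : 1 ≤ n * Real.log n := by
  have h2 : (2 : ℝ) ≤ n := by exact_mod_cast hn
  have h3 := Real.log_two_gt_d9
  have h4 := Real.log_le_log (by norm_num) h2
  nlinarith

theorem clog_le_four_mul_log {n : ℕ} (hn : 2 ≤ n) : (Nat.clog 2 n : ℝ) ≤ 4 * Real.log n := by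
  have h1 : Nat.clog 2 n ≤ Nat.log 2 n + 1 :=
    Nat.clog_le_of_le_pow (Nat.lt_pow_succ_log_self (by norm_num) n).le
  have h2 : 1 ≤ Nat.log 2 n := Nat.log_pos (by norm_num) hn
  have h3 : (Nat.clog 2 n : ℝ) ≤ 2 * Nat.log 2 n := by exact_mod_cast (by omega)
  linarith [natLog_le_two_mul_log hn]

theorem length_queries_le_mul_log (F : Type u) [Field F] (ι : IndexChoice) {G : PlaneComplex}
    (hV : GeneralPosition G.verts) {n : ℕ} (hn : 2 ≤ n) (hG : G.verts.ncard = n) :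
    ((queries (pht F ι G)).length : ℝ) ≤ 28 * (n * Real.log n) := by
  have h1 := length_queries_le F ι hV
  rw [hG] at h1
  have h2 : ((queries (pht F ι G)).length : ℝ) ≤ 4 + 6 * (n * Nat.clog 2 n) := by
    exact_mod_cast h1
  have h3 := mul_le_mul_of_nonneg_left (clog_le_four_mul_log hn) (Nat.cast_nonneg (α := ℝ) n)
  -- The constant is 28 = 4 + 6 * 4, the additive 4 being absorbed by 1 ≤ n log n.
  linarith [one_le_mul_log hn]

/-! ### A path on a parabola that needs many queries -/

/-- The point of the parabola with first coordinate `-2 ^ k`. -/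
noncomputable def parabolaPoint (k : ℕ) : Plane := !₂[-(2 : ℝ) ^ k, ((2 : ℝ) ^ k) ^ 2]

@[simp] theorem parabolaPoint_zero (k : ℕ) : parabolaPoint k 0 = -(2 : ℝ) ^ k := by
  simp [parabolaPoint]

@[simp] theorem parabolaPoint_one (k : ℕ) : parabolaPoint k 1 = ((2 : ℝ) ^ k) ^ 2 := by
  simp [parabolaPoint]

theorem parabolaPoint_fst_lt {k m : ℕ} : parabolaPoint k 0 < parabolaPoint m 0 ↔ m < k := by
  rw [parabolaPoint_zero, parabolaPoint_zero, neg_lt_neg_iff, pow_lt_pow_iff_right₀ (by norm_num)]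

theorem parabolaPoint_fst_inj {k m : ℕ} (h : parabolaPoint k 0 = parabolaPoint m 0) : k = m := by
  rcases lt_trichotomy k m with h' | h' | h'
  · exact absurd h (parabolaPoint_fst_lt.2 h').ne'
  · exact h'
  · exact absurd h (parabolaPoint_fst_lt.2 h').ne

theorem parabolaPoint_injective : Function.Injective parabolaPoint := fun k m h =>
  parabolaPoint_fst_inj (by rw [h])

theorem slopeOf_parabolaPoint {k m : ℕ} (h : m < k) :
    slopeOf (parabolaPoint k) (parabolaPoint m) = -((2 : ℝ) ^ m + 2 ^ k) := by
  have h1 := parabolaPoint_fst_lt.2 h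
  rw [slopeOf]
  simp only [parabolaPoint_zero, parabolaPoint_one] at h1 ⊢
  have : -(2 : ℝ) ^ m - -2 ^ k ≠ 0 := by linarith
  rw [div_eq_iff this]
  ring

theorem affineIndependent_coe_pair {a b : Plane} (h : a ≠ b) :
    AffineIndependent ℝ ((↑) : (({a, b} : Finset Plane)) → Plane) := by
  have h1 := (affineIndependent_of_ne ℝ h).range
  have h2 : Set.range ![a, b] = (({a, b} : Finset Plane) : Set Plane) := by
    simp [Matrix.range_cons, Set.pair_comm]
  rw [h2] at h1
  exact h1

theorem affineIndependent_coe_of_not_collinear {t : Finset Plane} (ht : t.card = 3)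
    (h : ∀ x ∈ t, ∀ y ∈ t, ∀ z ∈ t, x ≠ y → x ≠ z → y ≠ z →
      ¬ Collinear ℝ ({x, y, z} : Set Plane)) :
    AffineIndependent ℝ ((↑) : t → Plane) := by
  classical
  obtain ⟨x, y, z, hxy, hxz, hyz, rfl⟩ := Finset.card_eq_three.1 ht
  have h0 := h x (by simp) y (by simp) z (by simp) hxy hxz hyz
  have h1 := (affineIndependent_iff_not_collinear_set.2 h0).range
  have h2 : Set.range ![x, y, z] = (({x, y, z} : Finset Plane) : Set Plane) := by
    ext w
    simp [Matrix.range_cons]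
    tauto
  rw [h2] at h1
  exact h1

theorem not_collinear_parabolaPoint {i j k : ℕ} (hij : i ≠ j) (hik : i ≠ k) (hjk : j ≠ k) :
    ¬ Collinear ℝ ({parabolaPoint i, parabolaPoint j, parabolaPoint k} : Set Plane) := by
  intro h
  obtain ⟨v, hv⟩ := (collinear_iff_of_mem (p₀ := parabolaPoint i) (by simp)).1 h
  obtain ⟨r, hr⟩ := hv (parabolaPoint j) (by simp)
  obtain ⟨q, hq⟩ := hv (parabolaPoint k) (by simp)
  have r0 := congrArg (fun p : Plane => p 0) hr
  have r1 := congrArg (fun p : Plane => p 1) hr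
  have q0 := congrArg (fun p : Plane => p 0) hq
  have q1 := congrArg (fun p : Plane => p 1) hq
  simp only [vadd_eq_add, PiLp.add_apply, PiLp.smul_apply, smul_eq_mul, parabolaPoint_zero,
    parabolaPoint_one] at r0 r1 q0 q1
  have key : ∀ {a b : ℕ}, a ≠ b → (2 : ℝ) ^ a - 2 ^ b ≠ 0 := fun hab h0 => by
    refine hab (parabolaPoint_fst_inj ?_)
    simp only [parabolaPoint_zero]
    linarith
  -- Collinear points on a parabola make the Vandermonde determinant of their abscissae vanish.
  have : ((2 : ℝ) ^ j - 2 ^ i) * (2 ^ k - 2 ^ i) * (2 ^ k - 2 ^ j) = 0 := by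
    generalize (2 : ℝ) ^ i = a at *
    generalize (2 : ℝ) ^ j = b at *
    generalize (2 : ℝ) ^ k = c at *
    have e1 : b - a = -(r * v 0) := by linarith
    have e2 : c - a = -(q * v 0) := by linarith
    have e3 : b ^ 2 - a ^ 2 = r * v 1 := by linarith
    have e4 : c ^ 2 - a ^ 2 = q * v 1 := by linarith
    have e5 : (b - a) * (c ^ 2 - a ^ 2) = (c - a) * (b ^ 2 - a ^ 2) := by
      rw [e1, e2, e3, e4]; ring
    linear_combination e5
  rcases mul_eq_zero.1 this with h1 | h1
  · rcases mul_eq_zero.1 h1 with h1 | h1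
    · exact key hij.symm h1
    · exact key hik.symm h1
  · exact key hjk.symm h1

theorem eq_left_of_mem_convexHull_pair {u v p : Plane} (h : u = v ∨ u 0 < v 0)
    (hp : p ∈ convexHull ℝ (({u, v} : Finset Plane) : Set Plane)) (h0 : p 0 ≤ u 0) : p = u := by
  rw [Finset.coe_pair, convexHull_pair] at hp
  obtain ⟨a, b, ha, hb, hab, rfl⟩ := hp
  rcases h with rfl | h
  · rw [← add_smul, hab, one_smul]
  · have ha' : a = 1 - b := by linarith
    subst ha'
    simp only [PiLp.add_apply, PiLp.smul_apply, smul_eq_mul] at h0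
    have hb0 : b = 0 := by
      by_contra hne
      have : 0 < b := lt_of_le_of_ne hb (Ne.symm hne)
      nlinarith
    rw [hb0]; simp

/-- The simplices of the path through the first `n` points `parabolaPoint k`. -/
def parabolaFaces (n : ℕ) : Set (Finset Plane) :=
  {σ | ∃ i j, i ≤ j ∧ j ≤ i + 1 ∧ j < n ∧ σ = {parabolaPoint j, parabolaPoint i}}

theorem parabolaFaces_inter {i j i' j' : ℕ} (hij : i ≤ j) (hij' : i' ≤ j')
    (h : j ≤ i') :
    convexHull ℝ (({parabolaPoint j, parabolaPoint i} : Finset Plane) : Set Plane) ∩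
      convexHull ℝ (({parabolaPoint j', parabolaPoint i'} : Finset Plane) : Set Plane) ⊆
    convexHull ℝ ((({parabolaPoint j, parabolaPoint i} : Finset Plane) : Set Plane) ∩
      (({parabolaPoint j', parabolaPoint i'} : Finset Plane) : Set Plane)) := by
  rintro p ⟨hp, hp'⟩
  have hle : ∀ {a b : ℕ}, a ≤ b → parabolaPoint b 0 ≤ parabolaPoint a 0 := fun hab => by
    simp only [parabolaPoint_zero, neg_le_neg_iff]
    exact pow_le_pow_right₀ (by norm_num) hab
  have h1 := fst_mem_of_mem_convexHull_pair hp (hle hij)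
  have h2 := fst_mem_of_mem_convexHull_pair hp' (hle hij')
  have h3 := hle h
  have hji : j = i' := parabolaPoint_fst_inj (le_antisymm (h1.1.trans h2.2) h3)
  have hpj : p = parabolaPoint j := by
    refine eq_left_of_mem_convexHull_pair ?_ hp (h2.2.trans h3)
    rcases hij.eq_or_lt with rfl | hlt
    · exact Or.inl rfl
    · exact Or.inr (parabolaPoint_fst_lt.2 hlt)
  refine subset_convexHull ℝ _ ⟨?_, ?_⟩
  · rw [hpj]; simp
  · rw [hpj, hji]; simp

theorem finset_pair_self (a : Plane) : ({a, a} : Finset Plane) = {a} := by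
  ext; simp

/-- The path through the first `n` points `parabolaPoint k`. -/
def parabolaPath (n : ℕ) : PlaneComplex where
  faces := parabolaFaces n
  isRelLowerSet_faces := by
    rintro σ ⟨i, j, hij, hji, hj, rfl⟩
    refine ⟨by simp, fun τ hτ hne => ?_⟩
    have hτ' : τ ⊆ {parabolaPoint j, parabolaPoint i} := hτ
    by_cases h1 : parabolaPoint j ∈ τ
    · by_cases h2 : parabolaPoint i ∈ τ
      · refine ⟨i, j, hij, hji, hj, hτ'.antisymm ?_⟩
        intro x hx
        simp only [Finset.mem_insert, Finset.mem_singleton] at hx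
        rcases hx with rfl | rfl <;> assumption
      · refine ⟨j, j, le_rfl, by omega, hj, ?_⟩
        ext x
        rw [finset_pair_self, Finset.mem_singleton]
        refine ⟨fun hx => ?_, fun hx => hx ▸ h1⟩
        have := hτ' hx
        simp only [Finset.mem_insert, Finset.mem_singleton] at this
        rcases this with h | h
        · exact h
        · exact absurd (h ▸ hx) h2
    · refine ⟨i, i, le_rfl, by omega, by omega, ?_⟩
      have hsub : ∀ x ∈ τ, x = parabolaPoint i := fun x hx => by
        have := hτ' hx
        simp only [Finset.mem_insert, Finset.mem_singleton] at this
        rcases this with h | h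
        · exact absurd (h ▸ hx) h1
        · exact h
      ext x
      rw [finset_pair_self, Finset.mem_singleton]
      refine ⟨hsub x, ?_⟩
      rintro rfl
      obtain ⟨y, hy⟩ := hne
      exact hsub y hy ▸ hy
  indep := by
    rintro σ ⟨i, j, hij, hji, hj, rfl⟩
    by_cases h : i = j
    · subst h
      have : Subsingleton (({parabolaPoint i, parabolaPoint i} : Finset Plane)) := by
        rw [finset_pair_self]; infer_instance
      exact affineIndependent_of_subsingleton ℝ _
    · exact affineIndependent_coe_pair fun he => h (parabolaPoint_injective he).symm
  inter_subset_convexHull := by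
    rintro s t ⟨i, j, hij, hji, hj, rfl⟩ ⟨i', j', hij', hji', hj', rfl⟩
    -- For different lower indices the segments lie over intervals with at most an endpoint in
    -- common, since `j ≤ i + 1`. For equal ones `j` and `j'` are both in `{i, i + 1}`, and one
    -- simplex is a face of the other.
    rcases lt_trichotomy i i' with h | h | h
    · exact parabolaFaces_inter hij hij' (by omega)
    · subst h
      rcases le_total j j' with hle | hle
      · have : ({parabolaPoint j, parabolaPoint i} : Finset Plane) ⊆
            {parabolaPoint j', parabolaPoint i} := by
          rcases (by omega : j = j' ∨ j = i) with rfl | rfl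
          · exact subset_rfl
          · intro x hx; simp only [Finset.mem_insert, Finset.mem_singleton] at hx ⊢; tauto
        rw [Set.inter_eq_left.2 (Finset.coe_subset.2 this)]
        exact Set.inter_subset_left
      · have : ({parabolaPoint j', parabolaPoint i} : Finset Plane) ⊆
            {parabolaPoint j, parabolaPoint i} := by
          rcases (by omega : j = j' ∨ j' = i) with rfl | rfl
          · exact subset_rfl
          · intro x hx; simp only [Finset.mem_insert, Finset.mem_singleton] at hx ⊢; tauto
        rw [Set.inter_eq_right.2 (Finset.coe_subset.2 this)]
        exact Set.inter_subset_right
    · rw [Set.inter_comm, Set.inter_comm (SetLike.coe _)]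
      exact parabolaFaces_inter hij' hij (by omega)
  finite_faces := by
    classical
    refine (((Finset.range n) ×ˢ (Finset.range n)).image (fun p : ℕ × ℕ =>
      ({parabolaPoint p.2, parabolaPoint p.1} : Finset Plane))).finite_toSet.subset ?_
    rintro σ ⟨i, j, hij, hji, hj, rfl⟩
    simp only [Finset.coe_image, Set.mem_image, Finset.mem_coe, Finset.mem_product,
      Finset.mem_range]
    exact ⟨(i, j), ⟨by omega, hj⟩, by congr!⟩

theorem mem_verts_parabolaPath {n : ℕ} {x : Plane} :
    x ∈ (parabolaPath n).verts ↔ ∃ k < n, x = parabolaPoint k := by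
  constructor
  · rintro ⟨i, j, hij, hji, hj, he⟩
    refine ⟨j, hj, ?_⟩
    have : parabolaPoint j ∈ ({x} : Finset Plane) := by rw [he]; simp
    exact (Finset.mem_singleton.1 this).symm
  · rintro ⟨k, hk, rfl⟩
    exact ⟨k, k, le_rfl, by omega, hk, (finset_pair_self _).symm⟩

theorem isGraph_parabolaPath (n : ℕ) : (parabolaPath n).IsGraph := by
  rintro σ ⟨i, j, -, -, -, rfl⟩
  exact Finset.card_le_two

theorem generalPosition_parabolaPath (n : ℕ) : GeneralPosition (parabolaPath n).verts := by
  have h : ∀ x ∈ (parabolaPath n).verts, ∀ y ∈ (parabolaPath n).verts,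
      ∀ z ∈ (parabolaPath n).verts, x ≠ y → x ≠ z → y ≠ z →
      ¬ Collinear ℝ ({x, y, z} : Set Plane) := by
    intro x hx y hy z hz hxy hxz hyz
    obtain ⟨i, -, rfl⟩ := mem_verts_parabolaPath.1 hx
    obtain ⟨j, -, rfl⟩ := mem_verts_parabolaPath.1 hy
    obtain ⟨k, -, rfl⟩ := mem_verts_parabolaPath.1 hz
    exact not_collinear_parabolaPoint (fun h => hxy (h ▸ rfl)) (fun h => hxz (h ▸ rfl))
      (fun h => hyz (h ▸ rfl))
  refine ⟨fun t ht hc => ?_, h, ?_⟩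
  · exact affineIndependent_coe_of_not_collinear hc fun x hx y hy z hz =>
      h x (ht hx) y (ht hy) z (ht hz)
  · intro x hx y hy hxy
    obtain ⟨i, -, rfl⟩ := mem_verts_parabolaPath.1 hx
    obtain ⟨j, -, rfl⟩ := mem_verts_parabolaPath.1 hy
    rw [parabolaPoint_fst_inj hxy]

theorem ncard_verts_parabolaPath (n : ℕ) : (parabolaPath n).verts.ncard = n := by
  classical
  have : (parabolaPath n).verts = ↑((Finset.range n).image parabolaPoint) := by
    ext x
    simp [mem_verts_parabolaPath, eq_comm]
  rw [this, Set.ncard_coe_finset, Finset.card_image_of_injective _ parabolaPoint_injective,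
    Finset.card_range]

theorem adj_parabolaPath {n k : ℕ} (hk : k + 1 < n) :
    (parabolaPath n).Adj (parabolaPoint (k + 1)) (parabolaPoint k) :=
  ⟨⟨k, k + 1, by omega, le_rfl, hk, by congr!⟩, fun h => by
    have := parabolaPoint_injective h
    omega⟩

theorem mem_upVerts_parabolaPath {n k : ℕ} (hk : k < n) {y : Plane} :
    y ∈ upVerts (parabolaPath n).sortedVerts (parabolaPoint k) ↔
      ∃ m < k, y = parabolaPoint m := by
  rw [mem_upVerts, PlaneComplex.mem_sortedVerts, mem_verts_parabolaPath]
  constructor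
  · rintro ⟨⟨m, hm, rfl⟩, h⟩
    exact ⟨m, parabolaPoint_fst_lt.1 h, rfl⟩
  · rintro ⟨m, hm, rfl⟩
    exact ⟨⟨m, by omega, rfl⟩, parabolaPoint_fst_lt.2 hm⟩

theorem length_upVerts_parabolaPath {n k : ℕ} (hk : k < n) :
    (upVerts (parabolaPath n).sortedVerts (parabolaPoint k)).length = k := by
  classical
  have hnd : (upVerts (parabolaPath n).sortedVerts (parabolaPoint k)).Nodup :=
    (upVerts_perm _ _).nodup_iff.2 ((parabolaPath n).nodup_sortedVerts.filter _)
  have : (upVerts (parabolaPath n).sortedVerts (parabolaPoint k)).toFinset =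
      (Finset.range k).image parabolaPoint := by
    ext y
    rw [List.mem_toFinset, mem_upVerts_parabolaPath hk]
    simp [eq_comm]
  rw [← List.toFinset_card_of_nodup hnd, this,
    Finset.card_image_of_injective _ parabolaPoint_injective, Finset.card_range]

/-! ### Distinctness of the directions queried on the path -/

theorem dirOfAngle_sub_injOn :
    Set.InjOn (fun t => dirOfAngle (t - Real.pi / 2)) (Set.Ioo (-(Real.pi / 2)) (Real.pi / 2)) := by
  intro a ha b hb h
  have h0 := congrArg (fun s : Direction => (s : Plane) 0) h
  simp only [dirOfAngle, PiLp.toLp_apply, Matrix.cons_val_zero, Real.cos_sub_pi_div_two] at h0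
  exact Real.injOn_sin ⟨ha.1.le, ha.2.le⟩ ⟨hb.1.le, hb.2.le⟩ h0

/-- The points at which the search at `parabolaPoint k` splits. -/
noncomputable def parabolaSplits (n k : ℕ) : List Plane :=
  splitPoints ((parabolaPath n).Adj (parabolaPoint k))
    (upVerts (parabolaPath n).sortedVerts (parabolaPoint k))

/-- A chord of the parabola has slope -(2 ^ m + 2 ^ k), and 0 < 2 ^ m < 2 ^ k. The window depends on
`k` only, and windows of different `k` are disjoint. -/
theorem angleFrom_parabolaPoint {m k : ℕ} (h : m < k) :
    Real.arctan (-(2 : ℝ) ^ (k + 1)) < angleFrom (parabolaPoint k) (parabolaPoint m) ∧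
      angleFrom (parabolaPoint k) (parabolaPoint m) < Real.arctan (-(2 : ℝ) ^ k) := by
  have h1 := abs_lt.1 (abs_angleFrom_lt (parabolaPoint_fst_lt.2 h))
  rw [← Real.arctan_tan h1.1 h1.2, tan_angleFrom, slopeOf_parabolaPoint h, Real.arctan_lt_arctan_iff,
    Real.arctan_lt_arctan_iff, pow_succ]
  have h2 : (2 : ℝ) ^ m < 2 ^ k := pow_lt_pow_right₀ (by norm_num) h
  have h3 : (0 : ℝ) < 2 ^ m := by positivity
  constructor <;> linarith

/-- The shift by θ / 2 does not leave the window: `y` is not the last vertex of the list, and the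
last one has an angle in the window smaller by at least θ. -/
theorem parabolaSplits_angle {n k : ℕ} (hk : k < n) {y : Plane} (hy : y ∈ parabolaSplits n k) :
    y ∈ (parabolaPath n).verts ∧ y ≠ parabolaPoint k ∧
    angleFrom (parabolaPoint k) y -
      minAngle (parabolaPath n).sortedVerts (parabolaPoint k) / 2 ∈
      Set.Ioo (Real.arctan (-(2 : ℝ) ^ (k + 1))) (Real.arctan (-(2 : ℝ) ^ k)) := by
  set V := (parabolaPath n).sortedVerts with hV
  set I := upVerts V (parabolaPoint k) with hI
  have hθ := angleBound_minAngle (generalPosition_parabolaPath n)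
    (fun y => PlaneComplex.mem_sortedVerts) (mem_verts_parabolaPath.2 ⟨k, hk, rfl⟩)
  rw [← hV] at hθ
  have hyI := splitPoints_subset _ _ _ rfl y hy
  have hne : I ≠ [] := by
    rintro h
    rw [← hI, h] at hyI
    simp at hyI
  have hpw := pairwise_upVerts hθ
  rw [← hV, ← hI, ← List.dropLast_append_getLast hne] at hpw
  have hlt := (List.pairwise_append.1 hpw).2.2 y hyI (I.getLast hne) (by simp)
  obtain ⟨m, hm, hym⟩ := (mem_upVerts_parabolaPath hk).1 (List.dropLast_subset _ hyI)
  obtain ⟨m', hm', hz⟩ := (mem_upVerts_parabolaPath hk).1 (List.getLast_mem hne)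
  rw [hz] at hlt
  have hyv : y ∈ (parabolaPath n).verts := mem_verts_parabolaPath.2 ⟨m, by omega, hym⟩
  have hzv : parabolaPoint m' ∈ (parabolaPath n).verts :=
    mem_verts_parabolaPath.2 ⟨m', by omega, rfl⟩
  have hyk : parabolaPoint k 0 < y 0 := by rw [hym]; exact parabolaPoint_fst_lt.2 hm
  have hyne : y ≠ parabolaPoint k := by rintro rfl; exact lt_irrefl _ hyk
  have hzk := parabolaPoint_fst_lt.2 hm'
  have hsub := hθ.lt_sub hyv hzv hyk hzk hlt
  have hpos := (hθ y hyv _ hzv hyne (fun h => hm'.ne (parabolaPoint_injective h))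
    (by rintro rfl; exact lt_irrefl _ hlt)).1
  refine ⟨hyv, hyne, ?_, ?_⟩
  · have := (angleFrom_parabolaPoint hm').1
    linarith
  · have := (angleFrom_parabolaPoint hm).2
    rw [← hym] at this
    linarith

/-- The direction determines the shifted angle, whose window determines `k`, and then the angle
determines the splitting vertex. Only one of the two opposite directions per split is counted. -/
theorem sum_length_parabolaSplits_le (F : Type u) [Field F] (ι : IndexChoice) (n : ℕ) :
    ∑ k ∈ Finset.range n, (parabolaSplits n k).length ≤
      (queriedDirections (pht F ι (parabolaPath n))).card := by
  classical
  have hV := generalPosition_parabolaPath n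
  have hnd : ∀ k, (parabolaSplits n k).Nodup := fun k => nodup_splitPoints _ _ _ rfl
    ((upVerts_perm _ _).nodup_iff.2 ((parabolaPath n).nodup_sortedVerts.filter _))
  have h1 : ∑ k ∈ Finset.range n, (parabolaSplits n k).length =
      ((Finset.range n).sigma fun k => (parabolaSplits n k).toFinset).card := by
    rw [Finset.card_sigma]
    exact Finset.sum_congr rfl fun k _ => (List.toFinset_card_of_nodup (hnd k)).symm
  rw [h1]
  refine Finset.card_le_card_of_injOn (fun q => splitDir (parabolaPoint q.1) q.2
    (minAngle (parabolaPath n).sortedVerts (parabolaPoint q.1))) ?_ ?_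
  · rintro ⟨k, y⟩ hq
    simp only [Finset.coe_sigma, Set.mem_sigma_iff, Finset.mem_coe, Finset.mem_range,
      List.mem_toFinset] at hq
    rw [Finset.mem_coe, queriedDirections, List.mem_toFinset,
      (algorithm_spec hV fun s _ => consistent_pht F ι _ s).2.2]
    refine List.mem_cons_of_mem _ (List.mem_cons_of_mem _ (List.mem_cons_of_mem _
      (List.mem_cons_of_mem _ (List.mem_flatMap.2 ⟨parabolaPoint k, ?_, ?_⟩))))
    · exact PlaneComplex.mem_sortedVerts.2 (mem_verts_parabolaPath.2 ⟨k, hq.1, rfl⟩)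
    · exact List.mem_flatMap.2 ⟨y, hq.2, by simp⟩
  · rintro ⟨k, y⟩ hq ⟨k', y'⟩ hq' h
    simp only [Finset.coe_sigma, Set.mem_sigma_iff, Finset.mem_coe, Finset.mem_range,
      List.mem_toFinset] at hq hq'
    obtain ⟨hy, hyk, hw⟩ := parabolaSplits_angle hq.1 hq.2
    obtain ⟨hy', hyk', hw'⟩ := parabolaSplits_angle hq'.1 hq'.2
    have hwin : ∀ {k : ℕ} {t : ℝ}, t ∈ Set.Ioo (Real.arctan (-(2 : ℝ) ^ (k + 1)))
        (Real.arctan (-(2 : ℝ) ^ k)) → t ∈ Set.Ioo (-(Real.pi / 2)) (Real.pi / 2) := fun ht =>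
      ⟨(Real.neg_pi_div_two_lt_arctan _).trans ht.1, ht.2.trans (Real.arctan_lt_pi_div_two _)⟩
    have heq := dirOfAngle_sub_injOn (hwin hw) (hwin hw') (by
      simp only [splitDir] at h ⊢
      rw [sub_right_comm, h, sub_right_comm])
    have hdis : ∀ {a b : ℕ} {t : ℝ}, t ∈ Set.Ioo (Real.arctan (-(2 : ℝ) ^ (a + 1)))
        (Real.arctan (-(2 : ℝ) ^ a)) → t ∈ Set.Ioo (Real.arctan (-(2 : ℝ) ^ (b + 1)))
        (Real.arctan (-(2 : ℝ) ^ b)) → ¬ a < b := by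
      intro a b t ha hb hab
      have h1 := Real.arctan_lt_arctan_iff.1 (ha.1.trans hb.2)
      rw [neg_lt_neg_iff, pow_lt_pow_iff_right₀ (by norm_num)] at h1
      omega
    have hkk : k = k' := by
      rw [← heq] at hw'
      exact le_antisymm (not_lt.1 (hdis hw' hw)) (not_lt.1 (hdis hw hw'))
    subst hkk
    have hyy : y = y' := by
      by_contra hne
      refine (angleBound_minAngle hV (fun y => PlaneComplex.mem_sortedVerts)
        (mem_verts_parabolaPath.2 ⟨k, hq.1, rfl⟩)).angleFrom_ne hy hy' hyk hyk' hne ?_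
      linarith
    rw [hyy]

theorem log_le_length_parabolaSplits {n k : ℕ} (hk : k < n) (hk0 : 0 < k) :
    Nat.log 2 k ≤ (parabolaSplits n k).length := by
  classical
  refine log_le_length_splitPoints _ _ _ (length_upVerts_parabolaPath hk) ?_
  obtain ⟨m, rfl⟩ : ∃ m, k = m + 1 := ⟨k - 1, by omega⟩
  rw [← Nat.pos_iff_ne_zero, List.countP_pos_iff]
  exact ⟨parabolaPoint m, (mem_upVerts_parabolaPath hk).2 ⟨m, by omega, rfl⟩,
    by simpa using adj_parabolaPath hk⟩

/-! ### Summing the logarithms in the lower bound -/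

theorem mul_log_le_sum_log (n : ℕ) :
    n / 2 * (Nat.log 2 n - 1) ≤ ∑ k ∈ Finset.range n, Nat.log 2 k := by
  -- Only the upper half of the indices is kept: there `k ≥ n / 2`, so the binary logarithm drops by
  -- at most one.
  have h1 : Finset.Ico (n - n / 2) n ⊆ Finset.range n := fun k hk =>
    Finset.mem_range.2 (Finset.mem_Ico.1 hk).2
  refine le_trans ?_ (Finset.sum_le_sum_of_subset h1)
  have h2 : ∀ k ∈ Finset.Ico (n - n / 2) n, Nat.log 2 n - 1 ≤ Nat.log 2 k := fun k hk => by
    rw [← Nat.log_div_base]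
    exact Nat.log_mono_right (by have := (Finset.mem_Ico.1 hk).1; omega)
  have h3 := Finset.card_nsmul_le_sum _ _ _ h2
  rwa [Nat.card_Ico, smul_eq_mul, show n - (n - n / 2) = n / 2 by omega] at h3

theorem log_le_natLog_add_one (n : ℕ) : Real.log n ≤ Nat.log 2 n + 1 := by
  rcases Nat.eq_zero_or_pos n with rfl | hn
  · simp
  have h4 : (n : ℝ) ≤ 2 ^ (Nat.log 2 n + 1) := by
    exact_mod_cast (Nat.lt_pow_succ_log_self (by norm_num) n).le
  have h5 := Real.log_le_log (by exact_mod_cast hn) h4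
  rw [Real.log_pow] at h5
  have h6 := Real.log_two_lt_d9
  push_cast at h5
  have : (0 : ℝ) ≤ Nat.log 2 n := Nat.cast_nonneg _
  nlinarith

theorem mul_log_le_of_half_mul_log_le {n c : ℕ} (hc : 1 ≤ c)
    (h : n / 2 * (Nat.log 2 n - 1) ≤ c) : 1 / 12 * (n * Real.log n) ≤ (c : ℝ) := by
  have h4 := mul_le_mul_of_nonneg_left (log_le_natLog_add_one n) (Nat.cast_nonneg (α := ℝ) n)
  -- For n ≥ 4 both n ≤ 3 * (n / 2) and log₂ n + 1 ≤ 3 * (log₂ n - 1) hold, whence 9. For n < 4 the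
  -- hypothesis may be void, and `1 ≤ c` is used instead.
  suffices h9 : n * (Nat.log 2 n + 1) ≤ 9 * c by
    have h10 : (n : ℝ) * (Nat.log 2 n + 1) ≤ 9 * c := by exact_mod_cast h9
    have h11 : (0 : ℝ) ≤ c := Nat.cast_nonneg _
    linarith
  rcases lt_or_ge n 4 with hn | hn
  · have h6 : Nat.log 2 n ≤ 1 := Nat.lt_succ_iff.1 (Nat.log_lt_of_lt_pow' (by norm_num) hn)
    exact (Nat.mul_le_mul (by omega : n ≤ 3) (by omega : _ ≤ 2)).trans (by omega)
  · have h5 : 2 ≤ Nat.log 2 n := Nat.le_log_of_pow_le (by norm_num) hn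
    refine (Nat.mul_le_mul (by omega : n ≤ 3 * (n / 2))
      (by omega : _ ≤ 3 * (Nat.log 2 n - 1))).trans ?_
    calc 3 * (n / 2) * (3 * (Nat.log 2 n - 1)) = 9 * (n / 2 * (Nat.log 2 n - 1)) := by ring
      _ ≤ 9 * c := Nat.mul_le_mul_left 9 h

theorem mul_log_le_card_queriedDirections (F : Type u) [Field F] (ι : IndexChoice) (n : ℕ) :
    1 / 12 * (n * Real.log n) ≤ ((queriedDirections (pht F ι (parabolaPath n))).card : ℝ) := by
  classical
  refine mul_log_le_of_half_mul_log_le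
    (Finset.card_pos.2 ⟨e₁, by simp [queriedDirections, queries]⟩) ((mul_log_le_sum_log n).trans
      (le_trans (Finset.sum_le_sum fun k hk => ?_) (sum_length_parabolaSplits_le F ι n)))
  rcases Nat.eq_zero_or_pos k with rfl | hk0
  · simp
  · exact log_le_length_parabolaSplits (Finset.mem_range.1 hk) hk0

end DirTransform

theorem mainTheorem7 :
    ∃ a b : ℝ, 0 < a ∧ 0 < b ∧
      ∀ (F : Type u) [Field F] (ι : IndexChoice),
        (∀ G : PlaneComplex, G.IsGraph → GeneralPosition G.verts →
          IsFaithfulDiscretization (pht F ι) G (queriedDirections (pht F ι G)) ∧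
          IsFaithfulDiscretization (bct F ι) G (queriedDirections (pht F ι G)) ∧
          ∀ (α : Type v) (D : PlaneComplex → Direction → α), DimensionReturning D →
            IsFaithfulDiscretization D G (queriedDirections (pht F ι G))) ∧
        (∀ n : ℕ, 2 ≤ n →
          (∀ G : PlaneComplex, G.IsGraph → GeneralPosition G.verts → G.verts.ncard = n →
            ((queries (pht F ι G)).length : ℝ) ≤ b * (n * Real.log n)) ∧
          ∃ G : PlaneComplex, G.IsGraph ∧ GeneralPosition G.verts ∧ G.verts.ncard = n ∧
            a * (n * Real.log n) ≤ ((queriedDirections (pht F ι G)).card : ℝ)) := by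
  refine ⟨1 / 12, 28, by norm_num, by norm_num, fun F _ ι => ⟨fun G hG hV => ⟨?_, ?_, ?_⟩,
    fun n hn => ⟨fun G _ hV hGn => length_queries_le_mul_log F ι hV hn hGn, ?_⟩⟩⟩
  · exact isFaithfulDiscretization_queriedDirections F ι hG hV (dimensionReturning_pht F ι)
  · exact isFaithfulDiscretization_queriedDirections F ι hG hV (dimensionReturning_bct F ι)
  · exact fun α D hD => isFaithfulDiscretization_queriedDirections F ι hG hV hD
  · exact ⟨parabolaPath n, isGraph_parabolaPath n, generalPosition_parabolaPath n,
      ncard_verts_parabolaPath n, mul_log_le_card_queriedDirections F ι n⟩
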